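/- **Theorem (Comparison).** Let $d\ge 1$, $T>0$, and let $\Omega\subset\mathbb R^d$ be a smooth bounded domain. Let $\mathcal P_{\rm sub}$ be the set of Borel measures $m\ge 0$ on $\Omega$ with $m(\Omega)\le 1$, with the metric $$\mathbf d(m,n)=\sup\Big\{\int_\Omega\varphi\,d(m-n)\ :\ \varphi:\overline\Omega\to\mathbb R\ \text{is 1-Lipschitz},\ \varphi=0\ \text{on}\ \partial\Omega\Big\};$$ all topological notions on $\mathcal P_{\rm sub}$ refer to $\mathbf d$. Write $m\in L^2$ if $m$ has a square-integrable density, also denoted $m$, and $\|m\|_2$ for its $L^2(\Omega)$ norm. A function $\Phi:\mathcal P_{\rm sub}\to\mathbb R$ has linear derivative $\frac{\delta\Phi}{\delta m}:\mathcal P_{\rm sub}\times\Omega\to\mathbb R$ if $\Phi(m')-\Phi(m)=\int_0^1\int_\Omega\frac{\delta\Phi}{\delta m}(rm'+(1-r)m,x)\,(m'-m)(dx)\,dr$ for all $m,m'$, and is $C^1$ if it has a continuous one. A *smooth test function* is a map $\Phi:[0,T]\times\mathcal P_{\rm sub}\to\mathbb R$ such that $\partial_t\Phi$, $\frac{\delta\Phi}{\delta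 m}$ and $\frac{\delta^2\Phi}{\delta m^2}(t,m,x,y)=\frac{\delta}{\delta m}\big[\frac{\delta\Phi}{\delta m}(t,m,x)\big](y)$ exist and are continuous, $\frac{\delta\Phi}{\delta m}(t,m,\cdot)\in C^2_c(\Omega)$ and $\frac{\delta^2\Phi}{\delta m^2}(t,m,\cdot,\cdot)\in C^1_c(\Omega\times\Omega)$ for all $(t,m)$, and $(t,m)\mapsto\frac{\delta\Phi}{\delta m}(t,m,\cdot)\in C^2(\overline\Omega)$ and $(t,m)\mapsto\frac{\delta^2\Phi}{\delta m^2}(t,m,\cdot,\cdot)\in C^1(\overline\Omega\times\overline\Omega)$ are continuous and bounded. Let $H:\Omega\times\mathbb R^d\to\mathbb R$ be Lipschitz, let $F,G:\mathcal P_{\rm sub}\to\mathbb R$ be $C^1$ and Lipschitz, and consider $$-\partial_tU-\int_\Omega\Delta_x\frac{\delta U}{\delta m}\,dm+\int_\Omega H\Big(x,D_x\frac{\delta U}{\delta m}\Big)dm=F(m)\ \text{ in }[0,T)\times\mathcal P_{\rm sub},\qquad U(T,\cdot)=G,\qquad \frac{\delta U}{\delta m}=0\ \text{ on }\partial\Omega.$$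 An upper semicontinuous $V:[0,T]\times\mathcal P_{\rm sub}\to\mathbb R$ is a *viscosity subsolution* if $V(T,\cdot)\le G$ and there is $C>0$ such that for every smooth test function $\Phi$, every $\delta>0$ and every $(t_0,m_0)\in[0,T)\times(\mathcal P_{\rm sub}\cap L^2)$ at which $V-\Phi-\delta\|m\|_2^2$ attains its maximum over $[0,T]\times(\mathcal P_{\rm sub}\cap L^2)$, one has $m_0\in H^1_0(\Omega)$ and $$-\partial_t\Phi(t_0,m_0)+\delta\int_\Omega|Dm_0|^2dx-\int_\Omega\Delta_x\frac{\delta\Phi}{\delta m}(t_0,m_0,x)\,m_0(x)\,dx+\int_\Omega H\Big(x,D_x\frac{\delta\Phi}{\delta m}(t_0,m_0,x)\Big)m_0(x)\,dx\le F(m_0)+C\delta\|m_0\|_2^2 .$$ A lower semicontinuous $V$ is a *viscosity supersolution* if $V(T,\cdot)\ge G$ and there is $C>0$ such that for all $\Phi$, $\delta>0$ and $(t_0,m_0)$ as above at which $V-\Phi+\delta\|m\|_2^2$ attains its minimum over $[0,T]\times(\mathcal P_{\rm sub}\cap L^2)$, one has $m_0\in H_0^1(\Omega)$ and $$-\partial_t\Phi(t_0,m_0)-\delta\int_\Omega|Dm_0|^2dx-\int_\Omega\Delta_x\frac{\delta\Phi}{\delta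 m}(t_0,m_0,x)\,m_0(x)\,dx+\int_\Omega H\Big(x,D_x\frac{\delta\Phi}{\delta m}(t_0,m_0,x)\Big)m_0(x)\,dx\ge F(m_0)-C\delta\|m_0\|_2^2 .$$ Let $V^-$ be a viscosity subsolution and $V^+$ a viscosity supersolution. Then $V^-(t,m)\le V^+(t,m)$ for all $t\in[0,T]$ and $m\in\mathcal P_{\rm sub}\cap L^2$; moreover, $V^-(t,m)\le V^+(t,m)$ for every $t\in[0,T]$ and every $m\in\mathcal P_{\rm sub}$ at which both $V^-(t,\cdot)$ and $V^+(t,\cdot)$ are continuous. In particular, if $V^-$ and $V^+$ are continuous, then $V^-\le V^+$ on $[0,T]\times\mathcal P_{\rm sub}$. -/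

import Mathlib

open Set Filter Topology MeasureTheory
open scoped NNReal ENNReal ContDiff Gradient Laplacian

noncomputable section

namespace AbsorbedMFC

/-- A smooth, bounded domain: bounded, open, connected (hence nonempty), and near each boundary
point the sublevel set of a smooth function with nonvanishing differential at that point. -/
structure IsSmoothBoundedDomain {d : ℕ} (Ω : Set (EuclideanSpace ℝ (Fin d))) : Prop where
  isOpen : IsOpen Ω
  isConnected : IsConnected Ω
  isBounded : Bornology.IsBounded Ω
  smooth_boundary : ∀ x ∈ frontier Ω, ∃ r : EuclideanSpace ℝ (Fin d) → ℝ,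
    ContDiff ℝ ∞ r ∧ r x = 0 ∧ fderiv ℝ r x ≠ 0 ∧ ∀ᶠ y in 𝓝 x, (y ∈ Ω ↔ r y < 0)

/-- Sub-probability measures on `Ω`, seen as Borel measures on `ℝ^d` carried by `Ω`. -/
def SubProb {d : ℕ} (Ω : Set (EuclideanSpace ℝ (Fin d))) : Type :=
  {m : Measure (EuclideanSpace ℝ (Fin d)) // m Ωᶜ = 0 ∧ m univ ≤ 1}

variable {d : ℕ} {Ω : Set (EuclideanSpace ℝ (Fin d))}

/-- The underlying measure. -/
def SubProb.meas (m : SubProb Ω) : Measure (EuclideanSpace ℝ (Fin d)) := m.1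

/-- The `1`-Lipschitz functions on the closure of `Ω` that vanish on the boundary. -/
def lipZero (Ω : Set (EuclideanSpace ℝ (Fin d))) : Set (EuclideanSpace ℝ (Fin d) → ℝ) :=
  {φ | LipschitzOnWith 1 φ (closure Ω) ∧ ∀ x ∈ frontier Ω, φ x = 0}

/-- The distance `d(m, n) = sup {∫ φ d(m - n) : φ ∈ lipZero Ω}`, as an extended nonnegative
number (it is finite when `Ω` is bounded and `d ≥ 1`). -/
instance : PseudoEMetricSpace (SubProb Ω) where
  edist m n := ⨆ φ ∈ lipZero Ω, ENNReal.ofReal (∫ x, φ x ∂m.meas - ∫ x, φ x ∂n.meas)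
  edist_self m := by simp
  edist_comm m n := by
    have key : ∀ m n : SubProb Ω,
        (⨆ φ ∈ lipZero Ω, ENNReal.ofReal (∫ x, φ x ∂m.meas - ∫ x, φ x ∂n.meas)) ≤
        ⨆ φ ∈ lipZero Ω, ENNReal.ofReal (∫ x, φ x ∂n.meas - ∫ x, φ x ∂m.meas) := by
      intro m n
      refine iSup₂_le fun φ hφ => ?_
      have hneg : (-φ) ∈ lipZero Ω := by
        refine ⟨hφ.1.neg, fun x hx => ?_⟩
        simp [hφ.2 x hx]
      refine le_trans (le_of_eq ?_)
        (le_iSup₂ (f := fun (φ : EuclideanSpace ℝ (Fin d) → ℝ) (_ : φ ∈ lipZero Ω) =>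
          ENNReal.ofReal (∫ x, φ x ∂n.meas - ∫ x, φ x ∂m.meas)) (-φ) hneg)
      simp only [Pi.neg_apply, integral_neg]
      congr 1
      ring
    exact le_antisymm (key m n) (key n m)
  edist_triangle l m n := by
    refine iSup₂_le fun φ hφ => ?_
    have h : (∫ x, φ x ∂l.meas - ∫ x, φ x ∂n.meas)
        = (∫ x, φ x ∂l.meas - ∫ x, φ x ∂m.meas) + (∫ x, φ x ∂m.meas - ∫ x, φ x ∂n.meas) := by
      ring
    rw [h]
    refine le_trans ENNReal.ofReal_add_le (add_le_add ?_ ?_)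
    · exact le_iSup₂ (f := fun (φ : EuclideanSpace ℝ (Fin d) → ℝ) (_ : φ ∈ lipZero Ω) =>
        ENNReal.ofReal (∫ x, φ x ∂l.meas - ∫ x, φ x ∂m.meas)) φ hφ
    · exact le_iSup₂ (f := fun (φ : EuclideanSpace ℝ (Fin d) → ℝ) (_ : φ ∈ lipZero Ω) =>
        ENNReal.ofReal (∫ x, φ x ∂m.meas - ∫ x, φ x ∂n.meas)) φ hφ

/-- The convex combination `r m' + (1 - r) m`. -/
def SubProb.mix (m m' : SubProb Ω) (r : unitInterval) : SubProb Ω :=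
  ⟨ENNReal.ofReal (r : ℝ) • m'.meas + ENNReal.ofReal (1 - (r : ℝ)) • m.meas, by
    constructor
    · have h₁ : m.meas Ωᶜ = 0 := m.2.1
      have h₂ : m'.meas Ωᶜ = 0 := m'.2.1
      simp [h₁, h₂]
    · have h₁ : m.meas univ ≤ 1 := m.2.2
      have h₂ : m'.meas univ ≤ 1 := m'.2.2
      have h : ENNReal.ofReal (r : ℝ) + ENNReal.ofReal (1 - (r : ℝ)) = 1 := by
        rw [← ENNReal.ofReal_add r.2.1 (sub_nonneg.2 r.2.2)]
        simp
      calc (ENNReal.ofReal (r : ℝ) • m'.meas + ENNReal.ofReal (1 - (r : ℝ)) • m.meas) univ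
          = ENNReal.ofReal (r : ℝ) * m'.meas univ
              + ENNReal.ofReal (1 - (r : ℝ)) * m.meas univ := by simp
        _ ≤ ENNReal.ofReal (r : ℝ) * 1 + ENNReal.ofReal (1 - (r : ℝ)) * 1 := by gcongr
        _ = 1 := by simpa using h⟩

/-- `D` is a linear functional derivative of `U`:
`U m' - U m = ∫₀¹ ∫_Ω D (r m' + (1 - r) m, x) (m' - m)(dx) dr` for all `m, m'`. -/
def HasLinearDerivative (U : SubProb Ω → ℝ)
    (D : SubProb Ω → EuclideanSpace ℝ (Fin d) → ℝ) : Prop :=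
  ∀ m m' : SubProb Ω, U m' - U m = ∫ r in (0 : ℝ)..1,
    (∫ x, D (m.mix m' (projIcc 0 1 zero_le_one r)) x ∂m'.meas
      - ∫ x, D (m.mix m' (projIcc 0 1 zero_le_one r)) x ∂m.meas)

/-- `U` is `C¹`: it has a continuous linear functional derivative on `SubProb Ω × Ω`. -/
def IsC1 (U : SubProb Ω → ℝ) : Prop :=
  ∃ D : SubProb Ω → EuclideanSpace ℝ (Fin d) → ℝ,
    ContinuousOn (fun p : SubProb Ω × EuclideanSpace ℝ (Fin d) => D p.1 p.2) (univ ×ˢ Ω) ∧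
    HasLinearDerivative U D

/-- `u ∈ C_c^k(S)`, where `u` is extended by zero outside `S`. -/
def IsCcOn {X : Type*} [NormedAddCommGroup X] [NormedSpace ℝ X] (k : ℕ∞) (S : Set X)
    (u : X → ℝ) : Prop :=
  ContDiff ℝ k u ∧ HasCompactSupport u ∧ tsupport u ⊆ S

/-- The map `(t, m) ↦ f t m ·` from `[0, T] × SubProb Ω` into functions with the `C^k` norm
(the supremum norms of the derivatives of order `≤ k`) is continuous and bounded. It is used for
functions that vanish outside a bounded set, so the supremum may be taken over the whole space. -/
def ContinuousBoundedInC {X : Type*} [NormedAddCommGroup X] [NormedSpace ℝ X] (k : ℕ) (T : ℝ)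
    (f : ℝ → SubProb Ω → X → ℝ) : Prop :=
  ∀ j ≤ k,
    (∀ p₀ ∈ Icc 0 T ×ˢ (univ : Set (SubProb Ω)),
      TendstoUniformly (fun (p : ℝ × SubProb Ω) x => iteratedFDeriv ℝ j (f p.1 p.2) x)
        (iteratedFDeriv ℝ j (f p₀.1 p₀.2)) (𝓝[Icc 0 T ×ˢ univ] p₀)) ∧
    ∃ B : ℝ, ∀ t ∈ Icc 0 T, ∀ m : SubProb Ω, ∀ x, ‖iteratedFDeriv ℝ j (f t m) x‖ ≤ B

/-- A smooth test function `Φ` on `[0, T] × SubProb Ω`, together with `∂_t Φ` (one-sided at the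
end points), `δΦ/δm` and `δ²Φ/δm²`. Joint continuity of the latter two follows from the
continuity into `C²` and `C¹`. -/
structure SmoothTestFunction (T : ℝ) (Ω : Set (EuclideanSpace ℝ (Fin d))) where
  /-- the function -/
  toFun : ℝ → SubProb Ω → ℝ
  /-- the time derivative -/
  dt : ℝ → SubProb Ω → ℝ
  /-- the first linear functional derivative -/
  dm : ℝ → SubProb Ω → EuclideanSpace ℝ (Fin d) → ℝ
  /-- the second linear functional derivative -/
  dmm : ℝ → SubProb Ω → EuclideanSpace ℝ (Fin d) × EuclideanSpace ℝ (Fin d) → ℝ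
  hasDeriv_dt : ∀ t ∈ Icc 0 T, ∀ m,
    HasDerivWithinAt (fun s => toFun s m) (dt t m) (Icc 0 T) t
  continuous_dt : ContinuousOn (fun p : ℝ × SubProb Ω => dt p.1 p.2) (Icc 0 T ×ˢ univ)
  hasDeriv_dm : ∀ t ∈ Icc 0 T, HasLinearDerivative (toFun t) (dm t)
  hasDeriv_dmm : ∀ t ∈ Icc 0 T, ∀ x ∈ Ω,
    HasLinearDerivative (fun m => dm t m x) (fun m y => dmm t m (x, y))
  dm_mem : ∀ t ∈ Icc 0 T, ∀ m, IsCcOn 2 Ω (dm t m)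
  dmm_mem : ∀ t ∈ Icc 0 T, ∀ m, IsCcOn 1 (Ω ×ˢ Ω) (dmm t m)
  continuous_dm : ContinuousBoundedInC 2 T dm
  continuous_dmm : ContinuousBoundedInC 1 T dmm

/-- The Lebesgue density of `m`. -/
def SubProb.density (m : SubProb Ω) (x : EuclideanSpace ℝ (Fin d)) : ℝ :=
  (m.meas.rnDeriv volume x).toReal

/-- `m ∈ L²(Ω)`: `m` has a square-integrable density. -/
def SubProb.InL2 (m : SubProb Ω) : Prop :=
  m.meas ≪ volume ∧ MemLp m.density 2 (volume.restrict Ω)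

/-- The squared `L²` norm of the density of `m`. -/
def SubProb.l2NormSq (m : SubProb Ω) : ℝ := ∫ x in Ω, m.density x ^ 2

/-- `u ∈ H₀¹(Ω)` with weak gradient `g`: `(u, g)` is a limit in `L²(Ω)` of `(φ, ∇φ)` with
`φ ∈ C_c^∞(Ω)`. -/
def IsH01 (Ω : Set (EuclideanSpace ℝ (Fin d))) (u : EuclideanSpace ℝ (Fin d) → ℝ)
    (g : EuclideanSpace ℝ (Fin d) → EuclideanSpace ℝ (Fin d)) : Prop :=
  MemLp u 2 (volume.restrict Ω) ∧ MemLp g 2 (volume.restrict Ω) ∧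
  ∃ φ : ℕ → EuclideanSpace ℝ (Fin d) → ℝ, (∀ n, IsCcOn ⊤ Ω (φ n)) ∧
    Tendsto (fun n => eLpNorm (fun x => φ n x - u x) 2 (volume.restrict Ω)) atTop (𝓝 0) ∧
    Tendsto (fun n => eLpNorm (fun x => ∇ (φ n) x - g x) 2 (volume.restrict Ω)) atTop (𝓝 0)

/-- Viscosity subsolutions of
`-∂_t U - ∫ Δ_x (δU/δm) dm + ∫ H(x, D_x (δU/δm)) dm = F(m)`, `U(T, ·) = G`,
`δU/δm = 0` on the boundary. -/
structure IsViscositySubsolution (T : ℝ) (Ω : Set (EuclideanSpace ℝ (Fin d)))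
    (H : EuclideanSpace ℝ (Fin d) → EuclideanSpace ℝ (Fin d) → ℝ) (F G : SubProb Ω → ℝ)
    (V : ℝ → SubProb Ω → ℝ) : Prop where
  usc : UpperSemicontinuousOn (fun p : ℝ × SubProb Ω => V p.1 p.2) (Icc 0 T ×ˢ univ)
  terminal : ∀ m, V T m ≤ G m
  test : ∃ C > 0, ∀ (Φ : SmoothTestFunction T Ω) (δ : ℝ), 0 < δ →
    ∀ t₀ ∈ Ico 0 T, ∀ m₀ : SubProb Ω, m₀.InL2 →
    IsMaxOn (fun p : ℝ × SubProb Ω => V p.1 p.2 - Φ.toFun p.1 p.2 - δ * p.2.l2NormSq)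
      (Icc 0 T ×ˢ {m | m.InL2}) (t₀, m₀) →
    ∃ g, IsH01 Ω m₀.density g ∧
      - Φ.dt t₀ m₀ + δ * (∫ x in Ω, ‖g x‖ ^ 2) - (∫ x, Δ (Φ.dm t₀ m₀) x ∂m₀.meas)
        + (∫ x, H x (∇ (Φ.dm t₀ m₀) x) ∂m₀.meas) ≤ F m₀ + C * δ * m₀.l2NormSq

/-- Viscosity supersolutions of the same equation. -/
structure IsViscositySupersolution (T : ℝ) (Ω : Set (EuclideanSpace ℝ (Fin d)))
    (H : EuclideanSpace ℝ (Fin d) → EuclideanSpace ℝ (Fin d) → ℝ) (F G : SubProb Ω → ℝ)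
    (V : ℝ → SubProb Ω → ℝ) : Prop where
  lsc : LowerSemicontinuousOn (fun p : ℝ × SubProb Ω => V p.1 p.2) (Icc 0 T ×ˢ univ)
  terminal : ∀ m, G m ≤ V T m
  test : ∃ C > 0, ∀ (Φ : SmoothTestFunction T Ω) (δ : ℝ), 0 < δ →
    ∀ t₀ ∈ Ico 0 T, ∀ m₀ : SubProb Ω, m₀.InL2 →
    IsMinOn (fun p : ℝ × SubProb Ω => V p.1 p.2 - Φ.toFun p.1 p.2 + δ * p.2.l2NormSq)
      (Icc 0 T ×ˢ {m | m.InL2}) (t₀, m₀) →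
    ∃ g, IsH01 Ω m₀.density g ∧
      F m₀ - C * δ * m₀.l2NormSq ≤
        - Φ.dt t₀ m₀ - δ * (∫ x in Ω, ‖g x‖ ^ 2) - (∫ x, Δ (Φ.dm t₀ m₀) x ∂m₀.meas)
          + (∫ x, H x (∇ (Φ.dm t₀ m₀) x) ∂m₀.meas)

end AbsorbedMFC

end

/-!
The metric `d` makes `SubProb Ω` compact, so one may double the variables and maximize
`V⁻(t, m) - V⁺(s, n)` minus a penalty on `t - s`, an `L²` penalty `δ (‖m‖² + ‖n‖²)` and a penalty
on `m - n`. The squared distance itself is not a smooth test function; it is replaced by the sum of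
the squares of the integrals of `m - n` against finitely many `φ ∈ C_c^∞(Ω)` that are orthonormal
in `H¹`. By compactness of `H₀¹(Ω) ⊂ L²(Ω)` the neglected coefficients cost only `η ‖m - n‖₂` in the
estimate of `∫ φ d(m - n)` for `H¹`-normalized `φ`. At a maximum point the densities are in `H₀¹`,
and the terms `δ ‖Dm‖²` of the two viscosity inequalities absorb the error due to the truncation.
-/

namespace AbsorbedMFC

/-! ### The distance on sub-probability measures -/

/-- The class of test functions of the distance after extension by zero: the `1`-Lipschitz
functions on the whole space that vanish outside `Ω`. -/
def zeroLip {X : Type*} [PseudoMetricSpace X] (Ω : Set X) : Set (X → ℝ) :=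
  {ψ | LipschitzWith 1 ψ ∧ ∀ x ∉ Ω, ψ x = 0}

section ZeroLip

variable {X : Type*} [PseudoMetricSpace X] {Ω : Set X}

lemma abs_sub_le_dist_of_mem_zeroLip {ψ : X → ℝ} (hψ : ψ ∈ zeroLip Ω) (x y : X) :
    |ψ x - ψ y| ≤ dist x y := by
  simpa [Real.dist_eq] using hψ.1.dist_le_mul x y

lemma abs_le_dist_of_mem_zeroLip {ψ : X → ℝ} (hψ : ψ ∈ zeroLip Ω) (x : X) {y : X} (hy : y ∉ Ω) :
    |ψ x| ≤ dist x y := by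
  simpa [hψ.2 y hy] using abs_sub_le_dist_of_mem_zeroLip hψ x y

lemma exists_abs_le_of_mem_zeroLip (hΩb : Bornology.IsBounded Ω) (hΩc : Ωᶜ.Nonempty) :
    ∃ D, ∀ ψ ∈ zeroLip Ω, ∀ x, |ψ x| ≤ D := by
  obtain ⟨y, hy⟩ := hΩc
  obtain ⟨r, hr⟩ := hΩb.subset_closedBall y
  refine ⟨max r 0, fun ψ hψ x => ?_⟩
  by_cases hx : x ∈ Ω
  · exact (abs_le_dist_of_mem_zeroLip hψ x hy).trans ((hr hx).trans (le_max_left _ _))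
  · simp [hψ.2 x hx]

lemma totallyBounded_range_restrict_zeroLip [CompactSpace (closure Ω)] (hΩc : Ωᶜ.Nonempty)
    (hΩb : Bornology.IsBounded Ω) :
    TotallyBounded (range fun ψ : zeroLip Ω => BoundedContinuousFunction.mkOfCompact
      (⟨fun x => ψ.1 x, ψ.2.1.continuous.comp continuous_subtype_val⟩ : C(closure Ω, ℝ))) := by
  obtain ⟨D, hD⟩ := exists_abs_le_of_mem_zeroLip hΩb hΩc
  refine (BoundedContinuousFunction.arzela_ascoli (Icc (-D) D) isCompact_Icc _ ?_ ?_
    ).totallyBounded.subset subset_closure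
  · rintro _ x ⟨ψ, rfl⟩
    exact abs_le.1 (hD ψ ψ.2 x)
  · refine (LipschitzWith.uniformEquicontinuous _ 1 ?_).equicontinuous
    rintro ⟨_, ψ, rfl⟩
    exact ψ.2.1.comp (LipschitzWith.subtype_val _) |>.weaken (by simp)

lemma exists_finite_net_zeroLip (hΩ : IsCompact (closure Ω)) (hΩc : Ωᶜ.Nonempty) {ε : ℝ}
    (hε : 0 < ε) :
    ∃ t : Set (zeroLip Ω), t.Finite ∧ ∀ ψ : zeroLip Ω, ∃ φ ∈ t, ∀ x ∈ Ω, |ψ.1 x - φ.1 x| ≤ ε := by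
  have : CompactSpace (closure Ω) := isCompact_iff_compactSpace.1 hΩ
  have htb := totallyBounded_iff_subset.1
    (totallyBounded_range_restrict_zeroLip hΩc (hΩ.isBounded.subset subset_closure)) _
    (Metric.dist_mem_uniformity hε)
  rw [← image_univ] at htb
  obtain ⟨t, -, ht, hcover⟩ := exists_subset_image_finite_and.1 htb
  refine ⟨t, ht, fun ψ => ?_⟩
  obtain ⟨_, ⟨φ, hφ, rfl⟩, hdist⟩ := mem_iUnion₂.1 (hcover (mem_image_of_mem _ (mem_univ ψ)))
  exact ⟨φ, hφ, fun x hx => (BoundedContinuousFunction.dist_coe_le_dist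
    (⟨x, subset_closure hx⟩ : closure Ω)).trans (le_of_lt hdist)⟩

end ZeroLip

section SubProb

variable {d : ℕ} {Ω : Set (EuclideanSpace ℝ (Fin d))}

instance (m : SubProb Ω) : IsFiniteMeasure m.meas :=
  ⟨m.2.2.trans_lt ENNReal.one_lt_top⟩

lemma SubProb.measureReal_univ_le (m : SubProb Ω) : m.meas.real univ ≤ 1 :=
  ENNReal.toReal_le_of_le_ofReal zero_le_one (ENNReal.ofReal_one ▸ m.2.2)

lemma SubProb.ae_mem (m : SubProb Ω) : ∀ᵐ x ∂m.meas, x ∈ Ω :=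
  ae_iff.2 m.2.1

lemma SubProb.restrict_meas (m : SubProb Ω) : m.meas.restrict Ω = m.meas :=
  Measure.restrict_eq_self_of_ae_mem m.ae_mem

lemma SubProb.abs_integral_sub_le (m : SubProb Ω) {φ ψ : EuclideanSpace ℝ (Fin d) → ℝ}
    (hφ : Integrable φ m.meas) (hψ : Integrable ψ m.meas) {ε : ℝ} (hε : 0 ≤ ε)
    (h : ∀ x ∈ Ω, |φ x - ψ x| ≤ ε) : |∫ x, φ x ∂m.meas - ∫ x, ψ x ∂m.meas| ≤ ε := by
  rw [← integral_sub hφ hψ]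
  exact (norm_integral_le_of_norm_le_const (f := fun x => φ x - ψ x) (m.ae_mem.mono h)).trans
    (mul_le_of_le_one_right hε m.measureReal_univ_le)

lemma SubProb.integrable_of_mem_zeroLip (m : SubProb Ω) (hΩb : Bornology.IsBounded Ω)
    (hΩc : Ωᶜ.Nonempty) {ψ : EuclideanSpace ℝ (Fin d) → ℝ} (hψ : ψ ∈ zeroLip Ω) :
    Integrable ψ m.meas := by
  obtain ⟨D, hD⟩ := exists_abs_le_of_mem_zeroLip hΩb hΩc
  exact .of_bound hψ.1.continuous.aestronglyMeasurable D (.of_forall (hD ψ hψ))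

lemma abs_le_dist_of_mem_lipZero {φ : EuclideanSpace ℝ (Fin d) → ℝ} (hφ : φ ∈ lipZero Ω)
    {x y : EuclideanSpace ℝ (Fin d)} (hx : x ∈ Ω) (hy : y ∉ Ω) : |φ x| ≤ dist x y := by
  obtain ⟨z, hz, hxz⟩ := exists_mem_frontier_infDist_compl_eq_dist hx
    (ne_univ_iff_exists_notMem Ω |>.2 ⟨y, hy⟩)
  calc |φ x| = dist (φ x) (φ z) := by simp [hφ.2 z hz]
    _ ≤ dist x z := by
        simpa using hφ.1.dist_le_mul x (subset_closure hx) z (frontier_subset_closure hz)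
    _ ≤ dist x y := hxz ▸ Metric.infDist_le_dist_of_mem hy

lemma indicator_mem_zeroLip {φ : EuclideanSpace ℝ (Fin d) → ℝ} (hφ : φ ∈ lipZero Ω) :
    Ω.indicator φ ∈ zeroLip Ω := by
  refine ⟨LipschitzWith.of_dist_le_mul fun x y => ?_, fun _ hx => indicator_of_notMem hx _⟩
  rw [NNReal.coe_one, one_mul, Real.dist_eq]
  by_cases hx : x ∈ Ω <;> by_cases hy : y ∈ Ω
  · simpa [hx, hy, Real.dist_eq] using
      hφ.1.dist_le_mul x (subset_closure hx) y (subset_closure hy)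
  · simpa [hx, hy] using abs_le_dist_of_mem_lipZero hφ hx hy
  · simpa [hx, hy, dist_comm] using abs_le_dist_of_mem_lipZero hφ hy hx
  · simp [hx, hy]

lemma zeroLip_subset_lipZero (hΩ : IsOpen Ω) : zeroLip Ω ⊆ lipZero Ω := fun _ hψ =>
  ⟨hψ.1.lipschitzOnWith, fun x hx => hψ.2 x (hΩ.frontier_eq ▸ hx).2⟩

lemma edist_le_ofReal {m n : SubProb Ω} {r : ℝ}
    (h : ∀ ψ ∈ zeroLip Ω, ∫ x, ψ x ∂m.meas - ∫ x, ψ x ∂n.meas ≤ r) :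
    edist m n ≤ ENNReal.ofReal r := by
  have hind : ∀ (p : SubProb Ω) (φ : EuclideanSpace ℝ (Fin d) → ℝ),
      ∫ x, Ω.indicator φ x ∂p.meas = ∫ x, φ x ∂p.meas :=
    fun p φ => integral_congr_ae (p.ae_mem.mono fun _ hx => indicator_of_mem hx φ)
  refine iSup₂_le fun φ hφ => ENNReal.ofReal_le_ofReal ?_
  simpa only [hind] using h _ (indicator_mem_zeroLip hφ)

lemma ofReal_integral_sub_le_edist (hΩ : IsOpen Ω) (m n : SubProb Ω)
    {ψ : EuclideanSpace ℝ (Fin d) → ℝ} (hψ : ψ ∈ zeroLip Ω) :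
    ENNReal.ofReal (∫ x, ψ x ∂m.meas - ∫ x, ψ x ∂n.meas) ≤ edist m n :=
  le_iSup₂ (f := fun (φ : EuclideanSpace ℝ (Fin d) → ℝ) (_ : φ ∈ lipZero Ω) =>
    ENNReal.ofReal (∫ x, φ x ∂m.meas - ∫ x, φ x ∂n.meas)) ψ (zeroLip_subset_lipZero hΩ hψ)

-- A finite uniform net of `zeroLip Ω` turns the pointwise convergence into a uniform one.
lemma tendsto_of_tendsto_integral (hΩb : Bornology.IsBounded Ω) (hΩc : Ωᶜ.Nonempty) {ι : Type*}
    {l : Filter ι} {u : ι → SubProb Ω} {m : SubProb Ω}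
    (h : ∀ ψ ∈ zeroLip Ω, Tendsto (fun i => ∫ x, ψ x ∂(u i).meas) l (𝓝 (∫ x, ψ x ∂m.meas))) :
    Tendsto u l (𝓝 m) := by
  refine EMetric.tendsto_nhds.2 fun r hr => ?_
  obtain ⟨ρ, hρ, hρr⟩ := ENNReal.lt_iff_exists_nnreal_btwn.1 hr
  have hε : 0 < (ρ : ℝ) / 3 := by have : 0 < ρ := mod_cast hρ; positivity
  obtain ⟨t, htf, ht⟩ := exists_finite_net_zeroLip hΩb.isCompact_closure hΩc hε
  filter_upwards [htf.eventually_all.2 fun φ _ => Metric.tendsto_nhds.1 (h φ φ.2) _ hε] with i hi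
  refine lt_of_le_of_lt (edist_le_ofReal fun ψ hψ => ?_) (ENNReal.ofReal_coe_nnreal ▸ hρr)
  obtain ⟨φ, hφt, hφ⟩ := ht ⟨ψ, hψ⟩
  have hψφ : ∀ n : SubProb Ω, |∫ x, ψ x ∂n.meas - ∫ x, φ.1 x ∂n.meas| ≤ ρ / 3 := fun n =>
    n.abs_integral_sub_le (n.integrable_of_mem_zeroLip hΩb hΩc hψ)
      (n.integrable_of_mem_zeroLip hΩb hΩc φ.2) hε.le hφ
  linarith [(abs_le.1 (hψφ (u i))).2, (abs_le.1 (hψφ m)).1, (abs_lt.1 (hi φ hφt)).2]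

/-- The restriction to `Ω` of a measure of mass at most one. -/
noncomputable def SubProb.ofMeasure (hΩ : MeasurableSet Ω)
    (μ : Measure (EuclideanSpace ℝ (Fin d))) (hμ : μ univ ≤ 1) : SubProb Ω :=
  ⟨μ.restrict Ω, by simp [Measure.restrict_apply hΩ.compl],
    (Measure.restrict_apply_le Ω univ).trans hμ⟩

lemma SubProb.integral_ofMeasure (hΩ : MeasurableSet Ω)
    (μ : Measure (EuclideanSpace ℝ (Fin d))) (hμ : μ univ ≤ 1)
    {ψ : EuclideanSpace ℝ (Fin d) → ℝ} (hψ : ψ ∈ zeroLip Ω) :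
    ∫ x, ψ x ∂(SubProb.ofMeasure hΩ μ hμ).meas = ∫ x, ψ x ∂μ :=
  setIntegral_eq_integral_of_forall_compl_eq_zero hψ.2

-- Restriction to `Ω` maps the weakly compact set of sub-probability measures on `closure Ω`
-- continuously onto `SubProb Ω`: mass that reaches the boundary is not seen by `zeroLip Ω`.
theorem compactSpace_subProb (hΩ : MeasurableSet Ω) (hΩb : Bornology.IsBounded Ω)
    (hΩc : Ωᶜ.Nonempty) : CompactSpace (SubProb Ω) := by
  set Z : Set (FiniteMeasure (EuclideanSpace ℝ (Fin d))) := {μ | μ.mass ≤ 1 ∧ μ (closure Ω)ᶜ = 0}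
  have : CompactSpace Z := isCompact_iff_compactSpace.1
    (isCompact_setOfPred_finiteMeasure_le_of_isCompact 1 hΩb.isCompact_closure)
  let restr : Z → SubProb Ω := fun μ => SubProb.ofMeasure hΩ μ.1
    (by rw [← FiniteMeasure.ennreal_mass]; exact_mod_cast μ.2.1)
  have hcont : Continuous restr := by
    obtain ⟨D, hD⟩ := exists_abs_le_of_mem_zeroLip hΩb hΩc
    refine continuous_iff_continuousAt.2 fun μ₀ =>
      tendsto_of_tendsto_integral hΩb hΩc fun ψ hψ => ?_
    simp only [restr, SubProb.integral_ofMeasure _ _ _ hψ]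
    exact FiniteMeasure.tendsto_iff_forall_integral_tendsto.1 continuous_subtype_val.continuousAt
      (BoundedContinuousFunction.ofNormedAddCommGroup ψ hψ.1.continuous D (hD ψ hψ))
  have hsurj : Function.Surjective restr := by
    intro m
    let μ : FiniteMeasure (EuclideanSpace ℝ (Fin d)) := ⟨m.meas, inferInstance⟩
    refine ⟨⟨μ, ?_, (FiniteMeasure.null_iff_toMeasure_null μ _).2 ?_⟩, Subtype.ext m.restrict_meas⟩
    · exact_mod_cast (FiniteMeasure.ennreal_mass (μ := μ)).trans_le m.2.2
    · exact measure_mono_null (compl_subset_compl.2 subset_closure) m.2.1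
  exact hsurj.compactSpace hcont

end SubProb

/-! ### Square-integrable sub-probability measures -/

section L2

variable {α F : Type*} {_ : MeasurableSpace α} [NormedAddCommGroup F] {μ : Measure α}

lemma toReal_eLpNorm_two {f : α → F} (hf : MemLp f 2 μ) :
    (eLpNorm f 2 μ).toReal = √(∫ x, ‖f x‖ ^ 2 ∂μ) := by
  rw [hf.eLpNorm_eq_integral_rpow_norm (by norm_num) (by norm_num), Real.sqrt_eq_rpow]
  simp only [ENNReal.toReal_ofNat, Real.rpow_two]
  rw [ENNReal.toReal_ofReal (by positivity)]
  norm_num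

lemma sqrt_integral_norm_add_sq_le {f g : α → F} (hf : MemLp f 2 μ) (hg : MemLp g 2 μ) :
    √(∫ x, ‖f x + g x‖ ^ 2 ∂μ) ≤ √(∫ x, ‖f x‖ ^ 2 ∂μ) + √(∫ x, ‖g x‖ ^ 2 ∂μ) := by
  have h := ENNReal.toReal_mono (ENNReal.add_ne_top.2 ⟨hf.2.ne, hg.2.ne⟩)
    (eLpNorm_add_le hf.1 hg.1 one_le_two)
  rw [ENNReal.toReal_add hf.2.ne hg.2.ne] at h
  simpa only [toReal_eLpNorm_two hf, toReal_eLpNorm_two hg, toReal_eLpNorm_two (hf.add hg),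
    Pi.add_apply] using h

lemma abs_integral_inner_le [InnerProductSpace ℝ F] {f g : α → F} (hf : MemLp f 2 μ)
    (hg : MemLp g 2 μ) :
    |∫ x, inner ℝ (f x) (g x) ∂μ| ≤ √(∫ x, ‖f x‖ ^ 2 ∂μ) * √(∫ x, ‖g x‖ ^ 2 ∂μ) := by
  have h := abs_real_inner_le_norm (hf.toLp f) (hg.toLp g)
  rw [L2.inner_def, Lp.norm_toLp, Lp.norm_toLp, toReal_eLpNorm_two hf, toReal_eLpNorm_two hg] at h
  refine le_of_eq_of_le (congrArg _ (integral_congr_ae ?_)) h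
  filter_upwards [hf.coeFn_toLp, hg.coeFn_toLp] with x hfx hgx
  rw [hfx, hgx]

lemma abs_integral_mul_le {f g : α → ℝ} (hf : MemLp f 2 μ) (hg : MemLp g 2 μ) :
    |∫ x, f x * g x ∂μ| ≤ √(∫ x, f x ^ 2 ∂μ) * √(∫ x, g x ^ 2 ∂μ) := by
  simpa [mul_comm] using abs_integral_inner_le hf hg

lemma abs_integral_le_sqrt_measure_mul [IsFiniteMeasure μ] {f : α → ℝ} (hf : MemLp f 2 μ) :
    |∫ x, f x ∂μ| ≤ √(μ.real univ) * √(∫ x, f x ^ 2 ∂μ) := by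
  simpa using abs_integral_mul_le (memLp_const 1) hf

lemma sqrt_integral_sq_mono_measure {ν : Measure α} (hν : ν ≤ μ) {f : α → ℝ} (hf : MemLp f 2 μ) :
    √(∫ x, f x ^ 2 ∂ν) ≤ √(∫ x, f x ^ 2 ∂μ) :=
  Real.sqrt_le_sqrt (integral_mono_measure hν (.of_forall fun _ => sq_nonneg _) hf.integrable_sq)

-- Fatou's lemma for the truncations of `f`.
lemma memLp_two_of_forall_integral_min_sq_le [IsFiniteMeasure μ] {f : α → ℝ} (hf : Measurable f)
    (hf0 : 0 ≤ f) {A : ℝ} (hA : 0 ≤ A) (h : ∀ j : ℕ, √(∫ x, min (f x) j ^ 2 ∂μ) ≤ A) :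
    MemLp f 2 μ ∧ √(∫ x, f x ^ 2 ∂μ) ≤ A := by
  have hmin : ∀ j : ℕ, MemLp (fun x => min (f x) j) 2 μ := fun j =>
    .of_bound (hf.min measurable_const).aestronglyMeasurable j (.of_forall fun x => by
      rw [Real.norm_eq_abs, abs_of_nonneg (le_min (hf0 x) j.cast_nonneg)]
      exact min_le_right _ _)
  have hlim : ∀ x, Tendsto (fun j : ℕ => min (f x) j) atTop (𝓝 (f x)) := fun x => by
    refine tendsto_const_nhds.congr' ?_
    filter_upwards [tendsto_natCast_atTop_atTop.eventually_ge_atTop (f x)] with j hj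
    exact (min_eq_left hj).symm
  have hle : eLpNorm f 2 μ ≤ ENNReal.ofReal A := by
    refine (Lp.eLpNorm_lim_le_liminf_eLpNorm (fun j => (hmin j).1) f (.of_forall hlim)).trans
      (liminf_le_of_le (by isBoundedDefault) fun b hb => ?_)
    obtain ⟨j, hj⟩ := hb.exists
    refine hj.trans (ENNReal.le_ofReal_iff_toReal_le (hmin j).2.ne hA |>.2 ?_)
    simpa [toReal_eLpNorm_two (hmin j)] using h j
  have hmem : MemLp f 2 μ := ⟨hf.aestronglyMeasurable, hle.trans_lt ENNReal.ofReal_lt_top⟩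
  refine ⟨hmem, ?_⟩
  simpa [toReal_eLpNorm_two hmem] using ENNReal.toReal_le_of_le_ofReal hA hle

end L2

section LipschitzApproximation

lemma lipschitzWith_mul_of_abs_le {X : Type*} [PseudoMetricSpace X] {f g : X → ℝ}
    {K L B C : ℝ≥0} (hf : LipschitzWith K f) (hg : LipschitzWith L g) (hB : ∀ x, |f x| ≤ B)
    (hC : ∀ x, |g x| ≤ C) : LipschitzWith (B * L + C * K) fun x => f x * g x := by
  refine LipschitzWith.of_dist_le_mul fun x y => ?_
  have hfxy := hf.dist_le_mul x y
  have hgxy := hg.dist_le_mul x y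
  rw [Real.dist_eq] at hfxy hgxy ⊢
  calc |f x * g x - f y * g y| = |f x * (g x - g y) + g y * (f x - f y)| := by ring_nf
    _ ≤ |f x| * |g x - g y| + |g y| * |f x - f y| := by
        simpa only [abs_mul] using abs_add_le (f x * (g x - g y)) (g y * (f x - f y))
    _ ≤ B * (L * dist x y) + C * (K * dist x y) := by gcongr <;> apply_assumption
    _ = ↑(B * L + C * K) * dist x y := by push_cast; ring

lemma exists_lipschitz_cutoff_tendsto_one {X : Type*} [PseudoEMetricSpace X] {Ω : Set X}
    (hΩ : IsOpen Ω) :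
    ∃ χ : ℕ → X → ℝ, (∀ j, ∃ L, LipschitzWith L (χ j)) ∧ (∀ j x, χ j x ∈ Icc 0 1) ∧
      (∀ j, ∀ x ∉ Ω, χ j x = 0) ∧ ∀ x ∈ Ω, Tendsto (fun j => χ j x) atTop (𝓝 1) := by
  have hδ : ∀ j : ℕ, 0 < 1 / ((j : ℝ) + 1) := fun j => Nat.one_div_pos_of_nat
  refine ⟨fun j x => 1 - thickenedIndicator (hδ j) Ωᶜ x, fun j => ?_, fun j x => ?_,
    fun j x hx => ?_, fun x hx => ?_⟩
  · exact ⟨_, (LipschitzWith.const (1 : ℝ)).sub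
      (NNReal.isometry_coe.lipschitz.comp (lipschitzWith_thickenedIndicator (hδ j) Ωᶜ))⟩
  · exact ⟨sub_nonneg.2 (mod_cast thickenedIndicator_le_one (hδ j) _ x), by simp⟩
  · simp only [thickenedIndicator_one (hδ j) Ωᶜ hx, NNReal.coe_one, sub_self]
  · have h := tendsto_pi_nhds.1 (thickenedIndicator_tendsto_indicator_closure hδ
      tendsto_one_div_add_atTop_nhds_zero_nat Ωᶜ) x
    rw [hΩ.isClosed_compl.closure_eq, indicator_of_notMem (by simpa using hx)] at h
    simpa using (NNReal.tendsto_coe.2 h).const_sub 1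

variable {E : Type*} [NormedAddCommGroup E] [NormedSpace ℝ E] [FiniteDimensional ℝ E]
  [MeasurableSpace E] [BorelSpace E] {Ω : Set E}

lemma exists_lipschitz_eq_zero_off_sqrt_integral_sub_sq_le (hΩ : IsOpen Ω) {μ : Measure E}
    [IsFiniteMeasure μ] (hμ : ∀ᵐ x ∂μ, x ∈ Ω) {g : E → ℝ} (hg : MemLp g 2 μ) {ε : ℝ} (hε : 0 < ε) :
    ∃ (K : ℝ≥0) (ψ : E → ℝ), LipschitzWith K ψ ∧ (∀ x ∉ Ω, ψ x = 0) ∧ MemLp ψ 2 μ ∧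
      √(∫ x, (g x - ψ x) ^ 2 ∂μ) ≤ ε := by
  obtain ⟨φ, hφc, hφs, hgφ⟩ := hg.exist_eLpNorm_sub_le (by norm_num) one_le_two (half_pos hε)
  obtain ⟨K, hK⟩ := hφs.lipschitzWith_of_hasCompactSupport hφc (by simp)
  obtain ⟨B, hB⟩ := hφs.continuous.bounded_above_of_compact_support hφc
  have hB' : ∀ x, |φ x| ≤ B.toNNReal := fun x => (hB x).trans (Real.le_coe_toNNReal B)
  obtain ⟨χ, hχL, hχI, hχ0, hχlim⟩ := exists_lipschitz_cutoff_tendsto_one hΩ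
  have hχabs : ∀ j x, |χ j x| ≤ (1 : ℝ≥0) := fun j x =>
    abs_le.2 ⟨by simpa using by linarith [(hχI j x).1], (hχI j x).2⟩
  choose L hL using hχL
  have hLip : ∀ j, LipschitzWith _ fun x => φ x * χ j x := fun j =>
    lipschitzWith_mul_of_abs_le hK (hL j) hB' (hχabs j)
  have hφ2 : MemLp φ 2 μ := hφs.continuous.memLp_of_hasCompactSupport hφc
  have hφχ2 : ∀ j, MemLp (fun x => φ x * χ j x) 2 μ := fun j =>
    .of_bound (hLip j).continuous.aestronglyMeasurable B.toNNReal (.of_forall fun x => by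
      rw [norm_mul]
      exact (mul_le_mul (hB' x) (hχabs j x) (abs_nonneg _) (by positivity)).trans_eq (mul_one _))
  have hlim : Tendsto (fun j => √(∫ x, (φ x - φ x * χ j x) ^ 2 ∂μ)) atTop (𝓝 0) := by
    have hint := tendsto_integral_of_dominated_convergence (μ := μ)
      (F := fun j x => (φ x - φ x * χ j x) ^ 2) (f := fun _ => 0) (fun x => φ x ^ 2)
      (fun j => (hφ2.sub (hφχ2 j)).integrable_sq.1) hφ2.integrable_sq
      (fun j => .of_forall fun x => ?_) (hμ.mono fun x hx => ?_)
    · simpa [Function.comp_def] using (Real.continuous_sqrt.tendsto _).comp hint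
    · rw [Real.norm_of_nonneg (sq_nonneg _), ← mul_one_sub, mul_pow]
      exact mul_le_of_le_one_right (sq_nonneg _)
        (pow_le_one₀ (by linarith [(hχI j x).2]) (by linarith [(hχI j x).1]))
    · simpa using (((hχlim x hx).const_mul (φ x)).const_sub (φ x)).pow 2
  obtain ⟨j, hj⟩ := (hlim.eventually_le_const (half_pos hε)).exists
  refine ⟨_, _, hLip j, fun x hx => by simp [hχ0 j x hx], hφχ2 j, ?_⟩
  have hgφ' : √(∫ x, (g x - φ x) ^ 2 ∂μ) ≤ ε / 2 := by
    simpa [toReal_eLpNorm_two (hg.sub hφ2)] using ENNReal.toReal_le_of_le_ofReal (by positivity) hgφ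
  have htri := sqrt_integral_norm_add_sq_le (hg.sub hφ2) (hφ2.sub (hφχ2 j))
  simp only [Pi.sub_apply, sub_add_sub_cancel, Real.norm_eq_abs, sq_abs] at htri
  linarith

end LipschitzApproximation

section SquareIntegrable

variable {d : ℕ} {Ω : Set (EuclideanSpace ℝ (Fin d))}

lemma isFiniteMeasure_restrict_of_isBounded (hΩb : Bornology.IsBounded Ω) :
    IsFiniteMeasure (volume.restrict Ω) :=
  isFiniteMeasure_restrict.2 hΩb.measure_lt_top.ne

lemma SubProb.density_nonneg (m : SubProb Ω) (x : EuclideanSpace ℝ (Fin d)) : 0 ≤ m.density x :=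
  ENNReal.toReal_nonneg

lemma SubProb.measurable_density (m : SubProb Ω) : Measurable m.density :=
  (Measure.measurable_rnDeriv _ _).ennreal_toReal

lemma SubProb.l2NormSq_nonneg (m : SubProb Ω) : 0 ≤ m.l2NormSq :=
  integral_nonneg fun _ => sq_nonneg _

lemma SubProb.integral_eq (m : SubProb Ω) (hΩ : MeasurableSet Ω) (hac : m.meas ≪ volume)
    (f : EuclideanSpace ℝ (Fin d) → ℝ) :
    ∫ x, f x ∂m.meas = ∫ x in Ω, f x * m.density x := by
  conv_lhs => rw [← m.restrict_meas]
  simpa [SubProb.density, mul_comm] using (setIntegral_rnDeriv_smul (f := f) hac hΩ).symm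

lemma zeroLip_memLp (hΩb : Bornology.IsBounded Ω) (hΩc : Ωᶜ.Nonempty)
    {ψ : EuclideanSpace ℝ (Fin d) → ℝ} (hψ : ψ ∈ zeroLip Ω) (p : ℝ≥0∞) :
    MemLp ψ p (volume.restrict Ω) := by
  have := isFiniteMeasure_restrict_of_isBounded hΩb
  obtain ⟨D, hD⟩ := exists_abs_le_of_mem_zeroLip hΩb hΩc
  exact .of_bound hψ.1.continuous.aestronglyMeasurable D (.of_forall (hD ψ hψ))

lemma lipschitzWith_integral (hΩ : IsOpen Ω) {ψ : EuclideanSpace ℝ (Fin d) → ℝ}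
    (hψ : ψ ∈ zeroLip Ω) : LipschitzWith 1 fun m : SubProb Ω => ∫ x, ψ x ∂m.meas := by
  intro m n
  rw [ENNReal.coe_one, one_mul, edist_dist, Real.dist_eq]
  rcases abs_cases (∫ x, ψ x ∂m.meas - ∫ x, ψ x ∂n.meas) with h | h
  · rw [h.1]; exact ofReal_integral_sub_le_edist hΩ m n hψ
  · rw [h.1, neg_sub, edist_comm]; exact ofReal_integral_sub_le_edist hΩ n m hψ

lemma exists_smul_mem_zeroLip {ψ : EuclideanSpace ℝ (Fin d) → ℝ} {K : ℝ≥0}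
    (hψ : LipschitzWith K ψ) (h0 : ∀ x ∉ Ω, ψ x = 0) :
    ∃ c : ℝ, 0 < c ∧ (fun x => c * ψ x) ∈ zeroLip Ω := by
  refine ⟨((K : ℝ) + 1)⁻¹, by positivity, LipschitzWith.of_dist_le_mul fun x y => ?_,
    fun x hx => by simp [h0 x hx]⟩
  rw [Real.dist_eq, ← mul_sub, abs_mul, abs_of_pos (by positivity), NNReal.coe_one, one_mul,
    inv_mul_le_iff₀ (by positivity), ← Real.dist_eq]
  exact (hψ.dist_le_mul x y).trans (by gcongr; linarith)

lemma continuous_integral (hΩ : IsOpen Ω) {ψ : EuclideanSpace ℝ (Fin d) → ℝ} {K : ℝ≥0}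
    (hψ : LipschitzWith K ψ) (h0 : ∀ x ∉ Ω, ψ x = 0) :
    Continuous fun m : SubProb Ω => ∫ x, ψ x ∂m.meas := by
  obtain ⟨c, hc, hcψ⟩ := exists_smul_mem_zeroLip hψ h0
  have h : Continuous fun m : SubProb Ω => c⁻¹ * ∫ x, c * ψ x ∂m.meas :=
    continuous_const.mul (lipschitzWith_integral hΩ hcψ).continuous
  simpa [integral_const_mul, inv_mul_cancel_left₀ hc.ne'] using h

lemma abs_integral_le_of_zeroLip_of_lipschitzWith {m : SubProb Ω} {A : ℝ}
    (h : ∀ ψ ∈ zeroLip Ω, |∫ x, ψ x ∂m.meas| ≤ A * √(∫ x in Ω, ψ x ^ 2))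
    {ψ : EuclideanSpace ℝ (Fin d) → ℝ} {K : ℝ≥0}
    (hψ : LipschitzWith K ψ) (h0 : ∀ x ∉ Ω, ψ x = 0) :
    |∫ x, ψ x ∂m.meas| ≤ A * √(∫ x in Ω, ψ x ^ 2) := by
  obtain ⟨c, hc, hcψ⟩ := exists_smul_mem_zeroLip hψ h0
  have hbound := h _ hcψ
  simp only [mul_pow, integral_const_mul, abs_mul] at hbound
  rw [Real.sqrt_mul (by positivity), Real.sqrt_sq hc.le, abs_of_pos hc, mul_left_comm] at hbound
  exact le_of_mul_le_mul_left hbound hc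

-- Lipschitz functions vanishing off `Ω` are dense in `L²(m + volume.restrict Ω)`.
lemma abs_integral_le_of_zeroLip_of_memLp (hΩ : IsOpen Ω) (hΩb : Bornology.IsBounded Ω)
    {m : SubProb Ω} {A : ℝ} (hA : 0 ≤ A)
    (h : ∀ ψ ∈ zeroLip Ω, |∫ x, ψ x ∂m.meas| ≤ A * √(∫ x in Ω, ψ x ^ 2))
    {g : EuclideanSpace ℝ (Fin d) → ℝ} (hg : MemLp g 2 (m.meas + volume.restrict Ω)) :
    |∫ x, g x ∂m.meas| ≤ A * √(∫ x in Ω, g x ^ 2) := by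
  have := isFiniteMeasure_restrict_of_isBounded hΩb
  set μ := m.meas + volume.restrict Ω
  have hmμ : m.meas ≤ μ := Measure.le_add_right le_rfl
  have hvμ : volume.restrict Ω ≤ μ := Measure.le_add_left le_rfl
  have hμΩ : ∀ᵐ x ∂μ, x ∈ Ω :=
    ae_add_measure_iff.2 ⟨m.ae_mem, ae_restrict_mem hΩ.measurableSet⟩
  refine le_of_forall_pos_le_add fun ε hε => ?_
  obtain ⟨K, ψ, hψK, hψ0, hψ2, hψ⟩ := exists_lipschitz_eq_zero_off_sqrt_integral_sub_sq_le hΩ hμΩ hg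
    (ε := ε / (A + 1)) (by positivity)
  have hsub := hg.sub hψ2
  have hsub_m : |∫ x, g x ∂m.meas - ∫ x, ψ x ∂m.meas| ≤ ε / (A + 1) := by
    rw [← integral_sub ((hg.mono_measure hmμ).integrable one_le_two)
      ((hψ2.mono_measure hmμ).integrable one_le_two)]
    calc |∫ x, (g x - ψ x) ∂m.meas|
        ≤ √(m.meas.real univ) * √(∫ x, (g x - ψ x) ^ 2 ∂m.meas) :=
          abs_integral_le_sqrt_measure_mul (hsub.mono_measure hmμ)
      _ ≤ √(∫ x, (g x - ψ x) ^ 2 ∂m.meas) :=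
          mul_le_of_le_one_left (by positivity) (Real.sqrt_le_one.2 m.measureReal_univ_le)
      _ ≤ ε / (A + 1) := (sqrt_integral_sq_mono_measure hmμ hsub).trans hψ
  have hsub_vol : √(∫ x in Ω, ψ x ^ 2) ≤ √(∫ x in Ω, g x ^ 2) + ε / (A + 1) := by
    have htri := sqrt_integral_norm_add_sq_le (hg.mono_measure hvμ) (hsub.mono_measure hvμ).neg
    simp only [Pi.neg_apply, Pi.sub_apply, neg_sub, add_sub_cancel, Real.norm_eq_abs,
      sq_abs] at htri
    simp only [sub_sq_comm (ψ _)] at htri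
    exact htri.trans (by gcongr; exact (sqrt_integral_sq_mono_measure hvμ hsub).trans hψ)
  calc |∫ x, g x ∂m.meas| ≤ |∫ x, ψ x ∂m.meas| + ε / (A + 1) := by
        linarith [abs_sub_abs_le_abs_sub (∫ x, g x ∂m.meas) (∫ x, ψ x ∂m.meas)]
    _ ≤ A * (√(∫ x in Ω, g x ^ 2) + ε / (A + 1)) + ε / (A + 1) := by
        gcongr
        exact (abs_integral_le_of_zeroLip_of_lipschitzWith h hψK hψ0).trans (by gcongr)
    _ = A * √(∫ x in Ω, g x ^ 2) + ε := by field_simp; ring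

lemma absolutelyContinuous_of_zeroLip_bound (hΩ : IsOpen Ω) (hΩb : Bornology.IsBounded Ω)
    {m : SubProb Ω} {A : ℝ} (hA : 0 ≤ A)
    (h : ∀ ψ ∈ zeroLip Ω, |∫ x, ψ x ∂m.meas| ≤ A * √(∫ x in Ω, ψ x ^ 2)) :
    m.meas ≪ volume := by
  have := isFiniteMeasure_restrict_of_isBounded hΩb
  refine Measure.AbsolutelyContinuous.mk fun s hs hs0 => ?_
  have hbound := abs_integral_le_of_zeroLip_of_memLp hΩ hΩb hA h
    (memLp_indicator_const 2 hs (1 : ℝ) (.inr (measure_ne_top _ _)))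
  have hnull : ∫ x in Ω, s.indicator (fun _ => (1 : ℝ)) x ^ 2 = 0 :=
    integral_eq_zero_of_ae (ae_restrict_of_ae (measure_eq_zero_iff_ae_notMem.1 hs0 |>.mono
      fun x hx => by simp [hx]))
  rw [hnull, Real.sqrt_zero, mul_zero, integral_indicator_const _ hs] at hbound
  simpa [measureReal_eq_zero_iff] using hbound

-- Tested against the truncations of its own density, the functional bounds their `L²` norms.
theorem inL2_of_zeroLip_bound (hΩ : IsOpen Ω) (hΩb : Bornology.IsBounded Ω) {m : SubProb Ω}
    {A : ℝ} (hA : 0 ≤ A)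
    (h : ∀ ψ ∈ zeroLip Ω, |∫ x, ψ x ∂m.meas| ≤ A * √(∫ x in Ω, ψ x ^ 2)) :
    m.InL2 ∧ m.l2NormSq ≤ A ^ 2 := by
  have := isFiniteMeasure_restrict_of_isBounded hΩb
  have hac := absolutelyContinuous_of_zeroLip_bound hΩ hΩb hA h
  suffices htrunc : ∀ j : ℕ, √(∫ x in Ω, min (m.density x) j ^ 2) ≤ A by
    obtain ⟨hmem, hle⟩ := memLp_two_of_forall_integral_min_sq_le m.measurable_density
      m.density_nonneg hA htrunc
    exact ⟨⟨hac, hmem⟩, (Real.sqrt_le_left hA).1 hle⟩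
  intro j
  set g : EuclideanSpace ℝ (Fin d) → ℝ := fun x => min (m.density x) j
  have hg0 : ∀ x, 0 ≤ g x := fun x => le_min (m.density_nonneg x) j.cast_nonneg
  have hgm : Measurable g := m.measurable_density.min measurable_const
  have hgb : ∀ x, ‖g x‖ ≤ j := fun x => (Real.norm_of_nonneg (hg0 x)).trans_le (min_le_right _ _)
  have hg2 : ∀ {μ : Measure (EuclideanSpace ℝ (Fin d))} [IsFiniteMeasure μ], MemLp g 2 μ :=
    .of_bound hgm.aestronglyMeasurable j (.of_forall hgb)
  have hself : ∫ x in Ω, g x ^ 2 ≤ A * √(∫ x in Ω, g x ^ 2) := calc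
    ∫ x in Ω, g x ^ 2 ≤ ∫ x in Ω, g x * m.density x := by
        refine integral_mono hg2.integrable_sq (Measure.integrable_toReal_rnDeriv.restrict.bdd_mul
          hgm.aestronglyMeasurable (.of_forall hgb)) fun x => ?_
        exact (sq (g x)).trans_le (mul_le_mul_of_nonneg_left (min_le_left _ _) (hg0 x))
    _ = ∫ x, g x ∂m.meas := (m.integral_eq hΩ.measurableSet hac g).symm
    _ ≤ A * √(∫ x in Ω, g x ^ 2) :=
        (le_abs_self _).trans (abs_integral_le_of_zeroLip_of_memLp hΩ hΩb hA h hg2)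
  by_contra! hlt
  have : 0 < √(∫ x in Ω, g x ^ 2) := hA.trans_lt hlt
  nlinarith [Real.mul_self_sqrt (integral_nonneg (μ := volume.restrict Ω)
    fun x => sq_nonneg (g x))]

theorem isClosed_setOf_inL2_l2NormSq_le (hΩ : IsOpen Ω) (hΩb : Bornology.IsBounded Ω)
    (hΩc : Ωᶜ.Nonempty) (R : ℝ) : IsClosed {m : SubProb Ω | m.InL2 ∧ m.l2NormSq ≤ R} := by
  rcases lt_or_ge R 0 with hR | hR
  · convert! isClosed_empty
    exact eq_empty_of_forall_notMem fun m hm => (hR.trans_le m.l2NormSq_nonneg).not_ge hm.2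
  refine isClosed_of_closure_subset fun m hm => ?_
  have h : ∀ ψ ∈ zeroLip Ω, |∫ x, ψ x ∂m.meas| ≤ √R * √(∫ x in Ω, ψ x ^ 2) := by
    intro ψ hψ
    have hclosed : IsClosed {n : SubProb Ω | |∫ x, ψ x ∂n.meas| ≤ √R * √(∫ x in Ω, ψ x ^ 2)} :=
      isClosed_le (lipschitzWith_integral hΩ hψ).continuous.abs continuous_const
    refine closure_minimal (fun n hn => ?_) hclosed hm
    rw [mem_ofPred_eq, n.integral_eq hΩ.measurableSet hn.1.1, mul_comm]
    exact (abs_integral_mul_le (zeroLip_memLp hΩb hΩc hψ 2) hn.1.2).trans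
      (by gcongr; exact hn.2)
  obtain ⟨hmem, hle⟩ := inL2_of_zeroLip_bound hΩ hΩb (Real.sqrt_nonneg R) h
  exact ⟨hmem, by rwa [Real.sq_sqrt hR] at hle⟩

lemma SubProb.inL2_of_le_smul (hΩb : Bornology.IsBounded Ω) {n : SubProb Ω} {c : ℝ≥0∞}
    (hc : c ≠ ⊤) (hn : n.meas ≤ c • volume) : n.InL2 := by
  have := isFiniteMeasure_restrict_of_isBounded hΩb
  have hrn : n.meas.rnDeriv volume ≤ᵐ[volume] fun _ => c := by
    refine ae_le_of_forall_setLIntegral_le_of_sigmaFinite (Measure.measurable_rnDeriv _ _)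
      fun s _ _ => ?_
    exact (Measure.setLIntegral_rnDeriv_le s).trans (by simpa using hn s)
  refine ⟨Measure.absolutelyContinuous_of_le_smul hn,
    .of_bound n.measurable_density.aestronglyMeasurable c.toReal
      (ae_restrict_of_ae (hrn.mono fun x hx => ?_))⟩
  rw [Real.norm_of_nonneg (n.density_nonneg x)]
  exact ENNReal.toReal_mono hc hx

section Convolution

variable {E : Type*} [NormedAddCommGroup E] [MeasurableSpace E] [BorelSpace E]
  [SecondCountableTopology E] {μ ν : Measure E}

lemma conv_le_smul [SFinite μ] [SFinite ν] {l : Measure E} [l.IsAddLeftInvariant] {c : ℝ≥0∞}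
    (hν : ν ≤ c • l) (hμ : μ univ ≤ 1) : μ ∗ ν ≤ c • l := by
  refine Measure.le_iff.2 fun s hs => ?_
  rw [← lintegral_indicator_one hs, Measure.lintegral_conv (measurable_one.indicator hs)]
  calc ∫⁻ x, ∫⁻ y, s.indicator 1 (x + y) ∂ν ∂μ
      ≤ ∫⁻ _, (c • l) s ∂μ := lintegral_mono fun x => by
        calc ∫⁻ y, s.indicator 1 (x + y) ∂ν ≤ ∫⁻ y, s.indicator 1 (x + y) ∂(c • l) :=
              lintegral_mono' hν le_rfl
          _ = (c • l) s := by
              rw [lintegral_smul_measure, lintegral_add_left_eq_self (s.indicator 1) x,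
                lintegral_indicator_one hs, Measure.smul_apply]
    _ ≤ (c • l) s := by
        rw [lintegral_const]
        exact mul_le_of_le_one_right' hμ

lemma abs_integral_conv_sub_le [IsFiniteMeasure μ] [IsProbabilityMeasure ν] {r D : ℝ}
    (hν : ∀ᵐ y ∂ν, ‖y‖ ≤ r) {ψ : E → ℝ} (hψ : LipschitzWith 1 ψ) (hD : ∀ x, |ψ x| ≤ D) :
    |∫ x, ψ x ∂(μ ∗ ν) - ∫ x, ψ x ∂μ| ≤ r * μ.real univ := by
  have hfst : ∫ x, ψ x ∂μ = ∫ z, ψ z.1 ∂μ.prod ν := by simp [integral_fun_fst]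
  have hint : ∀ f : E × E → E, Measurable f → Integrable (fun z => ψ (f z)) (μ.prod ν) :=
    fun f hf => .of_bound (hψ.continuous.measurable.comp hf).aestronglyMeasurable D
      (.of_forall fun z => hD _)
  rw [Measure.conv, integral_map measurable_add.aemeasurable
    hψ.continuous.aestronglyMeasurable, hfst, ← integral_sub (hint _ measurable_add)
    (hint _ measurable_fst)]
  have hbound := norm_integral_le_of_norm_le_const (μ := μ.prod ν) (C := r)
    (f := fun z => ψ (z.1 + z.2) - ψ z.1) ?_
  · simpa [← univ_prod_univ, measureReal_prod_prod] using hbound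
  filter_upwards [Measure.quasiMeasurePreserving_snd.ae hν] with z hz
  simpa [Real.dist_eq] using (hψ.dist_le_mul (z.1 + z.2) z.1).trans (by simpa using hz)

end Convolution

-- Convolve with the uniform probability measure on a small ball.
theorem exists_inL2_edist_le (hΩ : MeasurableSet Ω) (hΩb : Bornology.IsBounded Ω)
    (hΩc : Ωᶜ.Nonempty) (m : SubProb Ω) {r : ℝ} (hr : 0 < r) :
    ∃ n : SubProb Ω, n.InL2 ∧ edist n m ≤ ENNReal.ofReal r := by
  have hball : volume (Metric.ball (0 : EuclideanSpace ℝ (Fin d)) r) ≠ 0 :=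
    (Metric.measure_ball_pos volume 0 hr).ne'
  set ν := ProbabilityTheory.cond volume (Metric.ball (0 : EuclideanSpace ℝ (Fin d)) r)
  have : IsProbabilityMeasure ν :=
    ProbabilityTheory.cond_isProbabilityMeasure_of_finite hball measure_ball_lt_top.ne
  have hνr : ∀ᵐ y ∂ν, ‖y‖ ≤ r := (ProbabilityTheory.ae_cond_mem measurableSet_ball).mono
    fun y hy => (mem_ball_zero_iff.1 hy).le
  have hμle : m.meas ∗ ν ≤ (volume (Metric.ball (0 : EuclideanSpace ℝ (Fin d)) r))⁻¹ • volume :=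
    conv_le_smul (smul_mono_right _ Measure.restrict_le_self) m.2.2
  have hμ : (m.meas ∗ ν) univ ≤ 1 := by
    rw [Measure.conv, Measure.map_apply measurable_add .univ, preimage_univ, ← univ_prod_univ,
      Measure.prod_prod, measure_univ (μ := ν), mul_one]
    exact m.2.2
  refine ⟨SubProb.ofMeasure hΩ _ hμ, SubProb.inL2_of_le_smul hΩb (ENNReal.inv_ne_top.2 hball)
    (Measure.restrict_le_self.trans hμle), edist_le_ofReal fun ψ hψ => ?_⟩
  obtain ⟨D, hD⟩ := exists_abs_le_of_mem_zeroLip hΩb hΩc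
  rw [SubProb.integral_ofMeasure _ _ _ hψ]
  exact (le_abs_self _).trans ((abs_integral_conv_sub_le hνr hψ.1 (hD ψ hψ)).trans
    (mul_le_of_le_one_right hr.le m.measureReal_univ_le))

end SquareIntegrable

/-! ### The compact embedding of `H₀¹` into `L²` -/

section Gradient

variable {E : Type*} [NormedAddCommGroup E] [InnerProductSpace ℝ E] [CompleteSpace E] {w : E → ℝ}

lemma norm_gradient_eq (f : E → ℝ) (x : E) : ‖∇ f x‖ = ‖fderiv ℝ f x‖ := by
  rw [← toDual_gradient, LinearIsometryEquiv.norm_map]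

lemma continuous_gradient (hw : ContDiff ℝ 1 w) : Continuous (∇ w) :=
  (InnerProductSpace.toDual ℝ E).symm.continuous.comp (hw.continuous_fderiv one_ne_zero)

lemma hasCompactSupport_gradient (hw : HasCompactSupport w) : HasCompactSupport (∇ w) :=
  (hw.fderiv ℝ).comp_left (map_zero _)

lemma gradient_eq_zero_of_notMem_tsupport {x : E} (hx : x ∉ tsupport w) : ∇ w x = 0 := by
  rw [gradient, image_eq_zero_of_notMem_tsupport fun h => hx (tsupport_fderiv_subset ℝ h),
    map_zero]

-- The fundamental theorem of calculus on the segment, and Jensen's inequality.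
lemma sq_sub_le_integral_gradient (hw : ContDiff ℝ 1 w) (x z : E) :
    (w (x + z) - w x) ^ 2 ≤ ∫ s in Ioc (0 : ℝ) 1, ‖z‖ ^ 2 * ‖∇ w (x + s • z)‖ ^ 2 := by
  have hgrad : Continuous fun s : ℝ => ∇ w (x + s • z) :=
    (continuous_gradient hw).comp (by fun_prop)
  have hinner : Continuous fun s : ℝ => inner ℝ (∇ w (x + s • z)) z :=
    hgrad.inner continuous_const
  have hderiv : ∀ s : ℝ,
      HasDerivAt (fun s : ℝ => w (x + s • z)) (inner ℝ (∇ w (x + s • z)) z) s := fun s => by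
    have hline : HasDerivAt (fun s : ℝ => x + s • z) z s := by
      simpa using ((hasDerivAt_id s).smul_const z).const_add x
    rw [inner_gradient_left]
    exact (hw.differentiable one_ne_zero _).hasFDerivAt.comp_hasDerivAt s hline
  have hftc : w (x + z) - w x = ∫ s in Ioc (0 : ℝ) 1, inner ℝ (∇ w (x + s • z)) z := by
    rw [← intervalIntegral.integral_of_le zero_le_one,
      intervalIntegral.integral_eq_sub_of_hasDerivAt (fun s _ => hderiv s)
        (hinner.intervalIntegrable 0 1), one_smul, zero_smul, add_zero]
  have hint : ∀ f : ℝ → ℝ, Continuous f → Integrable f (volume.restrict (Ioc (0 : ℝ) 1)) :=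
    fun f hf => hf.integrableOn_Ioc
  have hcs := abs_integral_le_sqrt_measure_mul
    ((memLp_two_iff_integrable_sq hinner.aestronglyMeasurable).2 (hint _ (hinner.pow 2)))
  rw [measureReal_restrict_apply_univ, Real.volume_real_Ioc_of_le zero_le_one, sub_zero,
    Real.sqrt_one, one_mul, ← hftc] at hcs
  calc (w (x + z) - w x) ^ 2 ≤ ∫ s in Ioc (0 : ℝ) 1, (inner ℝ (∇ w (x + s • z)) z) ^ 2 := by
        exact (Real.sq_le (integral_nonneg fun _ => sq_nonneg _)).2 (abs_le.1 hcs)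
    _ ≤ _ := by
        refine integral_mono (hint _ (hinner.pow 2))
          (hint _ (continuous_const.mul (hgrad.norm.pow 2))) fun s => ?_
        rw [← mul_pow, mul_comm ‖z‖]
        exact sq_le_sq.2 ((abs_real_inner_le_norm _ _).trans (le_abs_self _))

end Gradient

section Mollification

variable {E : Type*} [NormedAddCommGroup E] [InnerProductSpace ℝ E] [FiniteDimensional ℝ E]
  [MeasurableSpace E] [BorelSpace E] {w ρ : E → ℝ}

lemma memLp_gradient (hw : ContDiff ℝ 1 w) (hwc : HasCompactSupport w) (p : ℝ≥0∞) (μ : Measure E)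
    [IsFiniteMeasureOnCompacts μ] : MemLp (∇ w) p μ :=
  (continuous_gradient hw).memLp_of_hasCompactSupport (hasCompactSupport_gradient hwc)

lemma integral_sq_translate_sub_le (hw : ContDiff ℝ 1 w) (hwc : HasCompactSupport w) (z : E) :
    ∫ x, (w (x + z) - w x) ^ 2 ≤ ‖z‖ ^ 2 * ∫ x, ‖∇ w x‖ ^ 2 := by
  have hgrad := continuous_gradient hw
  have hgi : Integrable (fun x => ‖z‖ ^ 2 * ‖∇ w x‖ ^ 2) :=
    ((memLp_gradient hw hwc 2 volume).integrable_norm_pow two_ne_zero).const_mul _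
  have hlin : ∫⁻ x, ENNReal.ofReal ((w (x + z) - w x) ^ 2)
      ≤ ENNReal.ofReal (‖z‖ ^ 2 * ∫ x, ‖∇ w x‖ ^ 2) := by
    calc ∫⁻ x, ENNReal.ofReal ((w (x + z) - w x) ^ 2)
        ≤ ∫⁻ x, ∫⁻ s in Ioc (0 : ℝ) 1, ENNReal.ofReal (‖z‖ ^ 2 * ‖∇ w (x + s • z)‖ ^ 2) := by
          refine lintegral_mono fun x => ?_
          rw [← ofReal_integral_eq_lintegral_ofReal _ (.of_forall fun s => by positivity)]
          · exact ENNReal.ofReal_le_ofReal (sq_sub_le_integral_gradient hw x z)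
          · exact (continuous_const.mul
              ((hgrad.comp (by fun_prop)).norm.pow 2) : Continuous _).integrableOn_Ioc
      _ = ∫⁻ s in Ioc (0 : ℝ) 1, ∫⁻ x, ENNReal.ofReal (‖z‖ ^ 2 * ‖∇ w (x + s • z)‖ ^ 2) :=
          lintegral_lintegral_swap (continuous_const.mul
            ((hgrad.comp (by fun_prop)).norm.pow 2)).measurable.ennreal_ofReal.aemeasurable
      _ = ∫⁻ _ in Ioc (0 : ℝ) 1, ∫⁻ x, ENNReal.ofReal (‖z‖ ^ 2 * ‖∇ w x‖ ^ 2) :=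
          lintegral_congr fun s => lintegral_add_right_eq_self
            (fun x => ENNReal.ofReal (‖z‖ ^ 2 * ‖∇ w x‖ ^ 2)) (s • z)
      _ = _ := by
          rw [← integral_const_mul, ofReal_integral_eq_lintegral_ofReal hgi
            (.of_forall fun x => by positivity)]
          simp
  rw [integral_eq_lintegral_of_nonneg_ae (f := fun x => (w (x + z) - w x) ^ 2)
    (.of_forall fun x => sq_nonneg _)
    (((hw.continuous.comp (continuous_add_const z)).sub hw.continuous).pow 2).aestronglyMeasurable]
  exact ENNReal.toReal_le_of_le_ofReal (by positivity) hlin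

lemma abs_integral_mul_sub_translate_le (hw : ContDiff ℝ 1 w) (hwc : HasCompactSupport w) (z : E) :
    |∫ x, w x * (w x - w (x + z))| ≤ ‖z‖ * (√(∫ x, w x ^ 2) * √(∫ x, ‖∇ w x‖ ^ 2)) := by
  have hwL : MemLp w 2 volume := hw.continuous.memLp_of_hasCompactSupport hwc
  have htrans : √(∫ x, (w x - w (x + z)) ^ 2) ≤ ‖z‖ * √(∫ x, ‖∇ w x‖ ^ 2) := by
    refine (Real.sqrt_le_sqrt (integral_sq_translate_sub_le hw hwc z)).trans' (le_of_eq ?_)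
      |>.trans_eq (by rw [Real.sqrt_mul (by positivity), Real.sqrt_sq (norm_nonneg z)])
    simp only [sub_sq_comm]
  calc |∫ x, w x * (w x - w (x + z))|
      ≤ √(∫ x, w x ^ 2) * √(∫ x, (w x - w (x + z)) ^ 2) := abs_integral_mul_le hwL
        (hwL.sub (hwL.comp_measurePreserving (measurePreserving_add_right volume z)))
    _ ≤ √(∫ x, w x ^ 2) * (‖z‖ * √(∫ x, ‖∇ w x‖ ^ 2)) := by gcongr
    _ = _ := by ring

/-- The mollification of `w` by the kernel `ρ`, that is `x ↦ ∫ w (x + z) ρ(z) dz`; the translate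
of `ρ` pairs with `w` without a reflection. -/
noncomputable def mollify (ρ w : E → ℝ) (x : E) : ℝ := ∫ z, w z * ρ (z - x)

lemma mollify_eq_integral_add (ρ w : E → ℝ) (x : E) : mollify ρ w x = ∫ z, w (x + z) * ρ z := by
  rw [mollify, ← integral_add_left_eq_self (fun z => w z * ρ (z - x)) x]
  simp only [add_sub_cancel_left]

lemma integrable_mul_of_hasCompactSupport {f : E → ℝ} (hw : Continuous w)
    (hwc : HasCompactSupport w) (hf : Continuous f) : Integrable fun x => w x * f x :=
  (hw.mul hf).integrable_of_hasCompactSupport hwc.mul_right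

lemma continuous_mollify (hw : Continuous w) (hwc : HasCompactSupport w) (hρ : Continuous ρ) :
    Continuous (mollify ρ w) := by
  refine (continuous_parametric_integral_of_continuous (f := fun x z => w z * ρ (z - x))
    (μ := volume) ?_ hwc.isCompact).congr fun x =>
      setIntegral_eq_integral_of_forall_compl_eq_zero fun z hz => by
        rw [image_eq_zero_of_notMem_tsupport hz, zero_mul]
  simp only [Function.uncurry_def]
  fun_prop

lemma integral_mul_sub_mollify (hw : Continuous w) (hwc : HasCompactSupport w)
    (hρ : Continuous ρ) (hρc : HasCompactSupport ρ) (hone : ∫ z, ρ z = 1) :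
    ∫ x, w x * (w x - mollify ρ w x) = ∫ z, ρ z * ∫ x, w x * (w x - w (x + z)) := by
  have hcs : HasCompactSupport (Function.uncurry fun x z => ρ z * (w x * (w x - w (x + z)))) := by
    refine HasCompactSupport.intro (hwc.isCompact.prod hρc.isCompact) fun ⟨x, z⟩ hxz => ?_
    rcases not_and_or.1 hxz with hx | hz
    · simp [image_eq_zero_of_notMem_tsupport hx]
    · simp [image_eq_zero_of_notMem_tsupport hz]
  have hswap := integral_integral_swap_of_hasCompactSupport (μ := volume) (ν := volume)
    (by simp only [Function.uncurry_def]; fun_prop) hcs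
  simp only [integral_const_mul] at hswap
  rw [← hswap]
  congr 1 with x
  have hi : Integrable fun z => w (x + z) * ρ z :=
    ((hw.comp (continuous_const_add x)).mul hρ).integrable_of_hasCompactSupport hρc.mul_left
  calc w x * (w x - mollify ρ w x) = w x * (w x * (∫ z, ρ z) - ∫ z, w (x + z) * ρ z) := by
        rw [hone, mul_one, mollify_eq_integral_add]
    _ = w x * ∫ z, (w x * ρ z - w (x + z) * ρ z) := by
        rw [integral_sub ((hρ.integrable_of_hasCompactSupport hρc).const_mul _) hi,
          integral_const_mul]
    _ = ∫ z, ρ z * (w x * (w x - w (x + z))) := by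
        rw [← integral_const_mul]
        congr 1 with z
        ring

lemma abs_integral_mul_sub_mollify_le (hw : ContDiff ℝ 1 w) (hwc : HasCompactSupport w)
    (hρ : Continuous ρ) (hρ0 : 0 ≤ ρ) (hone : ∫ z, ρ z = 1) {h : ℝ}
    (hsupp : Function.support ρ ⊆ Metric.ball 0 h) :
    |∫ x, w x * (w x - mollify ρ w x)| ≤ h * (√(∫ x, w x ^ 2) * √(∫ x, ‖∇ w x‖ ^ 2)) := by
  have hρc : HasCompactSupport ρ := HasCompactSupport.of_support_subset_isCompact
    (isCompact_closedBall 0 h) (hsupp.trans Metric.ball_subset_closedBall)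
  rw [integral_mul_sub_mollify hw.continuous hwc hρ hρc hone]
  have hbound : ∀ z, ‖ρ z * ∫ x, w x * (w x - w (x + z))‖
      ≤ ρ z * (h * (√(∫ x, w x ^ 2) * √(∫ x, ‖∇ w x‖ ^ 2))) := fun z => by
    rw [norm_mul, Real.norm_of_nonneg (hρ0 z), Real.norm_eq_abs]
    rcases eq_or_ne (ρ z) 0 with hz | hz
    · simp [hz]
    · have hzh : ‖z‖ < h := mem_ball_zero_iff.1 (hsupp hz)
      exact mul_le_mul_of_nonneg_left
        ((abs_integral_mul_sub_translate_le hw hwc z).trans (by gcongr)) (hρ0 z)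
  refine (norm_integral_le_of_norm_le ((hρ.integrable_of_hasCompactSupport hρc).mul_const _)
    (.of_forall hbound)).trans_eq ?_
  rw [integral_mul_const, hone, one_mul]

lemma abs_mollify_sub_le (hw : Continuous w) (hwc : HasCompactSupport w) {K : ℝ≥0}
    (hρ : LipschitzWith K ρ) (x y : E) :
    |mollify ρ w x - mollify ρ w y| ≤ K * dist x y * ∫ z, |w z| := by
  have hint : ∀ x, Integrable fun z => w z * ρ (z - x) := fun x =>
    integrable_mul_of_hasCompactSupport hw hwc (hρ.continuous.comp (continuous_sub_right x))
  have hbound : ∀ z, ‖w z * ρ (z - x) - w z * ρ (z - y)‖ ≤ K * dist x y * |w z| := fun z => by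
    rw [← mul_sub, norm_mul, Real.norm_eq_abs, mul_comm, ← dist_eq_norm]
    gcongr
    exact (hρ.dist_le_mul (z - x) (z - y)).trans_eq (by rw [dist_sub_left])
  rw [mollify, mollify, ← integral_sub (hint x) (hint y), ← integral_const_mul]
  exact norm_integral_le_of_norm_le
    ((hw.integrable_of_hasCompactSupport hwc).abs.const_mul _) (.of_forall hbound)

lemma abs_mollify_le_sum_add {ι : Type*} [Fintype ι] (hw : Continuous w)
    (hwc : HasCompactSupport w) {K : ℝ≥0} (hρ : LipschitzWith K ρ) {y : ι → E} {x : E} {j : ι}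
    {κ : ℝ} (hj : dist x (y j) ≤ κ) :
    |mollify ρ w x| ≤ ∑ j, |mollify ρ w (y j)| + K * κ * ∫ z, |w z| := by
  have : 0 ≤ ∫ z, |w z| := integral_nonneg fun _ => abs_nonneg _
  calc |mollify ρ w x| ≤ |mollify ρ w (y j)| + |mollify ρ w x - mollify ρ w (y j)| :=
        sub_le_iff_le_add'.1 (abs_sub_abs_le_abs_sub _ _)
    _ ≤ _ := by
        gcongr
        · exact Finset.single_le_sum (f := fun j => |mollify ρ w (y j)|)
            (fun _ _ => abs_nonneg _) (Finset.mem_univ j)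
        · exact (abs_mollify_sub_le hw hwc hρ x (y j)).trans (by gcongr)

end Mollification

section ZeroTraceSobolev

variable {d : ℕ} {Ω : Set (EuclideanSpace ℝ (Fin d))}

section IsCcOn

variable {k : ℕ∞} {w : EuclideanSpace ℝ (Fin d) → ℝ}

lemma IsCcOn.continuous (hw : IsCcOn k Ω w) : Continuous w := hw.1.continuous

lemma IsCcOn.contDiff_one (hw : IsCcOn ⊤ Ω w) : ContDiff ℝ 1 w := hw.1.of_le (by simp)

lemma IsCcOn.differentiable (hw : IsCcOn ⊤ Ω w) : Differentiable ℝ w :=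
  hw.contDiff_one.differentiable one_ne_zero

lemma IsCcOn.eq_zero (hw : IsCcOn k Ω w) {x : EuclideanSpace ℝ (Fin d)} (hx : x ∉ Ω) : w x = 0 :=
  image_eq_zero_of_notMem_tsupport fun h => hx (hw.2.2 h)

lemma IsCcOn.gradient_eq_zero (hw : IsCcOn k Ω w) {x : EuclideanSpace ℝ (Fin d)} (hx : x ∉ Ω) :
    ∇ w x = 0 :=
  gradient_eq_zero_of_notMem_tsupport fun h => hx (hw.2.2 h)

lemma IsCcOn.memLp (hw : IsCcOn k Ω w) (p : ℝ≥0∞) (μ : Measure (EuclideanSpace ℝ (Fin d)))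
    [IsFiniteMeasureOnCompacts μ] : MemLp w p μ :=
  hw.continuous.memLp_of_hasCompactSupport hw.2.1

lemma IsCcOn.memLp_gradient (hw : IsCcOn ⊤ Ω w) (p : ℝ≥0∞)
    (μ : Measure (EuclideanSpace ℝ (Fin d))) [IsFiniteMeasureOnCompacts μ] : MemLp (∇ w) p μ :=
  AbsorbedMFC.memLp_gradient hw.contDiff_one hw.2.1 p μ

lemma IsCcOn.exists_lipschitzWith (hw : IsCcOn ⊤ Ω w) : ∃ K : ℝ≥0, LipschitzWith K w :=
  hw.1.lipschitzWith_of_hasCompactSupport hw.2.1 (by simp)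

lemma IsCcOn.setIntegral_mul (hw : IsCcOn k Ω w) (f : EuclideanSpace ℝ (Fin d) → ℝ) :
    ∫ x in Ω, w x * f x = ∫ x, w x * f x :=
  setIntegral_eq_integral_of_forall_compl_eq_zero fun x hx => by rw [hw.eq_zero hx, zero_mul]

lemma IsCcOn.setIntegral_sq (hw : IsCcOn k Ω w) : ∫ x in Ω, w x ^ 2 = ∫ x, w x ^ 2 := by
  simpa only [sq] using hw.setIntegral_mul w

lemma IsCcOn.setIntegral_norm_gradient_sq (hw : IsCcOn k Ω w) :
    ∫ x in Ω, ‖∇ w x‖ ^ 2 = ∫ x, ‖∇ w x‖ ^ 2 :=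
  setIntegral_eq_integral_of_forall_compl_eq_zero fun x hx => by simp [hw.gradient_eq_zero hx]

lemma IsCcOn.integral_abs_le (hw : IsCcOn k Ω w) (hΩb : Bornology.IsBounded Ω) :
    ∫ x, |w x| ≤ √(volume.real Ω) * √(∫ x, w x ^ 2) := by
  have := isFiniteMeasure_restrict_of_isBounded hΩb
  have habs : ∫ x in Ω, |w x| = ∫ x, |w x| :=
    setIntegral_eq_integral_of_forall_compl_eq_zero fun x hx => by rw [hw.eq_zero hx, abs_zero]
  have h := (le_abs_self _).trans
    (abs_integral_le_sqrt_measure_mul (hw.memLp 2 (volume.restrict Ω)).abs)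
  simpa only [Pi.abs_apply, sq_abs, measureReal_restrict_apply_univ, hw.setIntegral_sq, habs]
    using h

end IsCcOn

lemma integral_sq_le_of_mollify {N : ℕ} {w ρ : EuclideanSpace ℝ (Fin d) → ℝ} (hw : IsCcOn ⊤ Ω w)
    (hΩb : Bornology.IsBounded Ω) {K : ℝ≥0} (hρ : LipschitzWith K ρ) (hρ0 : 0 ≤ ρ)
    (hone : ∫ z, ρ z = 1) {h : ℝ} (hsupp : Function.support ρ ⊆ Metric.ball 0 h)
    {y : Fin N → EuclideanSpace ℝ (Fin d)} {κ : ℝ} (hκ : 0 ≤ κ)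
    (hy : ∀ x ∈ Ω, ∃ j, dist x (y j) ≤ κ) :
    ∫ x, w x ^ 2 ≤ h * (√(∫ x, w x ^ 2) * √(∫ x, ‖∇ w x‖ ^ 2))
      + √(volume.real Ω) * √(∫ x, w x ^ 2) *
        (∑ j, |mollify ρ w (y j)| + K * κ * (√(volume.real Ω) * √(∫ x, w x ^ 2))) := by
  have hv := continuous_mollify hw.continuous hw.2.1 hρ.continuous
  have hpair : |∫ x, w x * mollify ρ w x|
      ≤ (∫ x, |w x|) * (∑ j, |mollify ρ w (y j)| + K * κ * ∫ x, |w x|) := by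
    have hbound : ∀ x, ‖w x * mollify ρ w x‖
        ≤ |w x| * (∑ j, |mollify ρ w (y j)| + K * κ * ∫ x, |w x|) := fun x => by
      rw [norm_mul, Real.norm_eq_abs, Real.norm_eq_abs]
      by_cases hx : x ∈ Ω
      · obtain ⟨j, hj⟩ := hy x hx
        gcongr
        exact abs_mollify_le_sum_add hw.continuous hw.2.1 hρ hj
      · simp [hw.eq_zero hx]
    refine (norm_integral_le_of_norm_le ((hw.continuous.integrable_of_hasCompactSupport
      hw.2.1).abs.mul_const _) (.of_forall hbound)).trans_eq (integral_mul_const _ _)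
  have hsplit : ∫ x, w x ^ 2
      = (∫ x, w x * (w x - mollify ρ w x)) + ∫ x, w x * mollify ρ w x := by
    rw [← integral_add (integrable_mul_of_hasCompactSupport hw.continuous hw.2.1
        (f := fun x => w x - mollify ρ w x) (hw.continuous.sub hv))
      (integrable_mul_of_hasCompactSupport hw.continuous hw.2.1 hv)]
    congr 1 with x
    ring
  have hL1 := hw.integral_abs_le hΩb
  have : 0 ≤ ∫ x, |w x| := integral_nonneg fun _ => abs_nonneg _
  refine hsplit.trans_le (add_le_add ((le_abs_self _).trans
    (abs_integral_mul_sub_mollify_le hw.contDiff_one hw.2.1 hρ.continuous hρ0 hone hsupp)) ?_)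
  exact (le_abs_self _).trans (hpair.trans (by gcongr))

lemma exists_finite_net_of_isBounded {X : Type*} [PseudoMetricSpace X] [ProperSpace X] {s : Set X}
    (hs : Bornology.IsBounded s) {κ : ℝ} (hκ : 0 < κ) :
    ∃ (N : ℕ) (y : Fin N → X), ∀ x ∈ s, ∃ j, dist x (y j) ≤ κ := by
  obtain ⟨t, ht, hst⟩ := Metric.totallyBounded_iff.1
    (hs.isCompact_closure.totallyBounded.subset subset_closure) κ hκ
  obtain ⟨N, y, -, rfl⟩ := ht.fin_param
  refine ⟨N, y, fun x hx => ?_⟩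
  obtain ⟨_, ⟨j, rfl⟩, hj⟩ := mem_iUnion₂.1 (hst hx)
  exact ⟨j, (Metric.mem_ball.1 hj).le⟩

-- The functionals are the values, at the points of a finite net, of a mollification of `w`.
theorem exists_finite_family_l2_le (hΩb : Bornology.IsBounded Ω) {h : ℝ} (hh : 0 < h) :
    ∃ (N : ℕ) (ℓ : Fin N → EuclideanSpace ℝ (Fin d) → ℝ) (c : ℝ), 0 ≤ c ∧
      (∀ j, MemLp (ℓ j) 2 (volume.restrict Ω)) ∧
      ∀ w, IsCcOn ⊤ Ω w →
        √(∫ x in Ω, w x ^ 2) ≤ h * (√(∫ x in Ω, w x ^ 2) + √(∫ x in Ω, ‖∇ w x‖ ^ 2))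
          + c * ∑ j, |∫ x in Ω, w x * ℓ j x| := by
  have := isFiniteMeasure_restrict_of_isBounded hΩb
  let b : ContDiffBump (0 : EuclideanSpace ℝ (Fin d)) := ⟨h / 2, h, half_pos hh, half_lt_self hh⟩
  have hb : Continuous (b.normed volume) := b.continuous_normed
  obtain ⟨K, hK⟩ := (b.contDiff_normed (μ := volume)
    (n := (⊤ : ℕ∞))).lipschitzWith_of_hasCompactSupport b.hasCompactSupport_normed (by simp)
  set A := √(volume.real Ω)
  have hA : 0 ≤ A := Real.sqrt_nonneg _
  obtain ⟨κ, hκ, hκA⟩ : ∃ κ : ℝ, 0 < κ ∧ A * A * K * κ < h :=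
    exists_pos_mul_lt hh _
  obtain ⟨N, y, hy⟩ := exists_finite_net_of_isBounded hΩb hκ
  refine ⟨N, fun j z => b.normed volume (z - y j), A, hA, fun j => ?_, fun w hw => ?_⟩
  · obtain ⟨B, hB⟩ := hb.bounded_above_of_compact_support b.hasCompactSupport_normed
    exact .of_bound (hb.comp (continuous_sub_right _)).aestronglyMeasurable B
      (.of_forall fun z => hB _)
  · simp only [hw.setIntegral_mul, hw.setIntegral_sq, hw.setIntegral_norm_gradient_sq]
    have hsq := integral_sq_le_of_mollify hw hΩb hK (fun z => b.nonneg_normed z)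
      b.integral_normed b.support_normed_eq.subset hκ.le hy
    rw [← Real.sq_sqrt (integral_nonneg fun x => sq_nonneg (w x)),
      Real.sqrt_sq (Real.sqrt_nonneg _)] at hsq
    change _ ≤ _ + A * ∑ j, |mollify (b.normed volume) w (y j)|
    set S := ∑ j, |mollify (b.normed volume) w (y j)|
    have : 0 ≤ S := Finset.sum_nonneg fun j _ => abs_nonneg _
    set n := √(∫ x, w x ^ 2)
    have hn : 0 ≤ n := Real.sqrt_nonneg _
    rcases hn.eq_or_lt with h0 | h0
    · rw [← h0]
      positivity
    · refine le_of_mul_le_mul_left ?_ h0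
      nlinarith [mul_le_mul_of_nonneg_right hκA.le (mul_nonneg h0.le h0.le)]

end ZeroTraceSobolev

/-! ### Galerkin approximation in `H₀¹` -/

section FiniteDimensionalApproximation

variable {V : Type*} [NormedAddCommGroup V] [InnerProductSpace ℝ V]

-- `U` is spanned by approximations in `D` of the projections of the `L j` to the closure of `D`.
lemma exists_finiteDimensional_abs_inner_le [CompleteSpace V] (D : Submodule ℝ V) {ι : Type*}
    [Finite ι] (L : ι → V) {θ : ℝ} (hθ : 0 < θ) :
    ∃ U : Submodule ℝ V, ∃ _ : FiniteDimensional ℝ U, U ≤ D ∧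
      ∀ w ∈ D.topologicalClosure, w ∈ Uᗮ → ∀ j, |inner ℝ w (L j)| ≤ θ * ‖w‖ := by
  set K := D.topologicalClosure
  have happrox : ∀ j, ∃ r ∈ D, dist (K.starProjection (L j)) r < θ := fun j =>
    Metric.mem_closure_iff.1 (K.starProjection_apply_mem (L j)) θ hθ
  choose r hrD hr using happrox
  refine ⟨.span ℝ (range r), .span_of_finite ℝ (finite_range r),
    Submodule.span_le.2 (range_subset_iff.2 hrD), fun w hw hwU j => ?_⟩
  have hK : inner ℝ w (L j - K.starProjection (L j)) = 0 :=
    K.inner_right_of_mem_orthogonal hw (K.sub_starProjection_mem_orthogonal _)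
  have hU : inner ℝ w (r j) = 0 :=
    Submodule.inner_left_of_mem_orthogonal (Submodule.subset_span (mem_range_self j)) hwU
  calc |inner ℝ w (L j)| = |inner ℝ w (K.starProjection (L j) - r j)| := by
        rw [inner_sub_right] at hK ⊢
        rw [hU, sub_zero, sub_eq_zero.1 hK]
    _ ≤ ‖w‖ * ‖K.starProjection (L j) - r j‖ := abs_real_inner_le_norm _ _
    _ ≤ θ * ‖w‖ := by
        rw [mul_comm, ← dist_eq_norm]
        gcongr
        exact (hr j).le

lemma exists_finiteDimensional_starProjection_close [CompleteSpace V] (D : Submodule ℝ V)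
    {ι : Type*} [Fintype ι] (L : ι → V) {q : V → ℝ} (hq : Continuous q) {η c : ℝ} (hη : 0 < η)
    (hc : 0 ≤ c) (hqD : ∀ v ∈ D, q v ≤ η / 2 * ‖v‖ + c * ∑ j, |inner ℝ v (L j)|) :
    ∃ U : Submodule ℝ V, ∃ _ : FiniteDimensional ℝ U, U ≤ D ∧
      ∀ x ∈ D.topologicalClosure, q (x - U.starProjection x) ≤ η * ‖x‖ := by
  have hqK : ∀ v ∈ D.topologicalClosure, q v ≤ η / 2 * ‖v‖ + c * ∑ j, |inner ℝ v (L j)| :=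
    closure_minimal (t := {v | q v ≤ η / 2 * ‖v‖ + c * ∑ j, |inner ℝ v (L j)|}) hqD
      (isClosed_le hq (by fun_prop))
  obtain ⟨θ, hθ, hθη⟩ : ∃ θ : ℝ, 0 < θ ∧ c * Fintype.card ι * θ < η / 2 :=
    exists_pos_mul_lt (half_pos hη) _
  obtain ⟨U, hU, hUD, hUL⟩ := exists_finiteDimensional_abs_inner_le D L hθ
  refine ⟨U, hU, hUD, fun x hx => ?_⟩
  set w := x - U.starProjection x
  have hwK : w ∈ D.topologicalClosure :=
    Submodule.sub_mem _ hx (D.le_topologicalClosure (hUD (U.starProjection_apply_mem x)))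
  have hwx : ‖w‖ ≤ ‖x‖ := by
    simpa only [U.starProjection_orthogonal_val] using Uᗮ.norm_starProjection_apply_le x
  calc q w ≤ η / 2 * ‖w‖ + c * ∑ j, |inner ℝ w (L j)| := hqK w hwK
    _ ≤ η / 2 * ‖w‖ + c * ∑ _j : ι, θ * ‖w‖ := by
        gcongr with j
        exact hUL w hwK (U.sub_starProjection_mem_orthogonal x) j
    _ = (η / 2 + c * Fintype.card ι * θ) * ‖w‖ := by
        rw [Finset.sum_const, Finset.card_univ, nsmul_eq_mul]
        ring
    _ ≤ η * ‖x‖ := by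
        gcongr
        linarith

lemma exists_orthonormal_starProjection_eq_sum (U : Submodule ℝ V) [FiniteDimensional ℝ U] :
    ∃ (n : ℕ) (B : Fin n → V), (∀ k, B k ∈ U) ∧
      (∀ a : Fin n → ℝ, ‖∑ k, a k • B k‖ ^ 2 = ∑ k, a k ^ 2) ∧
      ∀ x, U.starProjection x = ∑ k, (inner ℝ x (B k) : ℝ) • B k := by
  let B := stdOrthonormalBasis ℝ U
  have hB : Orthonormal ℝ fun k => (B k : V) := B.orthonormal.comp_linearIsometry U.subtypeₗᵢ
  refine ⟨_, fun k => B k, fun k => (B k).2, fun a => ?_, fun x => ?_⟩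
  · rw [← real_inner_self_eq_norm_sq, hB.inner_sum a a Finset.univ]
    simp [sq]
  · simp [B.starProjection_eq_sum_rankOne, real_inner_comm x]

end FiniteDimensionalApproximation

section Gradient

variable {E : Type*} [NormedAddCommGroup E] [InnerProductSpace ℝ E] [CompleteSpace E]
  {f g : E → ℝ}

lemma gradient_add_of_differentiable (hf : Differentiable ℝ f) (hg : Differentiable ℝ g) :
    ∇ (f + g) = ∇ f + ∇ g := by
  ext1 x
  simp only [gradient, Pi.add_apply, fderiv_add (hf x) (hg x), map_add]

lemma gradient_const_smul_of_differentiable (hf : Differentiable ℝ f) (c : ℝ) :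
    ∇ (c • f) = c • ∇ f := by
  ext1 x
  simp only [gradient, Pi.smul_apply, fderiv_const_smul (hf x) c, map_smul]

lemma gradient_sum_smul {ι : Type*} {s : Finset ι} {e : ι → E → ℝ}
    (he : ∀ k, Differentiable ℝ (e k)) (a : ι → ℝ) :
    ∇ (∑ k ∈ s, a k • e k) = ∑ k ∈ s, a k • ∇ (e k) := by
  ext1 x
  simp only [gradient, Finset.sum_apply, Pi.smul_apply, map_sum,
    fderiv_sum fun k _ => ((he k).const_smul (a k)) x, fderiv_const_smul (he _ x), map_smul]

end Gradient

section IsCcOn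

variable {X : Type*} [NormedAddCommGroup X] [NormedSpace ℝ X] {k : ℕ∞} {S : Set X} {f g : X → ℝ}

lemma isCcOn_zero : IsCcOn k S (0 : X → ℝ) :=
  ⟨contDiff_const, .zero, by simp [tsupport]⟩

lemma IsCcOn.add (hf : IsCcOn k S f) (hg : IsCcOn k S g) : IsCcOn k S (f + g) :=
  ⟨hf.1.add hg.1, hf.2.1.add hg.2.1, (tsupport_add f g).trans (union_subset hf.2.2 hg.2.2)⟩

lemma IsCcOn.const_smul (hf : IsCcOn k S f) (c : ℝ) : IsCcOn k S (c • f) :=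
  ⟨hf.1.const_smul c, hf.2.1.smul_left (f := fun _ => c),
    (closure_mono (Function.support_const_smul_subset c f)).trans hf.2.2⟩

variable (k S) in
/-- The space `C_c^k(S)`. -/
def ccSpace : Submodule ℝ (X → ℝ) where
  carrier := {f | IsCcOn k S f}
  add_mem' := IsCcOn.add
  zero_mem' := isCcOn_zero
  smul_mem' c _ hf := hf.const_smul c

lemma IsCcOn.sum_smul {ι : Type*} {s : Finset ι} {e : ι → X → ℝ} (he : ∀ i, IsCcOn k S (e i))
    (a : ι → ℝ) : IsCcOn k S (∑ i ∈ s, a i • e i) :=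
  (ccSpace k S).sum_smul_mem a fun i _ => he i

end IsCcOn

section Galerkin

variable {d : ℕ} {Ω : Set (EuclideanSpace ℝ (Fin d))}

/-- The squared norm in `H¹(Ω)` of a function `u` with weak gradient `g`. -/
noncomputable def h1NormSq (Ω : Set (EuclideanSpace ℝ (Fin d)))
    (u : EuclideanSpace ℝ (Fin d) → ℝ) (g : EuclideanSpace ℝ (Fin d) → EuclideanSpace ℝ (Fin d)) :
    ℝ :=
  (∫ x in Ω, u x ^ 2) + ∫ x in Ω, ‖g x‖ ^ 2

/-- The inner product in `H¹(Ω)` of a function `u` with weak gradient `g` and a smooth `φ`. -/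
noncomputable def h1Inner (Ω : Set (EuclideanSpace ℝ (Fin d)))
    (u : EuclideanSpace ℝ (Fin d) → ℝ) (g : EuclideanSpace ℝ (Fin d) → EuclideanSpace ℝ (Fin d))
    (φ : EuclideanSpace ℝ (Fin d) → ℝ) : ℝ :=
  (∫ x in Ω, u x * φ x) + ∫ x in Ω, inner ℝ (g x) (∇ φ x)

lemma h1NormSq_nonneg (u : EuclideanSpace ℝ (Fin d) → ℝ)
    (g : EuclideanSpace ℝ (Fin d) → EuclideanSpace ℝ (Fin d)) : 0 ≤ h1NormSq Ω u g := by
  unfold h1NormSq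
  positivity

/-- The Hilbert space `L²(Ω) × L²(Ω; ℝ^d)`, in which `H₀¹(Ω)` is a closed subspace. -/
abbrev L2Pair (Ω : Set (EuclideanSpace ℝ (Fin d))) : Type :=
  WithLp 2 (Lp ℝ 2 (volume.restrict Ω) × Lp (EuclideanSpace ℝ (Fin d)) 2 (volume.restrict Ω))

/-- The element of `L2Pair Ω` given by two square-integrable functions. -/
noncomputable def toPair {u : EuclideanSpace ℝ (Fin d) → ℝ}
    {g : EuclideanSpace ℝ (Fin d) → EuclideanSpace ℝ (Fin d)}
    (hu : MemLp u 2 (volume.restrict Ω)) (hg : MemLp g 2 (volume.restrict Ω)) : L2Pair Ω :=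
  WithLp.toLp 2 (hu.toLp u, hg.toLp g)

section toPair

variable {u v : EuclideanSpace ℝ (Fin d) → ℝ}
  {g k : EuclideanSpace ℝ (Fin d) → EuclideanSpace ℝ (Fin d)}
  (hu : MemLp u 2 (volume.restrict Ω)) (hg : MemLp g 2 (volume.restrict Ω))
  (hv : MemLp v 2 (volume.restrict Ω)) (hk : MemLp k 2 (volume.restrict Ω))

lemma inner_toPair : inner ℝ (toPair hu hg) (toPair hv hk)
    = (∫ x in Ω, u x * v x) + ∫ x in Ω, inner ℝ (g x) (k x) := by
  rw [WithLp.prod_inner_apply, toPair, toPair, L2.inner_def, L2.inner_def]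
  congr 1
  · refine integral_congr_ae ?_
    filter_upwards [hu.coeFn_toLp, hv.coeFn_toLp] with x hux hvx
    rw [hux, hvx, Real.inner_apply]
  · refine integral_congr_ae ?_
    filter_upwards [hg.coeFn_toLp, hk.coeFn_toLp] with x hgx hkx
    rw [hgx, hkx]

lemma norm_sq_toPair : ‖toPair hu hg‖ ^ 2 = h1NormSq Ω u g := by
  rw [← real_inner_self_eq_norm_sq, inner_toPair]
  simp only [h1NormSq, real_inner_self_eq_norm_sq, ← sq]

lemma norm_fst_toPair : ‖(toPair hu hg).fst‖ = √(∫ x in Ω, u x ^ 2) := by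
  simpa [toPair] using toReal_eLpNorm_two hu

lemma norm_snd_toPair : ‖(toPair hu hg).snd‖ = √(∫ x in Ω, ‖g x‖ ^ 2) := by
  simpa [toPair] using toReal_eLpNorm_two hg

lemma toPair_congr (huv : u = v) (hgk : g = k) : toPair hu hg = toPair hv hk := by
  subst huv hgk; rfl

lemma toPair_sub : toPair hu hg - toPair hv hk = toPair (hu.sub hv) (hg.sub hk) := rfl

end toPair

/-- The embedding `φ ↦ (φ, ∇φ)` of `C_c^∞(Ω)` in `L²(Ω) × L²(Ω; ℝ^d)`. -/
noncomputable def ccToPair (Ω : Set (EuclideanSpace ℝ (Fin d))) : ccSpace ⊤ Ω →ₗ[ℝ] L2Pair Ω where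
  toFun φ := toPair (φ.2.memLp 2 _) (φ.2.memLp_gradient 2 _)
  map_add' φ ψ := toPair_congr _ _ ((φ.2.memLp 2 _).add (ψ.2.memLp 2 _))
    ((φ.2.memLp_gradient 2 _).add (ψ.2.memLp_gradient 2 _)) rfl
    (gradient_add_of_differentiable φ.2.differentiable ψ.2.differentiable)
  map_smul' c φ := toPair_congr _ _ ((φ.2.memLp 2 _).const_smul c)
    ((φ.2.memLp_gradient 2 _).const_smul c) rfl
    (gradient_const_smul_of_differentiable φ.2.differentiable c)

lemma ccToPair_apply (φ : ccSpace ⊤ Ω) :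
    ccToPair Ω φ = toPair (φ.2.memLp 2 _) (φ.2.memLp_gradient 2 _) := rfl

lemma toPair_mem_topologicalClosure {u : EuclideanSpace ℝ (Fin d) → ℝ}
    {g : EuclideanSpace ℝ (Fin d) → EuclideanSpace ℝ (Fin d)} (h : IsH01 Ω u g) :
    toPair h.1 h.2.1 ∈ (ccToPair Ω).range.topologicalClosure := by
  obtain ⟨hu, hg, φ, hφ, hφu, hφg⟩ := h
  have hu' := (Lp.tendsto_Lp_iff_tendsto_eLpNorm'' φ (fun n => (hφ n).memLp 2 _) u hu).2 hφu
  have hg' := (Lp.tendsto_Lp_iff_tendsto_eLpNorm'' (fun n => ∇ (φ n))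
    (fun n => (hφ n).memLp_gradient 2 _) g hg).2 hφg
  exact mem_closure_of_tendsto
    (((WithLp.prod_continuous_toLp 2 _ _).tendsto _).comp (hu'.prodMk_nhds hg'))
    (.of_forall fun n => ⟨⟨φ n, hφ n⟩, rfl⟩)

lemma exists_finiteDimensional_norm_fst_sub_starProjection_le (hΩb : Bornology.IsBounded Ω)
    {η : ℝ} (hη : 0 < η) :
    ∃ U : Submodule ℝ (L2Pair Ω), ∃ _ : FiniteDimensional ℝ U, U ≤ (ccToPair Ω).range ∧
      ∀ x ∈ (ccToPair Ω).range.topologicalClosure, ‖(x - U.starProjection x).fst‖ ≤ η * ‖x‖ := by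
  obtain ⟨N, ℓ, c, hc, hℓ, hℓφ⟩ := exists_finite_family_l2_le hΩb (h := η / 4) (by positivity)
  refine exists_finiteDimensional_starProjection_close _
    (fun j => toPair (hℓ j) (MemLp.zero (p := 2))) (q := fun v : L2Pair Ω => ‖v.fst‖)
    (WithLp.prod_continuous_ofLp 2 _ _).fst.norm hη hc ?_
  rintro _ ⟨φ, rfl⟩
  have hφ := φ.2.memLp 2 (volume.restrict Ω)
  have hφg := φ.2.memLp_gradient 2 (volume.restrict Ω)
  have hfst := WithLp.norm_fst_le _ (toPair hφ hφg)
  have hsnd := WithLp.norm_snd_le _ (toPair hφ hφg)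
  have hinner : ∀ j, inner ℝ (ccToPair Ω φ) (toPair (hℓ j) (MemLp.zero (p := 2)))
      = ∫ x in Ω, φ.1 x * ℓ j x := fun j => (inner_toPair hφ hφg _ _).trans (by simp)
  simp only [hinner]
  refine (norm_fst_toPair hφ hφg).trans_le ((hℓφ φ.1 φ.2).trans ?_)
  rw [← norm_fst_toPair hφ hφg, ← norm_snd_toPair hφ hφg]
  exact add_le_add_left (show _ ≤ η / 2 * ‖toPair hφ hφg‖ by nlinarith) _

/-- A finite family in `C_c^∞(Ω)`, orthonormal for the inner product of `H¹(Ω)`, such that the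
`H¹`-orthogonal projection to its span moves elements of `H₀¹(Ω)` by at most `η` times their `H¹`
norm in `L²(Ω)`. -/
structure GalerkinFamily (Ω : Set (EuclideanSpace ℝ (Fin d))) (η : ℝ) where
  /-- the number of members -/
  card : ℕ
  /-- the members -/
  basis : Fin card → EuclideanSpace ℝ (Fin d) → ℝ
  isCcOn : ∀ k, IsCcOn ⊤ Ω (basis k)
  h1NormSq_sum : ∀ a : Fin card → ℝ,
    h1NormSq Ω (∑ k, a k • basis k) (∇ (∑ k, a k • basis k)) = ∑ k, a k ^ 2
  sum_h1Inner_sq_le : ∀ u g, IsH01 Ω u g → ∑ k, h1Inner Ω u g (basis k) ^ 2 ≤ h1NormSq Ω u g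
  integral_sub_sq_le : ∀ u g, IsH01 Ω u g →
    ∫ x in Ω, (u x - (∑ k, h1Inner Ω u g (basis k) • basis k) x) ^ 2 ≤ η ^ 2 * h1NormSq Ω u g

theorem nonempty_galerkinFamily (hΩb : Bornology.IsBounded Ω) {η : ℝ} (hη : 0 < η) :
    Nonempty (GalerkinFamily Ω η) := by
  obtain ⟨U, hU, hUcc, hUη⟩ := exists_finiteDimensional_norm_fst_sub_starProjection_le hΩb hη
  obtain ⟨n, B, hBU, hBnorm, hBproj⟩ := exists_orthonormal_starProjection_eq_sum U
  choose e heB using fun k => hUcc (hBU k)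
  have hsum : ∀ a : Fin n → ℝ, ∑ k, a k • B k
      = ccToPair Ω ⟨∑ k, a k • (e k).1, .sum_smul (fun k => (e k).2) a⟩ := fun a => by
    simp only [← heB, ← map_smul, ← map_sum]
    congr 1
    ext1
    simp
  have hcoeff : ∀ u g (h : IsH01 Ω u g) k,
      inner ℝ (toPair h.1 h.2.1) (B k) = h1Inner Ω u g (e k) := fun u g h k => by
    rw [← heB k]
    exact inner_toPair _ _ _ _
  have hproj : ∀ u g (h : IsH01 Ω u g), U.starProjection (toPair h.1 h.2.1)
      = ∑ k, h1Inner Ω u g (e k) • B k := fun u g h => by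
    simp only [hBproj, hcoeff u g h]
  refine ⟨⟨n, fun k => e k, fun k => (e k).2, fun a => ?_, fun u g h => ?_, fun u g h => ?_⟩⟩
  · rw [← hBnorm, hsum]
    exact (norm_sq_toPair _ _).symm
  · rw [← norm_sq_toPair h.1 h.2.1, ← hBnorm, ← hproj u g h]
    gcongr
    exact U.norm_starProjection_apply_le _
  · have hclose := hUη _ (toPair_mem_topologicalClosure h)
    rw [hproj u g h, hsum, ccToPair_apply, toPair_sub, norm_fst_toPair] at hclose
    rw [← norm_sq_toPair h.1 h.2.1, ← mul_pow]
    exact (Real.sqrt_le_left (by positivity)).1 hclose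

end Galerkin

/-! ### Controlling the distance by finitely many integrals -/

section GalerkinDistance

variable {d : ℕ} {Ω : Set (EuclideanSpace ℝ (Fin d))}

/-- Soft thresholding, the proximal map of `k * |·|`: it shrinks `s` towards `0` by `k` and
vanishes on `[-k, k]`. Applied to a function vanishing off `Ω`, it makes room for mollification. -/
noncomputable def softThreshold (k s : ℝ) : ℝ := max (s - k) 0 + min (s + k) 0

lemma lipschitzWith_softThreshold {k : ℝ} (hk : 0 ≤ k) : LipschitzWith 1 (softThreshold k) := by
  refine LipschitzWith.of_dist_le_mul fun s t => ?_
  rw [NNReal.coe_one, one_mul, Real.dist_eq, Real.dist_eq]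
  unfold softThreshold
  rcases le_total (s - k) 0 with h1 | h1 <;> rcases le_total (s + k) 0 with h2 | h2 <;>
  rcases le_total (t - k) 0 with h3 | h3 <;> rcases le_total (t + k) 0 with h4 | h4 <;>
  simp only [h1, h2, h3, h4, max_eq_left, max_eq_right, min_eq_left, min_eq_right] <;>
  cases abs_cases (s - t) <;> rw [abs_le] <;> constructor <;> linarith

lemma softThreshold_eq_zero {k s : ℝ} (h : |s| ≤ k) : softThreshold k s = 0 := by
  obtain ⟨hl, hr⟩ := abs_le.1 h
  rw [softThreshold, max_eq_right (by linarith), min_eq_right (by linarith), add_zero]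

lemma abs_softThreshold_sub_self_le {k : ℝ} (hk : 0 ≤ k) (s : ℝ) :
    |softThreshold k s - s| ≤ k := by
  unfold softThreshold
  rcases le_total (s - k) 0 with h1 | h1 <;> rcases le_total (s + k) 0 with h2 | h2 <;>
  simp only [h1, h2, max_eq_left, max_eq_right, min_eq_left, min_eq_right] <;>
  rw [abs_le] <;> constructor <;> linarith

section NormedConvolution

variable {E : Type*} [NormedAddCommGroup E] [NormedSpace ℝ E] [FiniteDimensional ℝ E]
  [MeasurableSpace E] [BorelSpace E] {μ : Measure E} [μ.IsAddHaarMeasure]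

open scoped Convolution

lemma lipschitzWith_normed_convolution (b : ContDiffBump (0 : E)) {K : ℝ≥0} {θ : E → ℝ}
    (hθ : LipschitzWith K θ) :
    LipschitzWith K (b.normed μ ⋆[ContinuousLinearMap.lsmul ℝ ℝ, μ] θ) := by
  have hi : ∀ x, Integrable (fun z => b.normed μ z * θ (x - z)) μ := fun x =>
    (b.continuous_normed.mul
      (hθ.continuous.comp (continuous_sub_left x))).integrable_of_hasCompactSupport
        b.hasCompactSupport_normed.mul_right
  refine LipschitzWith.of_dist_le_mul fun x y => ?_
  calc dist ((b.normed μ ⋆[ContinuousLinearMap.lsmul ℝ ℝ, μ] θ) x)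
        ((b.normed μ ⋆[ContinuousLinearMap.lsmul ℝ ℝ, μ] θ) y)
      = ‖∫ z, b.normed μ z * (θ (x - z) - θ (y - z)) ∂μ‖ := by
        simp only [mul_sub]
        rw [integral_sub (hi x) (hi y), dist_eq_norm]
        rfl
    _ ≤ ∫ z, b.normed μ z * (K * dist x y) ∂μ := by
        refine norm_integral_le_of_norm_le (b.integrable_normed.mul_const _)
          (.of_forall fun z => ?_)
        rw [norm_mul, Real.norm_of_nonneg (b.nonneg_normed z), ← dist_eq_norm,
          ← dist_sub_right x y z]
        exact mul_le_mul_of_nonneg_left (hθ.dist_le_mul _ _) (b.nonneg_normed z)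
    _ = K * dist x y := by rw [integral_mul_const, b.integral_normed, one_mul]

end NormedConvolution

lemma softThreshold_eq_zero_of_infDist_lt {ψ : EuclideanSpace ℝ (Fin d) → ℝ}
    (hΩc : Ωᶜ.Nonempty) (hψ : ψ ∈ zeroLip Ω) {k : ℝ} {x : EuclideanSpace ℝ (Fin d)}
    (hx : Metric.infDist x Ωᶜ < k) : softThreshold k (ψ x) = 0 := by
  obtain ⟨y, hy, hxy⟩ := (Metric.infDist_lt_iff hΩc).1 hx
  exact softThreshold_eq_zero ((abs_le_dist_of_mem_zeroLip hψ x hy).trans hxy.le)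

lemma isCcOn_of_eq_zero_of_infDist_lt (hΩb : Bornology.IsBounded Ω) {k : ℕ∞} {r : ℝ} (hr : 0 < r)
    {φ : EuclideanSpace ℝ (Fin d) → ℝ} (hφ : ContDiff ℝ k φ)
    (h : ∀ x, Metric.infDist x Ωᶜ < r → φ x = 0) : IsCcOn k Ω φ := by
  have hSΩ : {x | r ≤ Metric.infDist x Ωᶜ} ⊆ Ω := fun x hx => by
    by_contra hxΩ
    exact hr.not_ge (hx.trans_eq (Metric.infDist_zero_of_mem hxΩ))
  have hSclosed : IsClosed {x | r ≤ Metric.infDist x Ωᶜ} :=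
    isClosed_le continuous_const (Metric.continuous_infDist_pt _)
  have hsupp : tsupport φ ⊆ {x | r ≤ Metric.infDist x Ωᶜ} :=
    closure_minimal (fun x hx => not_lt.1 fun hlt => hx (h x hlt)) hSclosed
  exact ⟨hφ, (Metric.isCompact_of_isClosed_isBounded hSclosed
    (hΩb.subset hSΩ)).of_isClosed_subset (isClosed_tsupport φ) hsupp, hsupp.trans hSΩ⟩

lemma exists_isCcOn_mem_zeroLip_close (hΩb : Bornology.IsBounded Ω) (hΩc : Ωᶜ.Nonempty)
    {ψ : EuclideanSpace ℝ (Fin d) → ℝ} (hψ : ψ ∈ zeroLip Ω) {κ : ℝ} (hκ : 0 < κ) :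
    ∃ φ, IsCcOn ⊤ Ω φ ∧ φ ∈ zeroLip Ω ∧ ∀ x, |φ x - ψ x| ≤ κ := by
  let θ : EuclideanSpace ℝ (Fin d) → ℝ := fun x => softThreshold (κ / 2) (ψ x)
  have hθ : LipschitzWith 1 θ :=
    ((lipschitzWith_softThreshold (half_pos hκ).le).comp hψ.1).weaken (one_mul 1).le
  let b : ContDiffBump (0 : EuclideanSpace ℝ (Fin d)) :=
    ⟨κ / 8, κ / 4, by positivity, by linarith⟩
  let φ := MeasureTheory.convolution (b.normed volume) θ (ContinuousLinearMap.lsmul ℝ ℝ) volume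
  have hsmooth : ContDiff ℝ ∞ φ :=
    b.hasCompactSupport_normed.contDiff_convolution_left (n := ⊤)
      (ContinuousLinearMap.lsmul ℝ ℝ) b.contDiff_normed hθ.continuous.locallyIntegrable
  have hzero : ∀ x, Metric.infDist x Ωᶜ < κ / 4 → φ x = 0 := fun x hx => by
    have hball : ∀ y ∈ Metric.ball x (κ / 4), θ y = 0 := fun y hy =>
      softThreshold_eq_zero_of_infDist_lt hΩc hψ <| by
        linarith [Metric.infDist_le_infDist_add_dist (s := Ωᶜ) (x := y) (y := x),
          Metric.mem_ball.1 hy]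
    have hx0 : θ x = 0 := hball x (Metric.mem_ball_self (by positivity))
    exact (b.normed_convolution_eq_right fun y hy => (hball y hy).trans hx0.symm).trans hx0
  have hcc : IsCcOn ⊤ Ω φ := isCcOn_of_eq_zero_of_infDist_lt hΩb (by positivity) hsmooth hzero
  refine ⟨φ, hcc, ⟨lipschitzWith_normed_convolution b hθ, fun x hx => hcc.eq_zero hx⟩,
    fun x => ?_⟩
  have hφθ : dist (φ x) (θ x) ≤ κ / 4 :=
    b.dist_normed_convolution_le hθ.continuous.aestronglyMeasurable fun y hy =>
      (hθ.dist_le_mul y x).trans (by simpa using (Metric.mem_ball.1 hy).le)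
  have hθψ : |θ x - ψ x| ≤ κ / 2 := abs_softThreshold_sub_self_le (by positivity) _
  exact (abs_sub_le _ (θ x) _).trans (by rw [Real.dist_eq] at hφθ; linarith)

lemma IsCcOn.isH01 {φ : EuclideanSpace ℝ (Fin d) → ℝ} (hφ : IsCcOn ⊤ Ω φ) :
    IsH01 Ω φ (∇ φ) :=
  ⟨hφ.memLp 2 _, hφ.memLp_gradient 2 _, fun _ => φ, fun _ => hφ, by simp, by simp⟩

lemma exists_h1NormSq_le_of_mem_zeroLip (hΩb : Bornology.IsBounded Ω) (hΩc : Ωᶜ.Nonempty) :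
    ∃ C, ∀ φ, IsCcOn ⊤ Ω φ → φ ∈ zeroLip Ω → h1NormSq Ω φ (∇ φ) ≤ C := by
  have := isFiniteMeasure_restrict_of_isBounded hΩb
  obtain ⟨D, hD⟩ := exists_abs_le_of_mem_zeroLip hΩb hΩc
  refine ⟨(∫ _ in Ω, D ^ 2) + ∫ _ in Ω, 1, fun φ hφ hφL => add_le_add ?_ ?_⟩
  · exact integral_mono (hφ.memLp 2 _).integrable_sq (integrable_const _) fun x =>
      sq_le_sq' (abs_le.1 (hD φ hφL x)).1 (abs_le.1 (hD φ hφL x)).2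
  · refine integral_mono ((hφ.memLp_gradient 2 _).integrable_norm_pow (by norm_num))
      (integrable_const _) fun x => pow_le_one₀ (norm_nonneg _) ?_
    rw [norm_gradient_eq]
    simpa using norm_fderiv_le_of_lipschitz ℝ hφL.1 (x₀ := x)

lemma SubProb.integral_sub_eq (hΩ : MeasurableSet Ω) {m n : SubProb Ω} (hm : m.InL2)
    (hn : n.InL2) {f : EuclideanSpace ℝ (Fin d) → ℝ} (hf : MemLp f 2 (volume.restrict Ω)) :
    ∫ x, f x ∂m.meas - ∫ x, f x ∂n.meas = ∫ x in Ω, (m.density x - n.density x) * f x := by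
  have hfm : Integrable (fun x => f x * m.density x) (volume.restrict Ω) := hf.integrable_mul hm.2
  have hfn : Integrable (fun x => f x * n.density x) (volume.restrict Ω) := hf.integrable_mul hn.2
  rw [m.integral_eq hΩ hm.1, n.integral_eq hΩ hn.1, ← integral_sub hfm hfn]
  exact integral_congr_ae (.of_forall fun x => by simp only; ring)

lemma abs_sum_mul_le_sqrt {ι : Type*} (s : Finset ι) (a b : ι → ℝ) :
    |∑ k ∈ s, a k * b k| ≤ √(∑ k ∈ s, a k ^ 2) * √(∑ k ∈ s, b k ^ 2) := by
  rw [← Real.sqrt_mul (Finset.sum_nonneg fun k _ => sq_nonneg _), ← Real.sqrt_sq_eq_abs]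
  exact Real.sqrt_le_sqrt (Finset.sum_mul_sq_le_sq_mul_sq _ _ _)

namespace GalerkinFamily

variable {η : ℝ} (𝓔 : GalerkinFamily Ω η) {φ : EuclideanSpace ℝ (Fin d) → ℝ} {m n : SubProb Ω}

lemma isCcOn_sum (a : Fin 𝓔.card → ℝ) : IsCcOn ⊤ Ω (∑ k, a k • 𝓔.basis k) :=
  .sum_smul 𝓔.isCcOn a

lemma integral_sub_eq (hΩ : MeasurableSet Ω) (hm : m.InL2) (hn : n.InL2)
    (hφ : MemLp φ 2 (volume.restrict Ω)) (a : Fin 𝓔.card → ℝ) :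
    ∫ x, φ x ∂m.meas - ∫ x, φ x ∂n.meas
      = (∫ x in Ω, (m.density x - n.density x) * (φ x - (∑ k, a k • 𝓔.basis k) x))
        + ∑ k, a k * (∫ x, 𝓔.basis k x ∂m.meas - ∫ x, 𝓔.basis k x ∂n.meas) := by
  have hint : ∀ f, MemLp f 2 (volume.restrict Ω) →
      Integrable (fun x => (m.density x - n.density x) * f x) (volume.restrict Ω) :=
    fun f hf => (hm.2.sub hn.2).integrable_mul hf
  have hsum2 := (𝓔.isCcOn_sum a).memLp 2 (volume.restrict Ω)
  have hsum : ∑ k, a k * (∫ x, 𝓔.basis k x ∂m.meas - ∫ x, 𝓔.basis k x ∂n.meas)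
      = ∫ x in Ω, (m.density x - n.density x) * (∑ k, a k • 𝓔.basis k) x := by
    simp only [Finset.sum_apply, Finset.mul_sum]
    rw [integral_finsetSum _ fun k _ => hint _ (((𝓔.isCcOn k).memLp 2 _).const_smul (a k))]
    refine Finset.sum_congr rfl fun k _ => ?_
    rw [SubProb.integral_sub_eq hΩ hm hn ((𝓔.isCcOn k).memLp 2 _), ← integral_const_mul]
    exact integral_congr_ae (.of_forall fun x => by
      simp only [Pi.smul_apply, smul_eq_mul]; ring)
  have hresidual : Integrable (fun x => (m.density x - n.density x) *
      (φ x - (∑ k, a k • 𝓔.basis k) x)) (volume.restrict Ω) := hint _ (hφ.sub hsum2)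
  rw [SubProb.integral_sub_eq hΩ hm hn hφ, hsum, ← integral_add hresidual (hint _ hsum2)]
  exact integral_congr_ae (.of_forall fun x => by simp only; ring)

/-- The squared Euclidean distance between the coefficients `∫ eₖ dm` and `∫ eₖ dn`, a
finite-dimensional and smooth substitute for `edist m n`. -/
noncomputable def distSq (m n : SubProb Ω) : ℝ :=
  ∑ k, (∫ x, 𝓔.basis k x ∂m.meas - ∫ x, 𝓔.basis k x ∂n.meas) ^ 2

lemma distSq_nonneg : 0 ≤ 𝓔.distSq m n := Finset.sum_nonneg fun _ _ => sq_nonneg _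

lemma integral_sub_le (hΩ : MeasurableSet Ω) (hη : 0 ≤ η) (hm : m.InL2) (hn : n.InL2)
    (hφ : IsCcOn ⊤ Ω φ) :
    ∫ x, φ x ∂m.meas - ∫ x, φ x ∂n.meas ≤ √(h1NormSq Ω φ (∇ φ)) *
      (√(𝓔.distSq m n)
        + η * √(∫ x in Ω, (m.density x - n.density x) ^ 2)) := by
  have hφ2 := hφ.memLp 2 (volume.restrict Ω)
  let a := fun k => h1Inner Ω φ (∇ φ) (𝓔.basis k)
  have hcoeff := Real.sqrt_le_sqrt (𝓔.sum_h1Inner_sq_le φ _ hφ.isH01)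
  have hresidual := Real.sqrt_le_sqrt (𝓔.integral_sub_sq_le φ _ hφ.isH01)
  rw [Real.sqrt_mul (sq_nonneg _), Real.sqrt_sq hη] at hresidual
  rw [𝓔.integral_sub_eq hΩ hm hn hφ2 a, mul_add, add_comm]
  refine add_le_add ((le_abs_self _).trans ?_) ((le_abs_self _).trans ?_)
  · refine (abs_sum_mul_le_sqrt _ a _).trans ?_
    exact mul_le_mul_of_nonneg_right hcoeff (Real.sqrt_nonneg _)
  · refine (abs_integral_mul_le (hm.2.sub hn.2)
      (hφ2.sub ((𝓔.isCcOn_sum a).memLp 2 _))).trans ?_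
    rw [mul_comm, mul_left_comm, ← mul_assoc]
    exact mul_le_mul_of_nonneg_right hresidual (Real.sqrt_nonneg _)

end GalerkinFamily

theorem exists_edist_le_galerkin (hΩ : IsOpen Ω) (hΩb : Bornology.IsBounded Ω)
    (hΩc : Ωᶜ.Nonempty) :
    ∃ C > 0, ∀ η ≥ 0, ∀ (𝓔 : GalerkinFamily Ω η) (m n : SubProb Ω), m.InL2 → n.InL2 →
      edist m n ≤ ENNReal.ofReal
        (C * (√(𝓔.distSq m n)
          + η * √(∫ x in Ω, (m.density x - n.density x) ^ 2))) := by
  obtain ⟨B, hB⟩ := exists_h1NormSq_le_of_mem_zeroLip hΩb hΩc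
  refine ⟨√B + 1, by positivity, fun η hη 𝓔 m n hm hn => edist_le_ofReal fun ψ hψ =>
    le_of_forall_pos_le_add fun κ hκ => ?_⟩
  obtain ⟨φ, hφ, hφL, hφψ⟩ := exists_isCcOn_mem_zeroLip_close hΩb hΩc hψ (half_pos hκ)
  have hclose : ∀ p : SubProb Ω, |∫ x, φ x ∂p.meas - ∫ x, ψ x ∂p.meas| ≤ κ / 2 := fun p =>
    p.abs_integral_sub_le (p.integrable_of_mem_zeroLip hΩb hΩc hφL)
      (p.integrable_of_mem_zeroLip hΩb hΩc hψ) (by positivity) fun x _ => hφψ x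
  have hφmn := 𝓔.integral_sub_le hΩ.measurableSet hη hm hn hφ
  have hbound := hφmn.trans (mul_le_mul_of_nonneg_right
    ((Real.sqrt_le_sqrt (hB φ hφ hφL)).trans (le_add_of_nonneg_right zero_le_one))
    (by positivity))
  linarith [abs_le.1 (hclose m), abs_le.1 (hclose n)]

end GalerkinDistance

/-! ### Integration by parts -/

section QuadraticTestFunctions

variable {d : ℕ} {Ω : Set (EuclideanSpace ℝ (Fin d))}

section Laplacian

variable {φ ψ : EuclideanSpace ℝ (Fin d) → ℝ}

lemma IsCcOn.fderiv_apply (hφ : IsCcOn ⊤ Ω φ) (v : EuclideanSpace ℝ (Fin d)) :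
    IsCcOn ⊤ Ω fun x => fderiv ℝ φ x v :=
  ⟨(hφ.1.fderiv_right (m := (⊤ : ℕ∞)) (by simp)).clm_apply contDiff_const,
    hφ.2.1.fderiv_apply ℝ v, (tsupport_fderiv_apply_subset ℝ v).trans hφ.2.2⟩

lemma IsCcOn.laplacian_eq (hφ : IsCcOn ⊤ Ω φ) : Δ φ = fun x => ∑ i,
    fderiv ℝ (fun y => fderiv ℝ φ y (EuclideanSpace.basisFun (Fin d) ℝ i)) x
      (EuclideanSpace.basisFun (Fin d) ℝ i) := by
  ext x
  rw [InnerProductSpace.laplacian_eq_iteratedFDeriv_orthonormalBasis φ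
    (EuclideanSpace.basisFun (Fin d) ℝ)]
  refine Finset.sum_congr rfl fun i _ => ?_
  have hd : DifferentiableAt ℝ (fderiv ℝ φ) x :=
    (hφ.1.fderiv_right (m := (⊤ : ℕ∞)) (by simp)).differentiable (by simp) x
  rw [iteratedFDeriv_two_apply, fderiv_clm_apply hd (differentiableAt_const _)]
  simp

lemma IsCcOn.memLp_laplacian (hφ : IsCcOn ⊤ Ω φ) (p : ℝ≥0∞)
    (μ : Measure (EuclideanSpace ℝ (Fin d))) [IsFiniteMeasureOnCompacts μ] :
    MemLp (Δ φ) p μ := by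
  rw [hφ.laplacian_eq]
  exact memLp_finsetSum _ fun i _ => ((hφ.fderiv_apply _).fderiv_apply _).memLp p μ

lemma IsCcOn.integrable_mul (hφ : IsCcOn ⊤ Ω φ) (hψ : IsCcOn ⊤ Ω ψ) :
    Integrable (fun x => φ x * ψ x) volume :=
  (hφ.memLp 2 volume).integrable_mul (hψ.memLp 2 volume)

lemma inner_gradient_eq_sum_fderiv (φ ψ : EuclideanSpace ℝ (Fin d) → ℝ)
    (x : EuclideanSpace ℝ (Fin d)) :
    inner ℝ (∇ ψ x) (∇ φ x) = ∑ i, fderiv ℝ ψ x (EuclideanSpace.basisFun (Fin d) ℝ i) *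
      fderiv ℝ φ x (EuclideanSpace.basisFun (Fin d) ℝ i) := by
  rw [← (EuclideanSpace.basisFun (Fin d) ℝ).sum_inner_mul_inner]
  refine Finset.sum_congr rfl fun i _ => ?_
  rw [inner_gradient_left, real_inner_comm, inner_gradient_left]

lemma IsCcOn.integral_mul_laplacian (hφ : IsCcOn ⊤ Ω φ) (hψ : IsCcOn ⊤ Ω ψ) :
    (∫ x in Ω, ψ x * Δ φ x) + ∫ x in Ω, inner ℝ (∇ ψ x) (∇ φ x) = 0 := by
  have hgrad : ∫ x in Ω, inner ℝ (∇ ψ x) (∇ φ x) = ∫ x, inner ℝ (∇ ψ x) (∇ φ x) :=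
    setIntegral_eq_integral_of_forall_compl_eq_zero fun x hx => by
      rw [hψ.gradient_eq_zero hx, inner_zero_left]
  rw [hψ.setIntegral_mul, hgrad]
  simp only [hφ.laplacian_eq, inner_gradient_eq_sum_fderiv, Finset.mul_sum]
  rw [integral_finsetSum _ fun i _ => hψ.integrable_mul ((hφ.fderiv_apply _).fderiv_apply _),
    integral_finsetSum _ fun i _ => (hψ.fderiv_apply _).integrable_mul (hφ.fderiv_apply _),
    ← Finset.sum_add_distrib]
  refine Finset.sum_eq_zero fun i _ => ?_
  rw [integral_mul_fderiv_eq_neg_fderiv_mul_of_integrable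
    ((hψ.fderiv_apply _).integrable_mul (hφ.fderiv_apply _))
    (hψ.integrable_mul ((hφ.fderiv_apply _).fderiv_apply _))
    (hψ.integrable_mul (hφ.fderiv_apply _)) (fun x _ => hψ.differentiable x)
    (fun x _ => (hφ.fderiv_apply _).differentiable x), neg_add_cancel]

theorem IsH01.integral_mul_laplacian {u : EuclideanSpace ℝ (Fin d) → ℝ}
    {g : EuclideanSpace ℝ (Fin d) → EuclideanSpace ℝ (Fin d)} (hu : IsH01 Ω u g)
    (hφ : IsCcOn ⊤ Ω φ) :
    (∫ x in Ω, u x * Δ φ x) + ∫ x in Ω, inner ℝ (g x) (∇ φ x) = 0 := by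
  have hLap := hφ.memLp_laplacian 2 (volume.restrict Ω)
  have hgrad := hφ.memLp_gradient 2 (volume.restrict Ω)
  have hcl : IsClosed {v : L2Pair Ω | inner ℝ v (toPair hLap hgrad) = 0} :=
    isClosed_eq (continuous_id.inner continuous_const) continuous_const
  have hcc : ((ccToPair Ω).range : Set (L2Pair Ω)) ⊆
      {v | inner ℝ v (toPair hLap hgrad) = 0} := by
    rintro _ ⟨ψ, rfl⟩
    exact (inner_toPair _ _ _ _).trans (hφ.integral_mul_laplacian ψ.2)
  exact (inner_toPair hu.1 hu.2.1 hLap hgrad).symm.trans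
    (closure_minimal hcc hcl (toPair_mem_topologicalClosure hu))

end Laplacian

lemma tendsto_eLpNorm_sub_sub {X E : Type*} [MeasurableSpace X] {μ : Measure X}
    [NormedAddCommGroup E] {p : ℝ≥0∞} (hp : 1 ≤ p) {f h : ℕ → X → E} {u v : X → E}
    (hf : ∀ n, MemLp (f n) p μ) (hh : ∀ n, MemLp (h n) p μ) (hu : MemLp u p μ) (hv : MemLp v p μ)
    (hfu : Tendsto (fun n => eLpNorm (fun x => f n x - u x) p μ) atTop (𝓝 0))
    (hhv : Tendsto (fun n => eLpNorm (fun x => h n x - v x) p μ) atTop (𝓝 0)) :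
    Tendsto (fun n => eLpNorm (fun x => (f n - h n) x - (u x - v x)) p μ) atTop (𝓝 0) := by
  refine tendsto_of_tendsto_of_tendsto_of_le_of_le tendsto_const_nhds
    (by simpa only [add_zero] using hfu.add hhv) (fun _ => zero_le) fun n => ?_
  refine le_trans (le_of_eq ?_) (eLpNorm_sub_le ((hf n).sub hu).1 ((hh n).sub hv).1 hp)
  congr 1
  ext x
  exact sub_sub_sub_comm _ _ _ _

lemma IsH01.sub {u v : EuclideanSpace ℝ (Fin d) → ℝ}
    {g k : EuclideanSpace ℝ (Fin d) → EuclideanSpace ℝ (Fin d)} (hu : IsH01 Ω u g)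
    (hv : IsH01 Ω v k) : IsH01 Ω (fun x => u x - v x) (fun x => g x - k x) := by
  obtain ⟨hu2, hg2, φ, hφ, hφu, hφg⟩ := hu
  obtain ⟨hv2, hk2, ψ, hψ, hψv, hψk⟩ := hv
  refine ⟨hu2.sub hv2, hg2.sub hk2, fun n => φ n - ψ n,
    fun n => (ccSpace ⊤ Ω).sub_mem (hφ n) (hψ n), ?_, ?_⟩
  · exact tendsto_eLpNorm_sub_sub one_le_two (fun n => (hφ n).memLp 2 _)
      (fun n => (hψ n).memLp 2 _) hu2 hv2 hφu hψv
  · have hgrad : ∀ n, ∇ (φ n - ψ n) = ∇ (φ n) - ∇ (ψ n) := fun n => by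
      ext1 x
      simp only [gradient, Pi.sub_apply,
        fderiv_sub (hφ n).differentiable.differentiableAt (hψ n).differentiable.differentiableAt,
        map_sub]
    simp only [hgrad]
    exact tendsto_eLpNorm_sub_sub one_le_two (fun n => (hφ n).memLp_gradient 2 _)
      (fun n => (hψ n).memLp_gradient 2 _) hg2 hk2 hφg hψk

/-! ### Quadratic test functions -/

section CcOn

variable {φ : EuclideanSpace ℝ (Fin d) → ℝ}

lemma IsCcOn.integrable {k : ℕ∞} (hφ : IsCcOn k Ω φ) (m : SubProb Ω) : Integrable φ m.meas :=
  hφ.continuous.integrable_of_hasCompactSupport hφ.2.1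

lemma IsCcOn.continuous_integral (hΩ : IsOpen Ω) (hφ : IsCcOn ⊤ Ω φ) :
    Continuous fun m : SubProb Ω => ∫ x, φ x ∂m.meas := by
  obtain ⟨K, hK⟩ := hφ.exists_lipschitzWith
  exact AbsorbedMFC.continuous_integral hΩ hK fun x hx => hφ.eq_zero hx

lemma IsCcOn.exists_abs_integral_le {k : ℕ∞} (hφ : IsCcOn k Ω φ) :
    ∃ B : ℝ, ∀ m : SubProb Ω, |∫ x, φ x ∂m.meas| ≤ B := by
  obtain ⟨B, hB⟩ := hφ.continuous.bounded_above_of_compact_support hφ.2.1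
  refine ⟨B, fun m => ?_⟩
  have hB0 : 0 ≤ B := (norm_nonneg _).trans (hB 0)
  exact (norm_integral_le_of_norm_le_const (.of_forall hB)).trans
    (mul_le_of_le_one_right hB0 m.measureReal_univ_le)

lemma IsCcOn.prodMul {k : ℕ∞} (hφ : IsCcOn k Ω φ) :
    IsCcOn k (Ω ×ˢ Ω) fun p : EuclideanSpace ℝ (Fin d) × EuclideanSpace ℝ (Fin d) =>
      φ p.1 * φ p.2 := by
  have hcpt : IsCompact (tsupport φ ×ˢ tsupport φ) := hφ.2.1.isCompact.prod hφ.2.1.isCompact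
  have hsupp : tsupport (fun p : EuclideanSpace ℝ (Fin d) × EuclideanSpace ℝ (Fin d) =>
      φ p.1 * φ p.2) ⊆ tsupport φ ×ˢ tsupport φ :=
    closure_minimal (fun p hp => ⟨subset_tsupport _ (left_ne_zero_of_mul hp),
      subset_tsupport _ (right_ne_zero_of_mul hp)⟩) hcpt.isClosed
  exact ⟨(hφ.1.comp contDiff_fst).mul (hφ.1.comp contDiff_snd),
    hcpt.of_isClosed_subset (isClosed_tsupport _) hsupp, hsupp.trans (prod_mono hφ.2.2 hφ.2.2)⟩

end CcOn

section Sum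

variable {X ι : Type*} [NormedAddCommGroup X] [NormedSpace ℝ X] {S : Set X}

lemma IsCcOn.of_le {k l : ℕ∞} {f : X → ℝ} (hf : IsCcOn l S f) (h : k ≤ l) : IsCcOn k S f :=
  ⟨hf.1.of_le (by exact_mod_cast h), hf.2⟩

lemma iteratedFDeriv_sum_smul [Fintype ι] {j : ℕ} {f : ι → X → ℝ} (hf : ∀ i, ContDiff ℝ j (f i))
    (c : ι → ℝ) (x : X) :
    iteratedFDeriv ℝ j (∑ i, c i • f i) x = ∑ i, c i • iteratedFDeriv ℝ j (f i) x := by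
  rw [iteratedFDeriv_sum_apply (f := fun i => c i • f i)
    fun i _ => ((hf i).const_smul (c i)).contDiffAt]
  exact Finset.sum_congr rfl fun i _ => iteratedFDeriv_const_smul_apply (hf i).contDiffAt

lemma continuousBoundedInC_sum [Fintype ι] {k : ℕ} {T : ℝ} {a : ι → SubProb Ω → ℝ}
    {f : ι → X → ℝ} (hf : ∀ i, IsCcOn k S (f i)) (ha : ∀ i, Continuous (a i))
    (hab : ∀ i, ∃ B : ℝ, ∀ m, |a i m| ≤ B) :
    ContinuousBoundedInC k T fun _ m => ∑ i, a i m • f i := by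
  intro j hj
  have hcd : ∀ i, ContDiff ℝ j (f i) := fun i => (hf i).1.of_le (by exact_mod_cast hj)
  choose B hB using fun i =>
    ((hcd i).continuous_iteratedFDeriv le_rfl).bounded_above_of_compact_support
      ((hf i).2.1.iteratedFDeriv j)
  choose A hA using hab
  simp only [iteratedFDeriv_sum_smul hcd]
  refine ⟨fun p₀ _ => Metric.tendstoUniformly_iff.2 fun ε hε => ?_,
    ∑ i, A i * B i, fun t _ m x => norm_sum_le_of_le _ fun i _ => ?_⟩
  · have hcont : Continuous fun p : ℝ × SubProb Ω => ∑ i, |a i p₀.2 - a i p.2| * B i := by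
      fun_prop
    have hlim : Tendsto (fun p : ℝ × SubProb Ω => ∑ i, |a i p₀.2 - a i p.2| * B i)
        (𝓝[Icc 0 T ×ˢ univ] p₀) (𝓝 0) := by
      simpa using (hcont.tendsto p₀).mono_left (nhdsWithin_le_nhds (s := Icc 0 T ×ˢ univ))
    filter_upwards [hlim.eventually_lt_const hε] with p hp x
    refine lt_of_le_of_lt ?_ hp
    rw [iteratedFDeriv_sum_smul hcd, dist_eq_norm, ← Finset.sum_sub_distrib]
    refine norm_sum_le_of_le _ fun i _ => ?_
    rw [← sub_smul, norm_smul, Real.norm_eq_abs]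
    exact mul_le_mul_of_nonneg_left (hB i x) (abs_nonneg _)
  · rw [norm_smul, Real.norm_eq_abs]
    exact mul_le_mul (hA i m) (hB i x) (norm_nonneg _) ((abs_nonneg _).trans (hA i m))

end Sum

lemma SubProb.integral_mix (m m' : SubProb Ω) (r : unitInterval)
    {f : EuclideanSpace ℝ (Fin d) → ℝ} (hf : Integrable f m.meas) (hf' : Integrable f m'.meas) :
    ∫ x, f x ∂(m.mix m' r).meas
      = r * ∫ x, f x ∂m'.meas + (1 - r) * ∫ x, f x ∂m.meas := by
  have hmix : (m.mix m' r).meas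
      = ENNReal.ofReal (r : ℝ) • m'.meas + ENNReal.ofReal (1 - (r : ℝ)) • m.meas := rfl
  rw [hmix, integral_add_measure (hf'.smul_measure ENNReal.ofReal_ne_top)
    (hf.smul_measure ENNReal.ofReal_ne_top), integral_smul_measure, integral_smul_measure,
    ENNReal.toReal_ofReal r.2.1, ENNReal.toReal_ofReal (sub_nonneg.2 r.2.2)]
  simp only [smul_eq_mul]

lemma integral_affine_mul (a a' c : ℝ) :
    ∫ r in (0 : ℝ)..1, (r * a' + (1 - r) * a - c) * (a' - a)
      = ((a' - c) ^ 2 - (a - c) ^ 2) / 2 := by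
  have hderiv : ∀ r ∈ uIcc (0 : ℝ) 1,
      HasDerivAt (fun r : ℝ => (r * a' + (1 - r) * a - c) ^ 2 / 2)
        ((r * a' + (1 - r) * a - c) * (a' - a)) r := by
    intro r _
    have haff : HasDerivAt (fun r : ℝ => r * a' + (1 - r) * a - c) (1 * a' + (0 - 1) * a) r :=
      (((hasDerivAt_id r).mul_const a').add
        (((hasDerivAt_const r (1 : ℝ)).sub (hasDerivAt_id r)).mul_const a)).sub_const c
    convert! (haff.pow 2).div_const 2 using 1
    ring
  rw [intervalIntegral.integral_eq_sub_of_hasDerivAt hderiv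
    (Continuous.intervalIntegrable (by fun_prop) _ _)]
  ring

section LinearDerivative

variable {ι : Type*} [Fintype ι] {e : ι → EuclideanSpace ℝ (Fin d) → ℝ}

lemma integral_sum_smul {X : Type*} [MeasurableSpace X] {μ : Measure X} {e : ι → X → ℝ}
    (he : ∀ k, Integrable (e k) μ) (b : ι → ℝ) :
    ∫ x, (∑ k, b k • e k) x ∂μ = ∑ k, b k * ∫ x, e k x ∂μ := by
  simp only [Finset.sum_apply, Pi.smul_apply, smul_eq_mul]
  rw [integral_finsetSum _ fun k _ => (he k).const_mul (b k)]
  simp only [integral_const_mul]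

lemma hasLinearDerivative_of_integral_sub_eq {U : SubProb Ω → ℝ}
    {f : EuclideanSpace ℝ (Fin d) → ℝ}
    (h : ∀ m m' : SubProb Ω, U m' - U m = ∫ x, f x ∂m'.meas - ∫ x, f x ∂m.meas) :
    HasLinearDerivative U fun _ => f := fun m m' => by
  rw [intervalIntegral.integral_const, sub_zero, one_smul, h]

lemma hasLinearDerivative_sum_sq (he : ∀ (m : SubProb Ω) k, Integrable (e k) m.meas) (α β : ℝ)
    (c : ι → ℝ) :
    HasLinearDerivative (fun m : SubProb Ω => α + β / 2 * ∑ k, (∫ x, e k x ∂m.meas - c k) ^ 2)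
      fun m => ∑ k, (β * (∫ x, e k x ∂m.meas - c k)) • e k := by
  intro m m'
  have hpath : ∀ r ∈ uIcc (0 : ℝ) 1,
      (∫ x, (∑ k, (β * (∫ y, e k y ∂(m.mix m' (projIcc 0 1 zero_le_one r)).meas - c k)) • e k) x
          ∂m'.meas
        - ∫ x, (∑ k, (β * (∫ y, e k y ∂(m.mix m' (projIcc 0 1 zero_le_one r)).meas - c k)) • e k) x
          ∂m.meas)
      = ∑ k, β * ((r * (∫ x, e k x ∂m'.meas) + (1 - r) * (∫ x, e k x ∂m.meas) - c k)
        * ((∫ x, e k x ∂m'.meas) - ∫ x, e k x ∂m.meas)) := by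
    intro r hr
    rw [uIcc_of_le zero_le_one] at hr
    rw [integral_sum_smul (he m'), integral_sum_smul (he m), ← Finset.sum_sub_distrib]
    refine Finset.sum_congr rfl fun k _ => ?_
    rw [SubProb.integral_mix _ _ _ (he m k) (he m' k), projIcc_of_mem _ hr]
    ring
  rw [intervalIntegral.integral_congr hpath, intervalIntegral.integral_finsetSum fun k _ =>
    Continuous.intervalIntegrable (by fun_prop) _ _]
  simp only [intervalIntegral.integral_const_mul, integral_affine_mul]
  rw [add_sub_add_left_eq_sub, ← mul_sub, ← Finset.sum_sub_distrib, Finset.mul_sum]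
  exact Finset.sum_congr rfl fun k _ => by ring

end LinearDerivative

/-- The test function `α(t) + β/2 ∑ₖ (∫ eₖ dm - cₖ)²`, with `α'` the derivative of `α`. -/
noncomputable def quadTest (T : ℝ) (hΩ : IsOpen Ω) {α α' : ℝ → ℝ}
    (hα : ∀ t, HasDerivAt α (α' t) t) (hα' : Continuous α') (β : ℝ) {N : ℕ}
    {e : Fin N → EuclideanSpace ℝ (Fin d) → ℝ} (he : ∀ k, IsCcOn ⊤ Ω (e k)) (c : Fin N → ℝ) :
    SmoothTestFunction T Ω where
  toFun t m := α t + β / 2 * ∑ k, (∫ x, e k x ∂m.meas - c k) ^ 2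
  dt t _ := α' t
  dm _ m := ∑ k, (β * (∫ x, e k x ∂m.meas - c k)) • e k
  dmm _ _ := ∑ k, β • fun p => e k p.1 * e k p.2
  hasDeriv_dt t _ m := ((hα t).add_const _).hasDerivWithinAt
  continuous_dt := (hα'.comp continuous_fst).continuousOn
  hasDeriv_dm t _ := hasLinearDerivative_sum_sq (fun m k => (he k).integrable m) _ β c
  hasDeriv_dmm t _ x _ := hasLinearDerivative_of_integral_sub_eq fun m m' => by
    have hdmm : (fun y => (∑ k, β • fun p : EuclideanSpace ℝ (Fin d) × EuclideanSpace ℝ (Fin d) =>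
        e k p.1 * e k p.2) (x, y)) = ∑ k, (β * e k x) • e k := by
      ext y
      simp only [Finset.sum_apply, Pi.smul_apply, smul_eq_mul, mul_assoc]
    rw [hdmm, integral_sum_smul fun k => (he k).integrable m',
      integral_sum_smul fun k => (he k).integrable m]
    simp only [Finset.sum_apply, Pi.smul_apply, smul_eq_mul]
    rw [← Finset.sum_sub_distrib, ← Finset.sum_sub_distrib]
    exact Finset.sum_congr rfl fun k _ => by ring
  dm_mem t _ m := (IsCcOn.sum_smul he _).of_le le_top
  dmm_mem t _ _ := (IsCcOn.sum_smul (fun k => (he k).prodMul) _).of_le le_top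
  continuous_dm := by
    refine continuousBoundedInC_sum (S := Ω) (fun k => (he k).of_le le_top)
      (fun k => (((he k).continuous_integral hΩ).sub continuous_const).const_mul β) fun k => ?_
    obtain ⟨B, hB⟩ := (he k).exists_abs_integral_le
    refine ⟨|β| * (B + |c k|), fun m => ?_⟩
    rw [abs_mul]
    exact mul_le_mul_of_nonneg_left ((abs_sub _ _).trans (add_le_add_left (hB m) _))
      (abs_nonneg _)
  continuous_dmm := by
    refine continuousBoundedInC_sum (S := Ω ×ˢ Ω) (a := fun _ _ => β)
      (f := fun k p => e k p.1 * e k p.2) (fun k => (he k).prodMul.of_le le_top)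
      (fun _ => continuous_const) fun _ => ⟨|β|, fun _ => le_rfl⟩

end QuadraticTestFunctions

/-! ### The Hamiltonian at the gradient of the penalization -/

section HamiltonianEstimate

variable {d : ℕ} {Ω : Set (EuclideanSpace ℝ (Fin d))}

section MemLp

variable {X E : Type*} [MeasurableSpace X] [NormedAddCommGroup E] {μ : Measure X} {f g : X → E}

lemma integrable_inner_of_memLp [InnerProductSpace ℝ E] (hf : MemLp f 2 μ) (hg : MemLp g 2 μ) :
    Integrable (fun x => inner ℝ (f x) (g x)) μ := by
  refine (L2.integrable_inner (𝕜 := ℝ) (hf.toLp f) (hg.toLp g)).congr ?_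
  filter_upwards [hf.coeFn_toLp, hg.coeFn_toLp] with x hfx hgx
  rw [hfx, hgx]

lemma integral_norm_sub_sq_le (hf : MemLp f 2 μ) (hg : MemLp g 2 μ) :
    ∫ x, ‖f x - g x‖ ^ 2 ∂μ ≤ 2 * (∫ x, ‖f x‖ ^ 2 ∂μ + ∫ x, ‖g x‖ ^ 2 ∂μ) := by
  have hf2 := hf.integrable_norm_pow two_ne_zero
  have hg2 := hg.integrable_norm_pow two_ne_zero
  rw [← integral_add hf2 hg2, ← integral_const_mul]
  refine integral_mono ((hf.sub hg).integrable_norm_pow two_ne_zero)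
    ((hf2.add hg2).const_mul 2) fun x => ?_
  calc ‖f x - g x‖ ^ 2 ≤ (‖f x‖ + ‖g x‖) ^ 2 := by gcongr; exact norm_sub_le _ _
    _ ≤ 2 * (‖f x‖ ^ 2 + ‖g x‖ ^ 2) := add_sq_le

end MemLp

section Hamiltonian

variable {H : EuclideanSpace ℝ (Fin d) → EuclideanSpace ℝ (Fin d) → ℝ} {C K : ℝ≥0}
  {φ u : EuclideanSpace ℝ (Fin d) → ℝ}

lemma exists_linear_growth_of_lipschitzOnWith (hΩb : Bornology.IsBounded Ω)
    (hH : LipschitzOnWith K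
      (fun z : EuclideanSpace ℝ (Fin d) × EuclideanSpace ℝ (Fin d) => H z.1 z.2) (Ω ×ˢ univ)) :
    ∃ C : ℝ≥0, ∀ x ∈ Ω, ∀ p, |H x p| ≤ C + K * ‖p‖ := by
  rcases Ω.eq_empty_or_nonempty with rfl | ⟨x₀, hx₀⟩
  · exact ⟨0, fun x hx => hx.elim⟩
  obtain ⟨D, hD⟩ := Metric.isBounded_iff.1 hΩb
  have hD0 : 0 ≤ D := dist_nonneg.trans (hD hx₀ hx₀)
  refine ⟨‖H x₀ 0‖₊ + K * D.toNNReal, fun x hx p => ?_⟩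
  have hdist : dist (x, p) (x₀, (0 : EuclideanSpace ℝ (Fin d))) ≤ D + ‖p‖ := by
    rw [Prod.dist_eq, dist_zero_right]
    exact max_le ((hD hx hx₀).trans (le_add_of_nonneg_right (norm_nonneg p)))
      (le_add_of_nonneg_left hD0)
  calc |H x p| ≤ |H x₀ 0| + |H x p - H x₀ 0| := by
        simpa using abs_add_le (H x₀ 0) (H x p - H x₀ 0)
    _ ≤ |H x₀ 0| + K * dist (x, p) (x₀, (0 : EuclideanSpace ℝ (Fin d))) :=
        add_le_add_right (hH.dist_le_mul (x, p) ⟨hx, mem_univ _⟩ (x₀, 0) ⟨hx₀, mem_univ _⟩) _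
    _ ≤ |H x₀ 0| + K * (D + ‖p‖) := by gcongr
    _ = (‖H x₀ 0‖₊ + K * D.toNNReal : ℝ≥0) + K * ‖p‖ := by
        rw [NNReal.coe_add, NNReal.coe_mul, Real.coe_toNNReal D hD0, coe_nnnorm,
          Real.norm_eq_abs, mul_add, add_assoc]

lemma memLp_hamiltonian (hΩ : MeasurableSet Ω) (hΩb : Bornology.IsBounded Ω)
    (hH : ContinuousOn
      (fun z : EuclideanSpace ℝ (Fin d) × EuclideanSpace ℝ (Fin d) => H z.1 z.2) (Ω ×ˢ univ))
    (hHb : ∀ x ∈ Ω, ∀ p, |H x p| ≤ C + K * ‖p‖) (hφ : IsCcOn ⊤ Ω φ) :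
    MemLp (fun x => H x (∇ φ x)) 2 (volume.restrict Ω) := by
  have := isFiniteMeasure_restrict_of_isBounded hΩb
  obtain ⟨B, hB⟩ := (continuous_gradient hφ.contDiff_one).bounded_above_of_compact_support
    (hasCompactSupport_gradient hφ.2.1)
  have hcont : ContinuousOn (fun x => H x (∇ φ x)) Ω :=
    hH.comp (continuous_id.prodMk (continuous_gradient hφ.contDiff_one)).continuousOn
      fun x hx => ⟨hx, mem_univ _⟩
  refine MemLp.of_bound (hcont.aestronglyMeasurable hΩ) (C + K * B) ?_
  filter_upwards [ae_restrict_mem hΩ] with x hx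
  exact (hHb x hx _).trans (by gcongr; exact hB x)

lemma abs_integral_mul_hamiltonian_le (hΩ : MeasurableSet Ω) (hΩb : Bornology.IsBounded Ω)
    (hHb : ∀ x ∈ Ω, ∀ p, |H x p| ≤ C + K * ‖p‖) (hφ : IsCcOn ⊤ Ω φ)
    (hu : MemLp u 2 (volume.restrict Ω)) :
    |∫ x in Ω, u x * H x (∇ φ x)|
      ≤ C * (√(volume.real Ω) * √(∫ x in Ω, u x ^ 2))
        + K * (√(∫ x in Ω, u x ^ 2) * √(∫ x in Ω, ‖∇ φ x‖ ^ 2)) := by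
  have := isFiniteMeasure_restrict_of_isBounded hΩb
  have hgrad := hφ.memLp_gradient 2 (volume.restrict Ω)
  have hu1 : Integrable (fun x => |u x|) (volume.restrict Ω) := (hu.integrable one_le_two).abs
  have hugrad : Integrable (fun x => |u x| * ‖∇ φ x‖) (volume.restrict Ω) :=
    hu.abs.integrable_mul hgrad.norm
  have hconst : ∫ x in Ω, |u x| ≤ √(volume.real Ω) * √(∫ x in Ω, u x ^ 2) := by
    simpa only [Pi.abs_apply, sq_abs, measureReal_restrict_apply_univ] using
      (le_abs_self _).trans (abs_integral_le_sqrt_measure_mul hu.abs)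
  have hlinear : ∫ x in Ω, |u x| * ‖∇ φ x‖
      ≤ √(∫ x in Ω, u x ^ 2) * √(∫ x in Ω, ‖∇ φ x‖ ^ 2) := by
    simpa only [Pi.abs_apply, sq_abs] using
      (le_abs_self _).trans (abs_integral_mul_le hu.abs hgrad.norm)
  calc |∫ x in Ω, u x * H x (∇ φ x)|
      ≤ ∫ x in Ω, (C * |u x| + K * (|u x| * ‖∇ φ x‖)) := by
        rw [← Real.norm_eq_abs]
        refine norm_integral_le_of_norm_le ((hu1.const_mul _).add (hugrad.const_mul _)) ?_
        filter_upwards [ae_restrict_mem hΩ] with x hx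
        rw [norm_mul, Real.norm_eq_abs, Real.norm_eq_abs, mul_left_comm, mul_comm (C : ℝ),
          ← mul_add]
        exact mul_le_mul_of_nonneg_left (hHb x hx _) (abs_nonneg _)
    _ = C * (∫ x in Ω, |u x|) + K * ∫ x in Ω, |u x| * ‖∇ φ x‖ := by
        rw [integral_add (hu1.const_mul _) (hugrad.const_mul _), integral_const_mul,
          integral_const_mul]
    _ ≤ _ := by gcongr

end Hamiltonian

lemma absorb_by_young {η U Y G κ r γ : ℝ} (hη : η ^ 2 ≤ 1 / 4) (hY : Y ^ 2 = U ^ 2 + G) :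
    -U ^ 2 + U * (η * Y) + κ * (U * r) + γ * U ≤ η ^ 2 * G + κ ^ 2 * r ^ 2 + γ ^ 2 := by
  have hGalerkin : U * (η * Y) ≤ U ^ 2 / 4 + η ^ 2 * Y ^ 2 := by
    linarith [sq_nonneg (U / 2 - η * Y)]
  have hlinear : κ * (U * r) ≤ U ^ 2 / 4 + κ ^ 2 * r ^ 2 := by
    linarith [sq_nonneg (U / 2 - κ * r)]
  have hconst : γ * U ≤ U ^ 2 / 4 + γ ^ 2 := by linarith [sq_nonneg (U / 2 - γ)]
  rw [hY] at hGalerkin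
  linarith [mul_le_mul_of_nonneg_right hη (sq_nonneg U)]

namespace GalerkinFamily

variable {η : ℝ} (𝓔 : GalerkinFamily Ω η) {u : EuclideanSpace ℝ (Fin d) → ℝ}
  {g : EuclideanSpace ℝ (Fin d) → EuclideanSpace ℝ (Fin d)}

lemma sum_integral_mul_h1Inner (h : IsH01 Ω u g) :
    ∑ k, (∫ x in Ω, u x * 𝓔.basis k x) * h1Inner Ω u g (𝓔.basis k)
      = ∫ x in Ω, u x * (∑ k, h1Inner Ω u g (𝓔.basis k) • 𝓔.basis k) x := by
  have hint : ∀ k, Integrable (fun x => h1Inner Ω u g (𝓔.basis k) * (u x * 𝓔.basis k x))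
      (volume.restrict Ω) := fun k =>
    (h.1.integrable_mul ((𝓔.isCcOn k).memLp 2 _)).const_mul _
  simp only [Finset.sum_apply, Pi.smul_apply, smul_eq_mul, Finset.mul_sum, mul_left_comm (u _)]
  rw [integral_finsetSum _ fun k _ => hint k]
  simp only [integral_const_mul, mul_comm]

lemma le_sum_integral_mul_h1Inner (hη : 0 ≤ η) (h : IsH01 Ω u g) :
    (∫ x in Ω, u x ^ 2) - √(∫ x in Ω, u x ^ 2) * (η * √(h1NormSq Ω u g))
      ≤ ∑ k, (∫ x in Ω, u x * 𝓔.basis k x) * h1Inner Ω u g (𝓔.basis k) := by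
  set w := ∑ k, h1Inner Ω u g (𝓔.basis k) • 𝓔.basis k
  have hw : MemLp w 2 (volume.restrict Ω) := (𝓔.isCcOn_sum _).memLp 2 _
  have hresidual : Integrable (fun x => u x * (u x - w x)) (volume.restrict Ω) :=
    h.1.integrable_mul (h.1.sub hw)
  have hbound : ∫ x in Ω, u x * (u x - w x)
      ≤ √(∫ x in Ω, u x ^ 2) * (η * √(h1NormSq Ω u g)) :=
    calc _ ≤ √(∫ x in Ω, u x ^ 2) * √(∫ x in Ω, (u x - w x) ^ 2) :=
          (le_abs_self _).trans (abs_integral_mul_le h.1 (h.1.sub hw))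
      _ ≤ √(∫ x in Ω, u x ^ 2) * √(η ^ 2 * h1NormSq Ω u g) := by
          gcongr; exact 𝓔.integral_sub_sq_le u g h
      _ = _ := by rw [Real.sqrt_mul (sq_nonneg _), Real.sqrt_sq hη]
  have hsplit : ∫ x in Ω, u x * w x
      = (∫ x in Ω, u x ^ 2) - ∫ x in Ω, u x * (u x - w x) := by
    rw [← integral_sub h.1.integrable_sq hresidual]
    exact integral_congr_ae (.of_forall fun x => by simp only; ring)
  rw [𝓔.sum_integral_mul_h1Inner h, hsplit]
  linarith

lemma integral_mul_laplacian_sum (h : IsH01 Ω u g) (a : Fin 𝓔.card → ℝ) :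
    ∫ x in Ω, u x * Δ (∑ k, a k • 𝓔.basis k) x
      = ∑ k, a k * ((∫ x in Ω, u x * 𝓔.basis k x) - h1Inner Ω u g (𝓔.basis k)) := by
  have hgrad : ∫ x in Ω, inner ℝ (g x) (∇ (∑ k, a k • 𝓔.basis k) x)
      = ∑ k, a k * ∫ x in Ω, inner ℝ (g x) (∇ (𝓔.basis k) x) := by
    simp only [gradient_sum_smul fun k => (𝓔.isCcOn k).differentiable, Finset.sum_apply,
      Pi.smul_apply, inner_sum, inner_smul_right]
    rw [integral_finsetSum _ fun k _ =>
      (integrable_inner_of_memLp h.2.1 ((𝓔.isCcOn k).memLp_gradient 2 _)).const_mul _]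
    simp only [integral_const_mul]
  simp only [h1Inner, sub_add_cancel_left, mul_neg, Finset.sum_neg_distrib, ← hgrad]
  exact eq_neg_of_add_eq_zero_left (h.integral_mul_laplacian (𝓔.isCcOn_sum a))

lemma integral_norm_gradient_sum_sq_le (a : Fin 𝓔.card → ℝ) :
    ∫ x in Ω, ‖∇ (∑ k, a k • 𝓔.basis k) x‖ ^ 2 ≤ ∑ k, a k ^ 2 := by
  rw [← 𝓔.h1NormSq_sum a]
  exact le_add_of_nonneg_left (integral_nonneg fun _ => sq_nonneg _)

variable {H : EuclideanSpace ℝ (Fin d) → EuclideanSpace ℝ (Fin d) → ℝ} {C K : ℝ≥0} {ε : ℝ}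

lemma integral_mul_laplacian_penalization_le (hη : 0 ≤ η) (hε : 0 < ε) (h : IsH01 Ω u g) :
    ∫ x in Ω, u x * Δ (∑ k, (ε⁻¹ * ∫ x in Ω, u x * 𝓔.basis k x) • 𝓔.basis k) x
      ≤ ε⁻¹ * (∑ k, (∫ x in Ω, u x * 𝓔.basis k x) ^ 2
        - ((∫ x in Ω, u x ^ 2) - √(∫ x in Ω, u x ^ 2) * (η * √(h1NormSq Ω u g)))) := by
  have hsum : ∫ x in Ω, u x * Δ (∑ k, (ε⁻¹ * ∫ x in Ω, u x * 𝓔.basis k x) • 𝓔.basis k) x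
      = ε⁻¹ * (∑ k, (∫ x in Ω, u x * 𝓔.basis k x) ^ 2
        - ∑ k, (∫ x in Ω, u x * 𝓔.basis k x) * h1Inner Ω u g (𝓔.basis k)) := by
    rw [𝓔.integral_mul_laplacian_sum h, ← Finset.sum_sub_distrib, Finset.mul_sum]
    exact Finset.sum_congr rfl fun k _ => by ring
  rw [hsum]
  gcongr
  exact 𝓔.le_sum_integral_mul_h1Inner hη h

lemma abs_integral_mul_hamiltonian_penalization_le (hΩ : MeasurableSet Ω)
    (hΩb : Bornology.IsBounded Ω) (hHb : ∀ x ∈ Ω, ∀ p, |H x p| ≤ C + K * ‖p‖) (hε : 0 < ε)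
    (hu : MemLp u 2 (volume.restrict Ω)) (a : Fin 𝓔.card → ℝ) :
    |∫ x in Ω, u x * H x (∇ (∑ k, (ε⁻¹ * a k) • 𝓔.basis k) x)|
      ≤ C * (√(volume.real Ω) * √(∫ x in Ω, u x ^ 2))
        + K * (√(∫ x in Ω, u x ^ 2) * (ε⁻¹ * √(∑ k, a k ^ 2))) := by
  refine (abs_integral_mul_hamiltonian_le hΩ hΩb hHb (𝓔.isCcOn_sum _) hu).trans ?_
  gcongr
  calc √(∫ x in Ω, ‖∇ (∑ k, (ε⁻¹ * a k) • 𝓔.basis k) x‖ ^ 2)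
      ≤ √(∑ k, (ε⁻¹ * a k) ^ 2) := Real.sqrt_le_sqrt (𝓔.integral_norm_gradient_sum_sq_le _)
    _ = ε⁻¹ * √(∑ k, a k ^ 2) := by
        simp only [mul_pow, ← Finset.mul_sum]
        rw [Real.sqrt_mul (sq_nonneg _), Real.sqrt_sq (inv_nonneg.2 hε.le)]

/- The second-order term equals `-‖u‖² / ε` up to Galerkin error and `∑ₖ (∫ u eₖ)² / ε`, and this
negative term absorbs all the others except for the gradient part `η² ‖g‖² / ε` of the error. -/
lemma integral_mul_laplacian_sub_hamiltonian_le (hΩ : MeasurableSet Ω)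
    (hΩb : Bornology.IsBounded Ω) (hHb : ∀ x ∈ Ω, ∀ p, |H x p| ≤ C + K * ‖p‖) (hη : 0 ≤ η)
    (hη' : η ≤ 1 / 2) (hε : 0 < ε) (h : IsH01 Ω u g) :
    (∫ x in Ω, u x * Δ (∑ k, (ε⁻¹ * ∫ x in Ω, u x * 𝓔.basis k x) • 𝓔.basis k) x)
        - ∫ x in Ω, u x * H x (∇ (∑ k, (ε⁻¹ * ∫ x in Ω, u x * 𝓔.basis k x) • 𝓔.basis k) x)
      ≤ ε⁻¹ * (η ^ 2 * (∫ x in Ω, ‖g x‖ ^ 2)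
          + (1 + (K : ℝ) ^ 2) * ∑ k, (∫ x in Ω, u x * 𝓔.basis k x) ^ 2)
        + (C : ℝ) ^ 2 * volume.real Ω * ε := by
  have hΔ := 𝓔.integral_mul_laplacian_penalization_le hη hε h
  have hH := 𝓔.abs_integral_mul_hamiltonian_penalization_le hΩ hΩb hHb hε h.1
    fun k => ∫ x in Ω, u x * 𝓔.basis k x
  set U := √(∫ x in Ω, u x ^ 2)
  set r := √(∑ k, (∫ x in Ω, u x * 𝓔.basis k x) ^ 2)
  set v := √(volume.real Ω)
  set Y := √(h1NormSq Ω u g)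
  have hU : U ^ 2 = ∫ x in Ω, u x ^ 2 := Real.sq_sqrt (integral_nonneg fun _ => sq_nonneg _)
  have hr : r ^ 2 = ∑ k, (∫ x in Ω, u x * 𝓔.basis k x) ^ 2 :=
    Real.sq_sqrt (Finset.sum_nonneg fun _ _ => sq_nonneg _)
  have hv : v ^ 2 = volume.real Ω := Real.sq_sqrt measureReal_nonneg
  have hY : Y ^ 2 = U ^ 2 + ∫ x in Ω, ‖g x‖ ^ 2 := by
    rw [hU, Real.sq_sqrt (h1NormSq_nonneg _ _), h1NormSq]
  rw [← hU, ← hr] at hΔ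
  rw [← hr, ← hv]
  have hη2 : η ^ 2 ≤ 1 / 4 := by
    simpa only [div_pow, one_pow, show (2 : ℝ) ^ 2 = 4 by norm_num] using
      pow_le_pow_left₀ hη hη' 2
  calc _ ≤ ε⁻¹ * (r ^ 2 - (U ^ 2 - U * (η * Y))) + (C * (v * U) + K * (U * (ε⁻¹ * r))) := by
        linarith [neg_le_of_abs_le hH]
    _ = ε⁻¹ * (r ^ 2 + (-U ^ 2 + U * (η * Y) + K * (U * r) + ε * (C * v) * U)) := by
        field_simp
        ring
    _ ≤ ε⁻¹ * (r ^ 2 + (η ^ 2 * (∫ x in Ω, ‖g x‖ ^ 2) + K ^ 2 * r ^ 2 + (ε * (C * v)) ^ 2)) := by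
        gcongr ε⁻¹ * (r ^ 2 + ?_)
        exact absorb_by_young hη2 hY
    _ = _ := by
        field_simp
        ring

/-- The linear derivative at `m` of the penalization `(2 ε)⁻¹ distSq · n`. -/
noncomputable def potential (ε : ℝ) (m n : SubProb Ω) : EuclideanSpace ℝ (Fin d) → ℝ :=
  ∑ k, (ε⁻¹ * (∫ x, 𝓔.basis k x ∂m.meas - ∫ x, 𝓔.basis k x ∂n.meas)) • 𝓔.basis k

theorem integral_laplacian_sub_hamiltonian_le (hΩ : MeasurableSet Ω)
    (hΩb : Bornology.IsBounded Ω)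
    (hH : ContinuousOn
      (fun z : EuclideanSpace ℝ (Fin d) × EuclideanSpace ℝ (Fin d) => H z.1 z.2) (Ω ×ˢ univ))
    (hHb : ∀ x ∈ Ω, ∀ p, |H x p| ≤ C + K * ‖p‖) (hη : 0 ≤ η) (hη' : η ≤ 1 / 2) (hε : 0 < ε)
    {m n : SubProb Ω} (hm : m.InL2) (hn : n.InL2)
    {gm gn : EuclideanSpace ℝ (Fin d) → EuclideanSpace ℝ (Fin d)}
    (hgm : IsH01 Ω m.density gm) (hgn : IsH01 Ω n.density gn) :
    (∫ x, Δ (𝓔.potential ε m n) x ∂m.meas - ∫ x, Δ (𝓔.potential ε m n) x ∂n.meas)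
        - (∫ x, H x (∇ (𝓔.potential ε m n) x) ∂m.meas
          - ∫ x, H x (∇ (𝓔.potential ε m n) x) ∂n.meas)
      ≤ ε⁻¹ * (2 * η ^ 2 * ((∫ x in Ω, ‖gm x‖ ^ 2) + ∫ x in Ω, ‖gn x‖ ^ 2)
          + (1 + (K : ℝ) ^ 2) * 𝓔.distSq m n)
        + (C : ℝ) ^ 2 * volume.real Ω * ε := by
  have hφ : IsCcOn ⊤ Ω (𝓔.potential ε m n) := 𝓔.isCcOn_sum _
  have hdiff := fun k => SubProb.integral_sub_eq hΩ hm hn ((𝓔.isCcOn k).memLp 2 _)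
  rw [SubProb.integral_sub_eq hΩ hm hn (hφ.memLp_laplacian 2 _),
    SubProb.integral_sub_eq hΩ hm hn (memLp_hamiltonian hΩ hΩb hH hHb hφ)]
  simp only [potential, distSq, hdiff]
  refine (𝓔.integral_mul_laplacian_sub_hamiltonian_le hΩ hΩb hHb hη hη' hε
    (hgm.sub hgn)).trans ?_
  gcongr ε⁻¹ * (?_ + _) + _
  linarith [mul_le_mul_of_nonneg_left (integral_norm_sub_sq_le hgm.2.1 hgn.2.1) (sq_nonneg η)]

end GalerkinFamily

end HamiltonianEstimate

/-! ### Doubling of variables -/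

section Doubling

section Semicontinuous

variable {X : Type*} [TopologicalSpace X] {f g N : X → ℝ} {A : Set X}

lemma upperSemicontinuous_sub_prod (hf : UpperSemicontinuous f) (hg : LowerSemicontinuous g) :
    UpperSemicontinuous fun p : X × X => f p.1 - g p.2 := by
  have h : UpperSemicontinuous fun p : X × X => f p.1 + -g p.2 :=
    (hf.comp continuous_fst).add (hg.comp continuous_snd).neg
  simpa only [sub_eq_add_neg] using h

lemma lowerSemicontinuousOn_of_isClosed_sublevel (hN : ∀ R, IsClosed {x | x ∈ A ∧ N x ≤ R}) :
    LowerSemicontinuousOn N A :=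
  lowerSemicontinuousOn_iff_preimage_Iic.2 fun R => ⟨_, hN R, by ext x; simp⟩

lemma bddAbove_sub_prod [CompactSpace X] (hf : UpperSemicontinuous f)
    (hg : LowerSemicontinuous g) : ∃ M, ∀ x y, f x - g y ≤ M := by
  obtain ⟨M, hM⟩ := ((upperSemicontinuous_sub_prod hf hg).upperSemicontinuousOn
    univ).bddAbove_of_isCompact isCompact_univ
  exact ⟨M, fun x y => hM ⟨(x, y), mem_univ _, rfl⟩⟩

lemma exists_isMaxOn_sub [CompactSpace X] (hf : UpperSemicontinuous f)
    (hN : ∀ R, IsClosed {x | x ∈ A ∧ N x ≤ R}) (hA : A.Nonempty) :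
    ∃ x₀ ∈ A, IsMaxOn (fun x => f x - N x) A x₀ := by
  obtain ⟨a, ha⟩ := hA
  have : Nonempty X := ⟨a⟩
  obtain ⟨M, hM⟩ := (hf.upperSemicontinuousOn univ).bddAbove_of_isCompact isCompact_univ
  have hfM : ∀ x, f x ≤ M := fun x => hM ⟨x, mem_univ x, rfl⟩
  let B := {x | x ∈ A ∧ N x ≤ M - (f a - N a)}
  have haB : a ∈ B := ⟨ha, by linarith [hfM a]⟩
  have husc : UpperSemicontinuousOn (fun x => f x + -N x) B :=
    (hf.upperSemicontinuousOn B).add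
      ((lowerSemicontinuousOn_of_isClosed_sublevel hN).mono fun _ hx => hx.1).neg
  simp only [← sub_eq_add_neg] at husc
  obtain ⟨x₀, hx₀, hmax⟩ := husc.exists_isMaxOn ⟨a, haB⟩ (hN _).isCompact
  refine ⟨x₀, hx₀.1, fun x hx => ?_⟩
  by_cases hxB : x ∈ B
  · exact hmax hxB
  · have hNx : M - (f a - N a) < N x := not_le.1 fun h => hxB ⟨hx, h⟩
    exact (show f x - N x ≤ f a - N a by linarith [hfM x]).trans (hmax haB)

lemma isClosed_sublevel_add (hN0 : ∀ x, 0 ≤ N x) (hN : ∀ R, IsClosed {x | x ∈ A ∧ N x ≤ R})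
    {δ : ℝ} (hδ : 0 < δ) (R : ℝ) :
    IsClosed {p : X × X | p ∈ A ×ˢ A ∧ δ * (N p.1 + N p.2) ≤ R} := by
  have hlsc := lowerSemicontinuousOn_of_isClosed_sublevel hN
  have hsum : LowerSemicontinuousOn (fun p : X × X => N p.1 + N p.2) (A ×ˢ A) :=
    (hlsc.comp continuousOn_fst fun _ hp => hp.1).add
      (hlsc.comp continuousOn_snd fun _ hp => hp.2)
  obtain ⟨Z, hZ, hZeq⟩ := lowerSemicontinuousOn_iff_preimage_Iic.1 hsum (R / δ)
  convert ((hN (R / δ)).prod (hN (R / δ))).inter hZ using 1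
  ext p
  have hmem := Set.ext_iff.1 hZeq p
  have h1 := hN0 p.1
  have h2 := hN0 p.2
  simp only [mem_inter_iff, mem_preimage, mem_Iic, mem_ofPred_eq, mem_prod, le_div_iff₀' hδ]
    at hmem ⊢
  refine ⟨fun h => ?_, fun h => ?_⟩
  · refine ⟨⟨⟨h.1.1, ?_⟩, h.1.2, ?_⟩, (hmem.1 h).2⟩ <;> nlinarith
  · exact hmem.2 ⟨⟨h.1.1.1, h.1.2.1⟩, h.2⟩

end Semicontinuous

variable {X : Type*} [PseudoEMetricSpace X] [CompactSpace X] {f g N : X → ℝ} {A : Set X}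

lemma exists_sub_lt_of_edist_le (hf : UpperSemicontinuous f) (hg : LowerSemicontinuous g)
    {B₁ B₂ : Set X} (hB₁ : IsClosed B₁) (hB₂ : IsClosed B₂) {S : ℝ}
    (hS : ∀ x ∈ B₁, x ∈ B₂ → f x - g x ≤ S) {τ : ℝ} (hτ : 0 < τ) :
    ∃ ρ : ℝ, 0 < ρ ∧ ∀ x ∈ B₁, ∀ y ∈ B₂, edist x y ≤ ENNReal.ofReal ρ → f x - g y < S + τ := by
  let Z : Set (X × X) := (B₁ ×ˢ B₂) ∩ (fun p : X × X => f p.1 - g p.2) ⁻¹' Ici (S + τ)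
  have hZc : IsClosed Z :=
    (hB₁.prod hB₂).inter ((upperSemicontinuous_sub_prod hf hg).isClosed_preimage _)
  rcases Z.eq_empty_or_nonempty with hempty | hne
  · exact ⟨1, one_pos, fun x hx y hy _ =>
      not_le.1 fun h => hempty.subset (show (x, y) ∈ Z from ⟨⟨hx, hy⟩, h⟩)⟩
  obtain ⟨p, hpZ, hp⟩ := hZc.isCompact.exists_isMinOn hne (continuous_edist (α := X)).continuousOn
  have hpos : edist p.1 p.2 ≠ 0 := by
    intro h
    have hins : Inseparable p.1 p.2 := EMetric.inseparable_iff.2 h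
    have hpB₂ : p.1 ∈ B₂ := (hins.mem_closed_iff hB₂).2 hpZ.1.2
    have hgle : g p.1 ≤ g p.2 := not_lt.1 fun hlt => lt_irrefl (g p.2)
      ((hins.mem_open_iff (hg.isOpen_preimage (g p.2))).1 hlt)
    have hSτ : S + τ ≤ f p.1 - g p.2 := hpZ.2
    linarith [hS p.1 hpZ.1.1 hpB₂]
  obtain ⟨ρ, hρ, hρlt⟩ := ENNReal.lt_iff_exists_nnreal_btwn.1 (pos_iff_ne_zero.2 hpos)
  refine ⟨ρ, by simpa using hρ, fun x hx y hy hxy => not_le.1 fun h => ?_⟩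
  rw [ENNReal.ofReal_coe_nnreal] at hxy
  exact (hρlt.trans_le (hp (show (x, y) ∈ Z from ⟨⟨hx, hy⟩, h⟩))).not_ge hxy

-- The weight `δ` is fixed before the penalization `P`: it is chosen so small that `δ N` is
-- negligible at a point where `f - g` almost attains its supremum.
theorem exists_isMaxOn_doubling (hf : UpperSemicontinuous f) (hg : LowerSemicontinuous g)
    (hN0 : ∀ x, 0 ≤ N x) (hN : ∀ R, IsClosed {x | x ∈ A ∧ N x ≤ R}) {S τ : ℝ}
    (hS : IsLUB ((fun x => f x - g x) '' A) S) (hτ : 0 < τ) :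
    ∃ δ > 0, ∀ P : X × X → ℝ, Continuous P → (∀ x, P (x, x) = 0) →
      ∃ p₀ ∈ A ×ˢ A,
        IsMaxOn (fun p => f p.1 - g p.2 - P p - δ * (N p.1 + N p.2)) (A ×ˢ A) p₀ ∧
        S - τ ≤ f p₀.1 - g p₀.2 - P p₀ - δ * (N p₀.1 + N p₀.2) := by
  obtain ⟨_, ⟨a, ha, rfl⟩, haS, -⟩ := hS.exists_between (show S - τ / 2 < S by linarith)
  have ha0 := hN0 a
  let δ := τ / (4 * (N a + 1))
  have hδ : 0 < δ := by positivity
  have hδa : δ * (4 * (N a + 1)) = τ := div_mul_cancel₀ _ (by positivity)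
  refine ⟨δ, hδ, fun P hP hP0 => ?_⟩
  have husc : UpperSemicontinuous fun p : X × X => f p.1 - g p.2 + -P p :=
    (upperSemicontinuous_sub_prod hf hg).add hP.neg.upperSemicontinuous
  simp only [← sub_eq_add_neg] at husc
  obtain ⟨p₀, hp₀, hmax⟩ :=
    exists_isMaxOn_sub husc (isClosed_sublevel_add hN0 hN hδ) ⟨(a, a), ha, ha⟩
  refine ⟨p₀, hp₀, hmax, le_trans ?_ (hmax (show (a, a) ∈ A ×ˢ A from ⟨ha, ha⟩))⟩
  simp only [hP0]
  linarith

lemma exists_penalization_lt_of_edist_le (hf : UpperSemicontinuous f)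
    (hg : LowerSemicontinuous g) (hN0 : ∀ x, 0 ≤ N x)
    (hN : ∀ R, IsClosed {x | x ∈ A ∧ N x ≤ R}) {S τ δ : ℝ}
    (hS : IsLUB ((fun x => f x - g x) '' A) S) (hτ : 0 < τ) (hδ : 0 < δ) :
    ∃ M, ∃ ρ > 0, ∀ x ∈ A, ∀ y ∈ A, ∀ r ≥ 0, S - τ ≤ f x - g y - r - δ * (N x + N y) →
      r + δ * (N x + N y) ≤ M ∧
        (edist x y ≤ ENNReal.ofReal ρ → r + δ * (N x + N y) < 2 * τ) := by
  obtain ⟨M, hM⟩ := bddAbove_sub_prod hf hg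
  obtain ⟨ρ, hρ, hnear⟩ := exists_sub_lt_of_edist_le hf hg (hN ((M - S + τ) / δ))
    (hN ((M - S + τ) / δ)) (fun x hx _ => hS.1 ⟨x, hx.1, rfl⟩) hτ
  refine ⟨M - S + τ, ρ, hρ, fun x hx y hy r hr h => ?_⟩
  have hbound : r + δ * (N x + N y) ≤ M - S + τ := by linarith [hM x y]
  have hsum : N x + N y ≤ (M - S + τ) / δ := (le_div_iff₀' hδ).2 (by linarith)
  refine ⟨hbound, fun hxy => ?_⟩
  have := hnear x ⟨hx, by linarith [hN0 y]⟩ y ⟨hy, by linarith [hN0 x]⟩ hxy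
  linarith

end Doubling

/-! ### The viscosity inequalities at a doubled maximum -/

section ComparisonPrinciple

variable {d : ℕ} {Ω : Set (EuclideanSpace ℝ (Fin d))} {T : ℝ}

namespace GalerkinFamily

variable {η : ℝ} (𝓔 : GalerkinFamily Ω η) {ε : ℝ}

lemma distSq_comm (m n : SubProb Ω) : 𝓔.distSq m n = 𝓔.distSq n m :=
  Finset.sum_congr rfl fun _ _ => sub_sq_comm _ _

/-- The penalization of the variable doubling, a smooth test function of either variable. -/
noncomputable def penalty (ε : ℝ)
    (p : (Icc (0 : ℝ) T × SubProb Ω) × (Icc (0 : ℝ) T × SubProb Ω)) : ℝ :=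
  ε⁻¹ / 2 * (((p.1.1 : ℝ) - p.2.1) ^ 2 + 𝓔.distSq p.1.2 p.2.2)

lemma penalty_nonneg (hε : 0 < ε)
    (p : (Icc (0 : ℝ) T × SubProb Ω) × (Icc (0 : ℝ) T × SubProb Ω)) : 0 ≤ 𝓔.penalty ε p :=
  mul_nonneg (by positivity) (add_nonneg (sq_nonneg _) 𝓔.distSq_nonneg)

lemma penalty_self (ε : ℝ) (x : Icc (0 : ℝ) T × SubProb Ω) : 𝓔.penalty ε (x, x) = 0 := by
  simp [penalty, distSq]

lemma continuous_penalty (hΩ : IsOpen Ω) (ε : ℝ) :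
    Continuous (𝓔.penalty (T := T) ε) := by
  have hI : ∀ k, Continuous fun m : SubProb Ω => ∫ x, 𝓔.basis k x ∂m.meas := fun k =>
    (𝓔.isCcOn k).continuous_integral hΩ
  exact continuous_const.mul <| (by fun_prop : Continuous fun p : (Icc (0 : ℝ) T × SubProb Ω) ×
      (Icc (0 : ℝ) T × SubProb Ω) => ((p.1.1 : ℝ) - p.2.1) ^ 2).add <|
    continuous_finsetSum _ fun k _ =>
      (((hI k).comp (by fun_prop)).sub ((hI k).comp (by fun_prop))).pow 2

lemma two_mul_mul_penalty (hε : 0 < ε) (x y : Icc (0 : ℝ) T × SubProb Ω) :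
    2 * ε * 𝓔.penalty ε (x, y) = ((x.1 : ℝ) - y.1) ^ 2 + 𝓔.distSq x.2 y.2 := by
  unfold penalty
  field_simp

end GalerkinFamily

section Viscosity

variable {H : EuclideanSpace ℝ (Fin d) → EuclideanSpace ℝ (Fin d) → ℝ} {F G : SubProb Ω → ℝ}
  {Vm Vp : ℝ → SubProb Ω → ℝ}

lemma IsViscositySubsolution.exists_le_of_isMaxOn (hVm : IsViscositySubsolution T Ω H F G Vm)
    (hΩ : IsOpen Ω) :
    ∃ c > 0, ∀ {η : ℝ} (𝓔 : GalerkinFamily Ω η) (ε l s₀ : ℝ) (n₀ : SubProb Ω) {δ : ℝ}, 0 < δ →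
      ∀ t₀ ∈ Ico 0 T, ∀ m₀ : SubProb Ω, m₀.InL2 →
      (∀ t ∈ Icc 0 T, ∀ m : SubProb Ω, m.InL2 →
        Vm t m - (ε⁻¹ / 2 * ((t - s₀) ^ 2 + 𝓔.distSq m n₀) + l * (T - t)) - δ * m.l2NormSq ≤
          Vm t₀ m₀ - (ε⁻¹ / 2 * ((t₀ - s₀) ^ 2 + 𝓔.distSq m₀ n₀) + l * (T - t₀))
            - δ * m₀.l2NormSq) →
      ∃ g, IsH01 Ω m₀.density g ∧
        l - ε⁻¹ * (t₀ - s₀) + δ * (∫ x in Ω, ‖g x‖ ^ 2) - (∫ x, Δ (𝓔.potential ε m₀ n₀) x ∂m₀.meas)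
          + (∫ x, H x (∇ (𝓔.potential ε m₀ n₀) x) ∂m₀.meas) ≤ F m₀ + c * (δ * m₀.l2NormSq) := by
  obtain ⟨c, hc, htest⟩ := hVm.test
  refine ⟨c, hc, fun 𝓔 ε l s₀ n₀ δ hδ t₀ ht₀ m₀ hm₀ hmax => ?_⟩
  have hα : ∀ t, HasDerivAt (fun t => ε⁻¹ / 2 * (t - s₀) ^ 2 + l * (T - t))
      (ε⁻¹ * (t - s₀) - l) t := fun t => by
    refine (((((hasDerivAt_id t).sub_const s₀).pow 2).const_mul (ε⁻¹ / 2)).add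
      (((hasDerivAt_id t).const_sub T).const_mul l)).congr_deriv ?_
    simp only [id_eq, Nat.cast_ofNat]
    ring
  let Φ := quadTest T hΩ hα (by fun_prop) ε⁻¹ 𝓔.isCcOn fun k => ∫ x, 𝓔.basis k x ∂n₀.meas
  have hΦ : ∀ t m, Φ.toFun t m =
      ε⁻¹ / 2 * ((t - s₀) ^ 2 + 𝓔.distSq m n₀) + l * (T - t) := fun t m => by
    simp only [Φ, quadTest, GalerkinFamily.distSq]
    ring
  obtain ⟨g, hg, hle⟩ := htest Φ δ hδ t₀ ht₀ m₀ hm₀ fun p hp => by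
    simpa only [mem_ofPred_eq, hΦ] using hmax p.1 hp.1 p.2 hp.2
  have hdt : -Φ.dt t₀ m₀ = l - ε⁻¹ * (t₀ - s₀) := neg_sub _ _
  rw [hdt, mul_assoc c] at hle
  exact ⟨g, hg, hle⟩

lemma IsViscositySupersolution.exists_le_of_isMinOn (hVp : IsViscositySupersolution T Ω H F G Vp)
    (hΩ : IsOpen Ω) :
    ∃ c > 0, ∀ {η : ℝ} (𝓔 : GalerkinFamily Ω η) (ε t₀ : ℝ) (m₀ : SubProb Ω) {δ : ℝ}, 0 < δ →
      ∀ s₀ ∈ Ico 0 T, ∀ n₀ : SubProb Ω, n₀.InL2 →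
      (∀ s ∈ Icc 0 T, ∀ n : SubProb Ω, n.InL2 →
        Vp s₀ n₀ + ε⁻¹ / 2 * ((t₀ - s₀) ^ 2 + 𝓔.distSq m₀ n₀) + δ * n₀.l2NormSq ≤
          Vp s n + ε⁻¹ / 2 * ((t₀ - s) ^ 2 + 𝓔.distSq m₀ n) + δ * n.l2NormSq) →
      ∃ g, IsH01 Ω n₀.density g ∧
        F n₀ - c * (δ * n₀.l2NormSq) ≤
          -(ε⁻¹ * (t₀ - s₀)) - δ * (∫ x in Ω, ‖g x‖ ^ 2)
            - (∫ x, Δ (𝓔.potential ε m₀ n₀) x ∂n₀.meas)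
            + (∫ x, H x (∇ (𝓔.potential ε m₀ n₀) x) ∂n₀.meas) := by
  obtain ⟨c, hc, htest⟩ := hVp.test
  refine ⟨c, hc, fun 𝓔 ε t₀ m₀ δ hδ s₀ hs₀ n₀ hn₀ hmin => ?_⟩
  have hα : ∀ s, HasDerivAt (fun s => -(ε⁻¹ / 2 * (t₀ - s) ^ 2)) (ε⁻¹ * (t₀ - s)) s := fun s => by
    refine ((((hasDerivAt_id s).const_sub t₀).pow 2).const_mul (ε⁻¹ / 2)).neg.congr_deriv ?_
    simp only [id_eq, Nat.cast_ofNat]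
    ring
  let Φ := quadTest T hΩ hα (by fun_prop) (-ε⁻¹) 𝓔.isCcOn fun k => ∫ x, 𝓔.basis k x ∂m₀.meas
  have hΦ : ∀ s n, Φ.toFun s n = -(ε⁻¹ / 2 * ((t₀ - s) ^ 2 + 𝓔.distSq m₀ n)) := fun s n => by
    rw [𝓔.distSq_comm m₀]
    simp only [Φ, quadTest, GalerkinFamily.distSq]
    ring
  have hdm : Φ.dm s₀ n₀ = 𝓔.potential ε m₀ n₀ := by
    simp only [Φ, quadTest, GalerkinFamily.potential]
    refine Finset.sum_congr rfl fun k _ => congrArg (fun r : ℝ => r • 𝓔.basis k) ?_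
    ring
  obtain ⟨g, hg, hle⟩ := htest Φ δ hδ s₀ hs₀ n₀ hn₀ fun p hp => by
    simpa only [mem_ofPred_eq, hΦ, sub_neg_eq_add] using hmin p.1 hp.1 p.2 hp.2
  rw [hdm, mul_assoc c] at hle
  exact ⟨g, hg, hle⟩

theorem exists_le_of_isMaxOn_doubled (hΩ : IsOpen Ω) (hΩb : Bornology.IsBounded Ω)
    (hVm : IsViscositySubsolution T Ω H F G Vm) (hVp : IsViscositySupersolution T Ω H F G Vp)
    (hH : ContinuousOn
      (fun z : EuclideanSpace ℝ (Fin d) × EuclideanSpace ℝ (Fin d) => H z.1 z.2) (Ω ×ˢ univ))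
    {C K : ℝ≥0} (hHb : ∀ x ∈ Ω, ∀ p, |H x p| ≤ C + K * ‖p‖) :
    ∃ c > 0, ∀ {η ε δ l : ℝ} (𝓔 : GalerkinFamily Ω η), 0 ≤ η → η ≤ 1 / 2 → 0 < ε → 0 < δ →
      ε⁻¹ * (2 * η ^ 2) ≤ δ → ∀ x₀ y₀ : Icc (0 : ℝ) T × SubProb Ω,
      x₀.2.InL2 → y₀.2.InL2 → (x₀.1 : ℝ) < T → (y₀.1 : ℝ) < T →
      IsMaxOn (fun p => Vm p.1.1 p.1.2 - l * (T - p.1.1) - Vp p.2.1 p.2.2 - 𝓔.penalty ε p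
          - δ * (p.1.2.l2NormSq + p.2.2.l2NormSq))
        ({x | x.2.InL2} ×ˢ {x | x.2.InL2}) (x₀, y₀) →
      l ≤ F x₀.2 - F y₀.2
        + c * (𝓔.penalty ε (x₀, y₀) + δ * (x₀.2.l2NormSq + y₀.2.l2NormSq))
        + (C : ℝ) ^ 2 * volume.real Ω * ε := by
  obtain ⟨cm, hcm, hsub⟩ := hVm.exists_le_of_isMaxOn hΩ
  obtain ⟨cp, hcp, hsup⟩ := hVp.exists_le_of_isMinOn hΩ
  refine ⟨cm + cp + 2 * (1 + (K : ℝ) ^ 2), by positivity, ?_⟩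
  intro η ε δ l 𝓔 hη hη' hε hδ hηδ x₀ y₀ hx₀ hy₀ hx₀T hy₀T hmax
  obtain ⟨gm, hgm, hm⟩ := hsub 𝓔 ε l y₀.1 y₀.2 hδ x₀.1 ⟨x₀.1.2.1, hx₀T⟩ x₀.2 hx₀
    fun t ht m hm => by
      have := hmax (show ((⟨t, ht⟩, m), y₀) ∈ _ from ⟨hm, hy₀⟩)
      simp only [GalerkinFamily.penalty, mem_ofPred_eq] at this
      linarith
  obtain ⟨gn, hgn, hn⟩ := hsup 𝓔 ε x₀.1 x₀.2 hδ y₀.1 ⟨y₀.1.2.1, hy₀T⟩ y₀.2 hy₀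
    fun s hs n hn => by
      have := hmax (show (x₀, (⟨s, hs⟩, n)) ∈ _ from ⟨hx₀, hn⟩)
      simp only [GalerkinFamily.penalty, mem_ofPred_eq] at this
      linarith
  have hham := 𝓔.integral_laplacian_sub_hamiltonian_le hΩ.measurableSet hΩb hH hHb hη hη' hε
    hx₀ hy₀ hgm hgn
  have hgrad : ε⁻¹ * (2 * η ^ 2) * ((∫ x in Ω, ‖gm x‖ ^ 2) + ∫ x in Ω, ‖gn x‖ ^ 2) ≤
      δ * ((∫ x in Ω, ‖gm x‖ ^ 2) + ∫ x in Ω, ‖gn x‖ ^ 2) := by gcongr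
  have hdist : ε⁻¹ * 𝓔.distSq x₀.2 y₀.2 ≤ 2 * 𝓔.penalty ε (x₀, y₀) := by
    have : 0 ≤ ε⁻¹ * ((x₀.1 : ℝ) - y₀.1) ^ 2 := by positivity
    simp only [GalerkinFamily.penalty]
    linarith
  have hK := mul_le_mul_of_nonneg_left hdist (by positivity : 0 ≤ 1 + (K : ℝ) ^ 2)
  have hslack : 0 ≤ cp * (δ * x₀.2.l2NormSq) + cm * (δ * y₀.2.l2NormSq)
      + (cm + cp) * 𝓔.penalty ε (x₀, y₀)
      + 2 * (1 + (K : ℝ) ^ 2) * (δ * (x₀.2.l2NormSq + y₀.2.l2NormSq)) := by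
    have hx := x₀.2.l2NormSq_nonneg
    have hy := y₀.2.l2NormSq_nonneg
    have hpen := 𝓔.penalty_nonneg hε (x₀, y₀)
    positivity
  linarith

end Viscosity

/-! ### The comparison principle -/

section Semicontinuity

variable {V : ℝ → SubProb Ω → ℝ}

lemma upperSemicontinuous_sub_time
    (hV : UpperSemicontinuousOn (fun p : ℝ × SubProb Ω => V p.1 p.2) (Icc 0 T ×ˢ univ)) (l : ℝ) :
    UpperSemicontinuous fun x : Icc (0 : ℝ) T × SubProb Ω => V x.1 x.2 - l * (T - x.1) := by
  have hVx : UpperSemicontinuous fun x : Icc (0 : ℝ) T × SubProb Ω => V x.1 x.2 :=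
    upperSemicontinuousOn_univ_iff.1 <|
      hV.comp (g := fun x : Icc (0 : ℝ) T × SubProb Ω => ((x.1 : ℝ), x.2))
        (by fun_prop) fun x _ => ⟨x.1.2, mem_univ _⟩
  have hl : Continuous fun x : Icc (0 : ℝ) T × SubProb Ω => -(l * (T - x.1)) := by fun_prop
  simpa only [sub_eq_add_neg] using hVx.add hl.upperSemicontinuous

lemma lowerSemicontinuous_coe_prod
    (hV : LowerSemicontinuousOn (fun p : ℝ × SubProb Ω => V p.1 p.2) (Icc 0 T ×ˢ univ)) :
    LowerSemicontinuous fun x : Icc (0 : ℝ) T × SubProb Ω => V x.1 x.2 :=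
  lowerSemicontinuousOn_univ_iff.1 <|
    hV.comp (g := fun x : Icc (0 : ℝ) T × SubProb Ω => ((x.1 : ℝ), x.2))
      (by fun_prop) fun x _ => ⟨x.1.2, mem_univ _⟩

end Semicontinuity

lemma integral_density_sub_sq_le {m n : SubProb Ω} (hm : m.InL2) (hn : n.InL2) :
    ∫ x in Ω, (m.density x - n.density x) ^ 2 ≤ 2 * (m.l2NormSq + n.l2NormSq) := by
  simpa only [SubProb.l2NormSq, Real.norm_eq_abs, sq_abs] using integral_norm_sub_sq_le hm.2 hn.2

lemma eventually_le_of_continuous {u : ℝ → ℝ} {b : ℝ} (hu : Continuous u) (h : u 0 < b) :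
    ∀ᶠ ε in 𝓝[>] (0 : ℝ), u ε ≤ b :=
  ((hu.tendsto 0).eventually_le_const h).filter_mono nhdsWithin_le_nhds

lemma exists_penalization_parameters {ρ δ b : ℝ} (hρ : 0 < ρ) (hδ : 0 < δ) (hb : 0 < b)
    (C M R c : ℝ) :
    ∃ ε > 0, ∃ η > 0, η ≤ 1 / 2 ∧ ε⁻¹ * (2 * η ^ 2) ≤ δ ∧ c * ε ≤ b ∧ √(2 * ε * M) ≤ ρ ∧
      C * (√(2 * ε * M) + η * √R) ≤ ρ := by
  obtain ⟨ε, ⟨⟨hcε, hMε⟩, hCε⟩, hε⟩ :=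
    (((eventually_le_of_continuous (u := fun ε => c * ε) (by fun_prop) (by simpa using hb)).and
      (eventually_le_of_continuous (u := fun ε => √(2 * ε * M)) (by fun_prop)
        (by simpa using hρ))).and
      (eventually_le_of_continuous (u := fun ε => C * √(2 * ε * M)) (b := ρ / 2) (by fun_prop)
        (by simpa using hρ))).and self_mem_nhdsWithin |>.exists
  obtain ⟨η, ⟨⟨hη2, hηδ⟩, hCη⟩, hη⟩ :=
    (((eventually_le_of_continuous (u := fun η => η) (b := 1 / 2) (by fun_prop)
      (by norm_num)).and
      (eventually_le_of_continuous (u := fun η => ε⁻¹ * (2 * η ^ 2)) (by fun_prop)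
        (by simpa using hδ))).and
      (eventually_le_of_continuous (u := fun η => C * (η * √R)) (b := ρ / 2) (by fun_prop)
        (by simpa using hρ))).and self_mem_nhdsWithin |>.exists
  exact ⟨ε, hε, η, hη, hη2, hηδ, hcε, hMε, by linarith⟩

lemma exists_edist_le_of_penalty_le (hΩ : IsOpen Ω) (hΩb : Bornology.IsBounded Ω)
    (hΩc : Ωᶜ.Nonempty) {ρ δ b : ℝ} (hρ : 0 < ρ) (hδ : 0 < δ) (hb : 0 < b) (M c : ℝ) :
    ∃ ε > 0, ∃ η > 0, η ≤ 1 / 2 ∧ ε⁻¹ * (2 * η ^ 2) ≤ δ ∧ c * ε ≤ b ∧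
      ∀ (𝓔 : GalerkinFamily Ω η) (x y : Icc (0 : ℝ) T × SubProb Ω), x.2.InL2 → y.2.InL2 →
        𝓔.penalty ε (x, y) + δ * (x.2.l2NormSq + y.2.l2NormSq) ≤ M →
        edist x y ≤ ENNReal.ofReal ρ := by
  obtain ⟨C, hC, hgalerkin⟩ := exists_edist_le_galerkin hΩ hΩb hΩc
  obtain ⟨ε, hε, η, hη, hη2, hηδ, hcε, hMε, hCη⟩ :=
    exists_penalization_parameters hρ hδ hb C M (2 * (M / δ)) c
  refine ⟨ε, hε, η, hη, hη2, hηδ, hcε, fun 𝓔 x y hx hy hM => ?_⟩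
  have hN : 0 ≤ δ * (x.2.l2NormSq + y.2.l2NormSq) :=
    mul_nonneg hδ.le (add_nonneg x.2.l2NormSq_nonneg y.2.l2NormSq_nonneg)
  have hpen : ((x.1 : ℝ) - y.1) ^ 2 + 𝓔.distSq x.2 y.2 ≤ 2 * ε * M := by
    rw [← 𝓔.two_mul_mul_penalty hε]
    gcongr
    linarith
  have htime : |(x.1 : ℝ) - y.1| ≤ √(2 * ε * M) :=
    Real.abs_le_sqrt (by linarith [𝓔.distSq_nonneg (m := x.2) (n := y.2)])
  have hcoeff : 𝓔.distSq x.2 y.2 ≤ 2 * ε * M := by linarith [sq_nonneg ((x.1 : ℝ) - y.1)]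
  have hdensity : ∫ z in Ω, (x.2.density z - y.2.density z) ^ 2 ≤ 2 * (M / δ) := by
    refine (integral_density_sub_sq_le hx hy).trans ?_
    gcongr
    rw [le_div_iff₀' hδ]
    linarith [𝓔.penalty_nonneg hε (x, y)]
  rw [Prod.edist_eq]
  refine max_le ?_ ((hgalerkin η hη.le 𝓔 x.2 y.2 hx hy).trans ?_)
  · rw [edist_dist, Subtype.dist_eq, Real.dist_eq]
    exact ENNReal.ofReal_le_ofReal (htime.trans hMε)
  · refine ENNReal.ofReal_le_ofReal (le_trans ?_ hCη)
    gcongr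

lemma exists_lt_terminal_of_edist_le [CompactSpace (SubProb Ω)]
    {f g : Icc (0 : ℝ) T × SubProb Ω → ℝ} (hf : UpperSemicontinuous f)
    (hg : LowerSemicontinuous g) (hfg : ∀ x, (x.1 : ℝ) = T → f x ≤ g x) {κ : ℝ} (hκ : 0 < κ) :
    ∃ ρ > 0, ∀ x y, edist x y ≤ ENNReal.ofReal ρ → κ ≤ f x - g y →
      (x.1 : ℝ) < T ∧ (y.1 : ℝ) < T := by
  have hT : IsClosed {x : Icc (0 : ℝ) T × SubProb Ω | (x.1 : ℝ) = T} :=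
    isClosed_eq (by fun_prop) continuous_const
  obtain ⟨ρ₁, hρ₁, h₁⟩ := exists_sub_lt_of_edist_le hf hg hT isClosed_univ
    (fun x hx _ => sub_nonpos.2 (hfg x hx)) hκ
  obtain ⟨ρ₂, hρ₂, h₂⟩ := exists_sub_lt_of_edist_le hf hg isClosed_univ hT
    (fun x _ hx => sub_nonpos.2 (hfg x hx)) hκ
  refine ⟨min ρ₁ ρ₂, lt_min hρ₁ hρ₂, fun x y hxy hκxy => ⟨?_, ?_⟩⟩
  · refine lt_of_le_of_ne x.1.2.2 fun hx => (h₁ x hx y (mem_univ y) (hxy.trans ?_)).not_ge ?_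
    · exact ENNReal.ofReal_le_ofReal (min_le_left _ _)
    · rwa [zero_add]
  · refine lt_of_le_of_ne y.1.2.2 fun hy => (h₂ x (mem_univ x) y hy (hxy.trans ?_)).not_ge ?_
    · exact ENNReal.ofReal_le_ofReal (min_le_right _ _)
    · rwa [zero_add]

theorem exists_galerkin_doubling (hΩ : IsOpen Ω) (hΩb : Bornology.IsBounded Ω)
    (hΩc : Ωᶜ.Nonempty) {f g : Icc (0 : ℝ) T × SubProb Ω → ℝ} (hf : UpperSemicontinuous f)
    (hg : LowerSemicontinuous g) (hfg : ∀ x, (x.1 : ℝ) = T → f x ≤ g x) {S τ ρ b : ℝ}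
    (hS : IsLUB ((fun x => f x - g x) '' {x | x.2.InL2}) S) (hτ : 0 < τ) (hτS : τ ≤ S / 2)
    (hρ : 0 < ρ) (hb : 0 < b) (c : ℝ) :
    ∃ ε > 0, ∃ δ > 0, ∃ η > 0, η ≤ 1 / 2 ∧ ε⁻¹ * (2 * η ^ 2) ≤ δ ∧ c * ε ≤ b ∧
      ∃ (𝓔 : GalerkinFamily Ω η) (x₀ : Icc (0 : ℝ) T × SubProb Ω), x₀.2.InL2 ∧
      ∃ y₀ : Icc (0 : ℝ) T × SubProb Ω, y₀.2.InL2 ∧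
        IsMaxOn (fun p => f p.1 - g p.2 - 𝓔.penalty ε p
          - δ * (p.1.2.l2NormSq + p.2.2.l2NormSq))
          ({x | x.2.InL2} ×ˢ {x | x.2.InL2}) (x₀, y₀) ∧
        𝓔.penalty ε (x₀, y₀) + δ * (x₀.2.l2NormSq + y₀.2.l2NormSq) < 2 * τ ∧
        edist x₀ y₀ ≤ ENNReal.ofReal ρ ∧ (x₀.1 : ℝ) < T ∧ (y₀.1 : ℝ) < T := by
  have := compactSpace_subProb hΩ.measurableSet hΩb hΩc
  let A : Set (Icc (0 : ℝ) T × SubProb Ω) := {x | x.2.InL2}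
  have hN0 : ∀ x : Icc (0 : ℝ) T × SubProb Ω, 0 ≤ x.2.l2NormSq := fun x => x.2.l2NormSq_nonneg
  have hN : ∀ R, IsClosed {x : Icc (0 : ℝ) T × SubProb Ω | x ∈ A ∧ x.2.l2NormSq ≤ R} := fun R =>
    (isClosed_setOf_inL2_l2NormSq_le hΩ hΩb hΩc R).preimage continuous_snd
  obtain ⟨δ, hδ, hdoubling⟩ := exists_isMaxOn_doubling hf hg hN0 hN hS hτ
  obtain ⟨M, ρ₁, hρ₁, hsmall⟩ := exists_penalization_lt_of_edist_le hf hg hN0 hN hS hτ hδ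
  obtain ⟨ρ₂, hρ₂, hlt⟩ := exists_lt_terminal_of_edist_le hf hg hfg (hτ.trans_le hτS)
  obtain ⟨ε, hε, η, hη, hη2, hηδ, hcε, hclose⟩ :=
    exists_edist_le_of_penalty_le hΩ hΩb hΩc (lt_min hρ (lt_min hρ₁ hρ₂)) hδ hb M c
  obtain ⟨𝓔⟩ := nonempty_galerkinFamily hΩb hη
  obtain ⟨⟨x₀, y₀⟩, ⟨hx₀, hy₀⟩, hmax, hval⟩ :=
    hdoubling (𝓔.penalty ε) (𝓔.continuous_penalty hΩ ε) (𝓔.penalty_self ε)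
  have hP := 𝓔.penalty_nonneg hε (x₀, y₀)
  have hδN := mul_nonneg hδ.le (add_nonneg (hN0 x₀) (hN0 y₀))
  obtain ⟨hM, hpen⟩ := hsmall x₀ hx₀ y₀ hy₀ _ hP hval
  have hdist : ∀ r, min ρ (min ρ₁ ρ₂) ≤ r → edist x₀ y₀ ≤ ENNReal.ofReal r := fun r h =>
    (hclose 𝓔 x₀ y₀ hx₀ hy₀ hM).trans (ENNReal.ofReal_le_ofReal h)
  exact ⟨ε, hε, δ, hδ, η, hη, hη2, hηδ, hcε, 𝓔, x₀, hx₀, y₀, hy₀, hmax,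
    hpen (hdist _ ((min_le_right _ _).trans (min_le_left _ _))), hdist _ (min_le_left _ _),
    hlt x₀ y₀ (hdist _ ((min_le_right _ _).trans (min_le_right _ _))) (by linarith)⟩

section Comparison

variable {H : EuclideanSpace ℝ (Fin d) → EuclideanSpace ℝ (Fin d) → ℝ} {C K : ℝ≥0}
  {F G : SubProb Ω → ℝ} {Vm Vp : ℝ → SubProb Ω → ℝ}

theorem sub_time_le_of_inL2 (hΩ : IsOpen Ω) (hΩb : Bornology.IsBounded Ω) (hΩc : Ωᶜ.Nonempty)
    (hH : ContinuousOn
      (fun z : EuclideanSpace ℝ (Fin d) × EuclideanSpace ℝ (Fin d) => H z.1 z.2) (Ω ×ˢ univ))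
    (hHb : ∀ x ∈ Ω, ∀ p, |H x p| ≤ C + K * ‖p‖) (hF : Continuous F)
    (hVm : IsViscositySubsolution T Ω H F G Vm) (hVp : IsViscositySupersolution T Ω H F G Vp)
    {l : ℝ} (hl : 0 < l) {x : Icc (0 : ℝ) T × SubProb Ω} (hx : x.2.InL2) :
    Vm x.1 x.2 - l * (T - x.1) ≤ Vp x.1 x.2 := by
  by_contra! hcon
  have := compactSpace_subProb hΩ.measurableSet hΩb hΩc
  let f : Icc (0 : ℝ) T × SubProb Ω → ℝ := fun x => Vm x.1 x.2 - l * (T - x.1)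
  let g : Icc (0 : ℝ) T × SubProb Ω → ℝ := fun x => Vp x.1 x.2
  let A : Set (Icc (0 : ℝ) T × SubProb Ω) := {x | x.2.InL2}
  have hf : UpperSemicontinuous f := upperSemicontinuous_sub_time hVm.usc l
  have hg : LowerSemicontinuous g := lowerSemicontinuous_coe_prod hVp.lsc
  have hterminal : ∀ x, (x.1 : ℝ) = T → f x ≤ g x := fun x hx => by
    simpa only [f, g, hx, sub_self, mul_zero, sub_zero] using
      (hVm.terminal x.2).trans (hVp.terminal x.2)
  obtain ⟨S, hS, hS0⟩ : ∃ S, IsLUB ((fun x => f x - g x) '' A) S ∧ 0 < S := by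
    obtain ⟨M, hM⟩ := bddAbove_sub_prod hf hg
    have hLUB := isLUB_csSup ⟨_, mem_image_of_mem (fun x => f x - g x) (show x ∈ A from hx)⟩
      ⟨M, forall_mem_image.2 fun x _ => hM x x⟩
    exact ⟨_, hLUB, (sub_pos.2 hcon).trans_le (hLUB.1 (mem_image_of_mem _ hx))⟩
  obtain ⟨c, hc, hvisc⟩ := exists_le_of_isMaxOn_doubled hΩ hΩb hVm hVp hH hHb
  obtain ⟨τ, hτ, hτS, hτl⟩ : ∃ τ > 0, τ ≤ S / 2 ∧ c * (2 * τ) ≤ l / 4 := by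
    refine ⟨min (S / 2) (l / (8 * c)), by positivity, min_le_left _ _, ?_⟩
    have := (le_div_iff₀ (by positivity)).1 (min_le_right (S / 2) (l / (8 * c)))
    linarith
  obtain ⟨ρ, hρ, hFlt⟩ := exists_sub_lt_of_edist_le hF.upperSemicontinuous
    hF.lowerSemicontinuous isClosed_univ isClosed_univ (fun m _ _ => (sub_self (F m)).le)
    (show 0 < l / 4 by positivity)
  obtain ⟨ε, hε, δ, hδ, η, hη, hη2, hηδ, hCε, 𝓔, x₀, hx₀, y₀, hy₀, hmax, hpen, hxy, hx₀T, hy₀T⟩ :=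
    exists_galerkin_doubling hΩ hΩb hΩc hf hg hterminal hS hτ hτS hρ
      (show 0 < l / 4 by positivity) ((C : ℝ) ^ 2 * volume.real Ω)
  have hFxy := hFlt x₀.2 (mem_univ _) y₀.2 (mem_univ _) ((le_max_right _ _).trans hxy)
  have hcpen := mul_le_mul_of_nonneg_left hpen.le hc.le
  linarith [hvisc 𝓔 hη.le hη2 hε hδ hηδ x₀ y₀ hx₀ hy₀ hx₀T hy₀T hmax]

theorem comparison_of_inL2 (hΩ : IsOpen Ω) (hΩb : Bornology.IsBounded Ω) (hΩc : Ωᶜ.Nonempty)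
    (hH : ContinuousOn
      (fun z : EuclideanSpace ℝ (Fin d) × EuclideanSpace ℝ (Fin d) => H z.1 z.2) (Ω ×ˢ univ))
    (hHb : ∀ x ∈ Ω, ∀ p, |H x p| ≤ C + K * ‖p‖) (hF : Continuous F)
    (hVm : IsViscositySubsolution T Ω H F G Vm) (hVp : IsViscositySupersolution T Ω H F G Vp)
    {t : ℝ} (ht : t ∈ Icc 0 T) {m : SubProb Ω} (hm : m.InL2) : Vm t m ≤ Vp t m := by
  have hlim : Tendsto (fun l => Vm t m - l * (T - t)) (𝓝[>] 0) (𝓝 (Vm t m)) := by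
    have hcont : Continuous fun l => Vm t m - l * (T - t) := by fun_prop
    simpa using (hcont.tendsto 0).mono_left nhdsWithin_le_nhds
  exact le_of_tendsto hlim (eventually_mem_nhdsWithin.mono fun l hl =>
    sub_time_le_of_inL2 (x := (⟨t, ht⟩, m)) hΩ hΩb hΩc hH hHb hF hVm hVp hl hm)

lemma le_of_continuousAt (hΩ : MeasurableSet Ω) (hΩb : Bornology.IsBounded Ω)
    (hΩc : Ωᶜ.Nonempty) {U V : SubProb Ω → ℝ} (h : ∀ m : SubProb Ω, m.InL2 → U m ≤ V m)
    {m : SubProb Ω} (hU : ContinuousAt U m) (hV : ContinuousAt V m) : U m ≤ V m := by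
  refine ContinuousWithinAt.closure_le (s := {n : SubProb Ω | n.InL2}) ?_
    hU.continuousWithinAt hV.continuousWithinAt h
  refine EMetric.mem_closure_iff.2 fun r hr => ?_
  obtain ⟨c, hc, hcr⟩ := ENNReal.lt_iff_exists_nnreal_btwn.1 hr
  obtain ⟨n, hn, hnm⟩ := exists_inL2_edist_le hΩ hΩb hΩc m (r := c) (by simpa using hc)
  rw [ENNReal.ofReal_coe_nnreal] at hnm
  exact ⟨n, hn, (edist_comm m n).trans_lt (hnm.trans_lt hcr)⟩

end Comparison

end ComparisonPrinciple

end AbsorbedMFC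

theorem theorem1p1_general (d : ℕ) (hd : 0 < d) (T : ℝ) (Ω : Set (EuclideanSpace ℝ (Fin d)))
    (hΩ : IsOpen Ω) (hΩb : Bornology.IsBounded Ω)
    (H : EuclideanSpace ℝ (Fin d) → EuclideanSpace ℝ (Fin d) → ℝ)
    (hH : ContinuousOn
      (fun z : EuclideanSpace ℝ (Fin d) × EuclideanSpace ℝ (Fin d) => H z.1 z.2) (Ω ×ˢ univ))
    (hHb : ∃ C K : ℝ≥0, ∀ x ∈ Ω, ∀ p, |H x p| ≤ C + K * ‖p‖)
    (F G : AbsorbedMFC.SubProb Ω → ℝ) (hF : Continuous F)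
    (Vm Vp : ℝ → AbsorbedMFC.SubProb Ω → ℝ)
    (hVm : AbsorbedMFC.IsViscositySubsolution T Ω H F G Vm)
    (hVp : AbsorbedMFC.IsViscositySupersolution T Ω H F G Vp) :
    (∀ t ∈ Icc 0 T, ∀ m : AbsorbedMFC.SubProb Ω, m.InL2 → Vm t m ≤ Vp t m) ∧
    (∀ t ∈ Icc 0 T, ∀ m : AbsorbedMFC.SubProb Ω,
      ContinuousAt (Vm t) m → ContinuousAt (Vp t) m → Vm t m ≤ Vp t m) := by
  obtain ⟨C, K, hHb⟩ := hHb
  have : Nonempty (Fin d) := ⟨⟨0, hd⟩⟩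
  have hΩc : Ωᶜ.Nonempty := nonempty_compl.2 fun h =>
    NormedSpace.unbounded_univ ℝ (EuclideanSpace ℝ (Fin d)) (h ▸ hΩb)
  have hL2 : ∀ t ∈ Icc 0 T, ∀ m : AbsorbedMFC.SubProb Ω, m.InL2 → Vm t m ≤ Vp t m :=
    fun t ht m hm => AbsorbedMFC.comparison_of_inL2 hΩ hΩb hΩc hH hHb hF hVm hVp ht hm
  exact ⟨hL2, fun t ht m =>
    AbsorbedMFC.le_of_continuousAt hΩ.measurableSet hΩb hΩc (hL2 t ht)⟩

theorem theorem1p1 (d : ℕ) (hd : 0 < d) (T : ℝ) (hT : 0 < T)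
    (Ω : Set (EuclideanSpace ℝ (Fin d))) (hΩ : AbsorbedMFC.IsSmoothBoundedDomain Ω)
    (H : EuclideanSpace ℝ (Fin d) → EuclideanSpace ℝ (Fin d) → ℝ)
    (hH : ∃ K : ℝ≥0, LipschitzOnWith K
      (fun z : EuclideanSpace ℝ (Fin d) × EuclideanSpace ℝ (Fin d) => H z.1 z.2) (Ω ×ˢ univ))
    (F G : AbsorbedMFC.SubProb Ω → ℝ)
    (hF : AbsorbedMFC.IsC1 F) (hF' : ∃ K : ℝ≥0, LipschitzWith K F)
    (hG : AbsorbedMFC.IsC1 G) (hG' : ∃ K : ℝ≥0, LipschitzWith K G)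
    (Vm Vp : ℝ → AbsorbedMFC.SubProb Ω → ℝ)
    (hVm : AbsorbedMFC.IsViscositySubsolution T Ω H F G Vm)
    (hVp : AbsorbedMFC.IsViscositySupersolution T Ω H F G Vp) :
    (∀ t ∈ Icc 0 T, ∀ m : AbsorbedMFC.SubProb Ω, m.InL2 → Vm t m ≤ Vp t m) ∧
    (∀ t ∈ Icc 0 T, ∀ m : AbsorbedMFC.SubProb Ω,
      ContinuousAt (Vm t) m → ContinuousAt (Vp t) m → Vm t m ≤ Vp t m) := by
  obtain ⟨K, hK⟩ := hH
  obtain ⟨L, hL⟩ := hF'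
  obtain ⟨C, hC⟩ := AbsorbedMFC.exists_linear_growth_of_lipschitzOnWith hΩ.isBounded hK
  exact theorem1p1_general d hd T Ω hΩ.isOpen hΩ.isBounded H hK.continuousOn ⟨C, K, hC⟩ F G
    hL.continuous Vm Vp hVm hVp
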